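/- **Setting.** Let $D_m$ be the set of càdlàg paths $x:[0,\infty)\to\mathbb R^m$, with $x(0-):=x(0)$ and $\Delta x(t):=x(t)-x(t-)$; write $x_t:=x(\cdot\wedge t)$, and let $x_{t-}$ be the path equal to $x$ on $[0,t)$ and to $x(t-)$ on $[t,\infty)$. Fix finite partitions $\pi_n=(0=t^n_0<\dots<t^n_{k_n})$ with $t^n_{k_n}\to\infty$ and mesh vanishing on compacts. For $t_i=t^n_i\in\pi_n$ let $t_{i+1}$ be the next point of $\pi_n$ (with $t_{k_n+1}:=t_{k_n}$), let $x^n$ be the path with $x^n=x(t_{i+1})$ on $[t_i,t_{i+1})$, continued by its last value, and let $t'_n:=\max\{t_i\in\pi_n: t_i<t\}$ ($:=0$ if there is none). *Quadratic variation.* $Q^\pi_m$ is the set of $x\in D_m$ for which $q_n(t)=\sum_{\pi_n\ni t_i\le t}(x(t_{i+1})-x(t_i))(x(t_{i+1})-x(t_i))'$ converges in the Skorokhod $J_1$ topology; the limit is $[x]=([x_i,x_j])_{i,j}$. *Domains.* A nonempty $\Omega\subset D_m$ is *generic* if (i) for all $x\in\Omega$, $T>0$ one has $(x^n)_T\in\Omega$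 for all large $n$; (ii) for all $x\in\Omega$, $t\ge0$ there is a convex neighbourhood $U$ of $0$ with $-\Delta x(t)\in U$ and $x_t+e1_{[t,\infty)}\in\Omega$ for all $e\in U$. Put $\Lambda=\{(t,x_t):t\ge0,\ x\in\Omega\}$. *Regularity.* For a functional $F$ on $\Lambda$ put $F_-(t,x_t):=F(t,x_{t-})$; $F$ is *strictly causal* if $F=F_-$. $F$ is *left-continuous* if for all $x\in\Omega$, $t\ge0$ the following converge to $F(t,x_{t-})$: $F(s,x_{s-})$ as $s\uparrow t$ ($s\le t$); $F(s,x_s)$ as $s\uparrow t$ ($s<t$); $F(s_n,x^n_{s_n-})$ whenever $s_n\to t$, $s_n\le t'_n$; $F(s_n,x^n_{s_n})$ whenever $s_n\to t$, $s_n<t'_n$. It is *right-continuous* if the following converge to $F(t,x_t)$: $F(s,x_s)$ as $s\downarrow t$ ($s\ge t$); $F(s,x_{s-})$ as $s\downarrow t$ ($s>t$); $F(s_n,x^n_{s_n})$ whenever $s_n\to t$, $s_n\ge t'_n$; $F(s_n,x^n_{s_n-})$ whenever $s_n\to t$, $s_n>t'_n$. The $\pi$-topology on $\Lambda$ is the initial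 topology of all real functionals that are both left- and right-continuous; *continuous* means continuous for it. $F$ is *locally bounded* if for all $x\in\Omega$, $T\ge0$ there are $n_0,K$ with $|F(t,x^n_t)|\le K$ for all $n\ge n_0$, $t\le T$. The horizontal derivative is $\mathcal DF(t,x_t)=\lim_{h\downarrow0}(F(t+h,x_t)-F(t,x_t))/h$, and the vertical derivative $\nabla_xF(t,x_t)$ is the gradient at $e=0$ of $e\mapsto F(t,x_t+e1_{[t,\infty)})$. $\mathcal M_b(\Lambda)$ is the set of continuous $F:\Lambda\to\mathbb R$ that are horizontally and vertically differentiable on $\Lambda$ with $\mathcal DF=0$ and with $\nabla_xF$ left-continuous, strictly causal and locally bounded. Put $\mathfrak L_b(\Lambda)=\{\nabla_xF:F\in\mathcal M_b(\Lambda)\}$. *Integrals.* Let $\phi:\Lambda\to\mathbb R^m$ with $\phi_-$ left-continuous. It is *$\Lambda$-integrable* if for all $x\in\Omega$, $t\ge0$ the limit $$\Big(\int\phi\,dx\Big)(t,x_t):=\lim_n\sum_{\pi_n\ni t_i\le t}\phi(t_i,x^n_{t_i-})\cdot(x(t_{i+1})-x(t_i))$$ exists, depends only on $(t,x_t)$,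 and is a continuous functional on $\Lambda$. For $\phi,\psi\in\mathfrak L_b(\Lambda)$ put $$\{\phi,\psi\}(t,x_t):=\Big(\psi\int\phi\,dx+\phi\int\psi\,dx\Big)(t,x_{t-}).$$ **Theorem (pathwise Kunita–Watanabe identity).** Let $\Omega\subset Q^\pi_m$ be generic and let $\phi,\psi\in\mathfrak L_b(\Lambda)$. Then $\phi$ and $\psi$ are $\Lambda$-integrable, $\{\phi,\psi\}\in\mathfrak L_b(\Lambda)$, $\{\phi,\psi\}$ is $\Lambda$-integrable, and for all $x\in\Omega$ and $t\ge0$ $$\Big(\int\phi\,dx\Big)(t,x_t)\,\Big(\int\psi\,dx\Big)(t,x_t)=\sum_{i,j=1}^m\int_{(0,t]}\phi_i(s,x_{s-})\,\psi_j(s,x_{s-})\,d[x_i,x_j](s)+\Big(\int\{\phi,\psi\}\,dx\Big)(t,x_t),$$ where each $[x_i,x_j]$ has bounded variation on $[0,t]$ and the integrals against it are Lebesgue–Stieltjes integrals that exist. -/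

import Mathlib

open Set Filter Topology MeasureTheory
open scoped NNReal

noncomputable section

namespace CausalCalculus

/-- Functions from `[0, ∞)` to `ℝ^m` (Euclidean norm). -/
abbrev Traj (m : ℕ) : Type := ℝ≥0 → EuclideanSpace ℝ (Fin m)

/-- Maps defined on pairs (time, path). Such a map is regarded as a functional on a domain `Λ` of
stopped paths; every notion below only looks at its values on `Λ`. -/
abbrev Functional (m : ℕ) (V : Type*) : Type _ := ℝ≥0 → Traj m → V

/-! ### Paths -/

/-- Right-continuous with left limits (the left limit at `0` is a void requirement). -/
def IsCadlag {V : Type*} [TopologicalSpace V] (x : ℝ≥0 → V) : Prop :=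
  ∀ t, ContinuousWithinAt x (Ici t) t ∧ ∃ l, Tendsto x (𝓝[<] t) (𝓝 l)

/-- `x_t`, the path `x` stopped at `t`. -/
def stopAt {m : ℕ} (x : Traj m) (t : ℝ≥0) : Traj m := fun s => x (min s t)

/-- `x_{t-}`: equal to `x` before `t` and to `x(t-)` from `t` on. `Function.leftLim x 0 = x 0`, which
is the convention `x(0-) = x(0)`. -/
def stopLeft {m : ℕ} (x : Traj m) (t : ℝ≥0) : Traj m :=
  fun s => if s < t then x s else Function.leftLim x t

/-- `x_t + e 1_{[t, ∞)}`. -/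
def bump {m : ℕ} (x : Traj m) (t : ℝ≥0) (e : EuclideanSpace ℝ (Fin m)) : Traj m :=
  fun s => stopAt x t s + if t ≤ s then e else 0

/-! ### Partitions -/

/-- A sequence of finite partitions `0 = t^n_0 < ... < t^n_{k_n}` with `t^n_{k_n} → ∞`. -/
structure PartitionSeq where
  pts : ℕ → Finset ℝ≥0
  zero_mem : ∀ n, 0 ∈ pts n
  tendsto_last : Tendsto (fun n => (pts n).sup id) atTop atTop

namespace PartitionSeq

/-- The smallest point of the `n`-th partition that is `> t`; the last point if there is none. -/
def next (π : PartitionSeq) (n : ℕ) (t : ℝ≥0) : ℝ≥0 :=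
  if h : ((π.pts n).filter (fun s => t < s)).Nonempty then
    ((π.pts n).filter (fun s => t < s)).min' h
  else (π.pts n).sup id

/-- `t'_n`, the largest point of the `n`-th partition that is `< t`; `0` if there is none. -/
def prev (π : PartitionSeq) (n : ℕ) (t : ℝ≥0) : ℝ≥0 :=
  ((π.pts n).filter (fun s => s < t)).sup id

/-- The mesh vanishes on compacts: intervals that start in `[0, T]` become uniformly short. -/
def VanishingMesh (π : PartitionSeq) : Prop :=
  ∀ T : ℝ≥0, ∀ ε : ℝ, 0 < ε → ∀ᶠ n in atTop, ∀ s ∈ π.pts n, s ≤ T →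
    (π.next n s : ℝ) - (s : ℝ) < ε

end PartitionSeq

/-- `x^n = ∑ x(t_{i+1}) 1_{[t_i, t_{i+1})}` (continued by its last value). -/
def approx {m : ℕ} (π : PartitionSeq) (n : ℕ) (x : Traj m) : Traj m :=
  fun s => x (π.next n s)

/-! ### Quadratic variation -/

/-- Convergence in the Skorokhod `J₁` topology on functions on `[0, ∞)`: there are time changes
`l n`, increasing bijections of `[0, ∞)`, such that `l n → id` uniformly and `z n ∘ l n → z`
uniformly on every `[0, N]`. -/
def SkorokhodTendsto {V : Type*} [UniformSpace V] (z : ℕ → ℝ≥0 → V) (z' : ℝ≥0 → V) : Prop :=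
  ∃ l : ℕ → (ℝ≥0 ≃o ℝ≥0), TendstoUniformly (fun n s => l n s) (fun s => s) atTop ∧
    ∀ N : ℝ≥0, TendstoUniformlyOn (fun n s => z n (l n s)) z' atTop (Iic N)

/-- `q_n(t) = ∑_{t_i ≤ t} (x(t_{i+1}) - x(t_i)) (x(t_{i+1}) - x(t_i))'`. -/
def qvSum {m : ℕ} (π : PartitionSeq) (x : Traj m) (n : ℕ) (t : ℝ≥0) : Matrix (Fin m) (Fin m) ℝ :=
  ∑ s ∈ (π.pts n).filter (fun s => s ≤ t),
    Matrix.vecMulVec (fun i => x (π.next n s) i - x s i) (fun j => x (π.next n s) j - x s j)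

/-- `q` is the quadratic variation of `x` along `π`. -/
def HasQuadVar {m : ℕ} (π : PartitionSeq) (x : Traj m) (q : ℝ≥0 → Matrix (Fin m) (Fin m) ℝ) :
    Prop :=
  IsCadlag q ∧ SkorokhodTendsto (qvSum π x) q

/-- `Q^π_m`: càdlàg paths with finite quadratic variation along `π`. -/
def finiteQV (m : ℕ) (π : PartitionSeq) : Set (Traj m) :=
  {x | IsCadlag x ∧ ∃ q, HasQuadVar π x q}

open Classical in
/-- `[x]`, the quadratic variation of `x` along `π` (`0` if there is none). -/
def quadVar {m : ℕ} (π : PartitionSeq) (x : Traj m) : ℝ≥0 → Matrix (Fin m) (Fin m) ℝ :=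
  if h : ∃ q, HasQuadVar π x q then h.choose else 0

/-! ### Lebesgue–Stieltjes integrals on `(0, t]` -/

/-- `g` has bounded variation on `[0, t]`, and `f` is integrable on `(0, t]` with respect to the
total variation of the signed measure `dg`. -/
def StieltjesIntegrable (f g : ℝ≥0 → ℝ) (t : ℝ≥0) : Prop :=
  ∃ h : BoundedVariationOn (fun s => g (min s t)) univ, h.vectorMeasure.IntegrableOn f (Ioc 0 t)

open Classical in
/-- `∫_{(0, t]} f dg`, for `g` of bounded variation on `[0, t]`. -/
def stieltjesIntegral (f g : ℝ≥0 → ℝ) (t : ℝ≥0) : ℝ :=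
  if h : BoundedVariationOn (fun s => g (min s t)) univ then
    (h.vectorMeasure.restrict (Ioc 0 t)).integral f (ContinuousLinearMap.lsmul ℝ ℝ)
  else 0

/-! ### Generic sets of paths and domains -/

/-- Generic sets of càdlàg paths. -/
structure IsGeneric {m : ℕ} (π : PartitionSeq) (Ω : Set (Traj m)) : Prop where
  nonempty : Ω.Nonempty
  cadlag : ∀ x ∈ Ω, IsCadlag x
  approx_mem : ∀ x ∈ Ω, ∀ T : ℝ≥0, 0 < T → ∃ N : ℕ, ∀ n ≥ N, stopAt (approx π n x) T ∈ Ω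
  bump_mem : ∀ x ∈ Ω, ∀ t : ℝ≥0, ∃ U ∈ 𝓝 (0 : EuclideanSpace ℝ (Fin m)), Convex ℝ U ∧
    -(x t - Function.leftLim x t) ∈ U ∧ ∀ e ∈ U, bump x t e ∈ Ω

/-- The domain `Λ = {(t, x_t) : t ≥ 0, x ∈ Ω}` of stopped paths. -/
def domain {m : ℕ} (Ω : Set (Traj m)) : Set (ℝ≥0 × Traj m) :=
  {z | ∃ t : ℝ≥0, ∃ x ∈ Ω, z = (t, stopAt x t)}

/-! ### Regularity of functionals -/

/-- `F_-(t, x_t) = F(t, x_{t-})`. -/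
def leftVersion {m : ℕ} {V : Type*} (F : Functional m V) : Functional m V :=
  fun t x => F t (stopLeft x t)

/-- `F = F_-` on `Λ`. -/
def StrictlyCausal {m : ℕ} {V : Type*} (Ω : Set (Traj m)) (F : Functional m V) : Prop :=
  ∀ z ∈ domain Ω, F z.1 z.2 = leftVersion F z.1 z.2

/-- Left-continuous functionals. -/
structure LeftCont {m : ℕ} {V : Type*} [TopologicalSpace V] (π : PartitionSeq) (Ω : Set (Traj m))
    (F : Functional m V) : Prop where
  a : ∀ x ∈ Ω, ∀ t, Tendsto (fun s => F s (stopLeft x s)) (𝓝[≤] t) (𝓝 (F t (stopLeft x t)))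
  b : ∀ x ∈ Ω, ∀ t, Tendsto (fun s => F s (stopAt x s)) (𝓝[<] t) (𝓝 (F t (stopLeft x t)))
  c : ∀ x ∈ Ω, ∀ t, ∀ τ : ℕ → ℝ≥0, Tendsto τ atTop (𝓝 t) → (∀ n, τ n ≤ π.prev n t) →
    Tendsto (fun n => F (τ n) (stopLeft (approx π n x) (τ n))) atTop (𝓝 (F t (stopLeft x t)))
  d : ∀ x ∈ Ω, ∀ t, ∀ τ : ℕ → ℝ≥0, Tendsto τ atTop (𝓝 t) → (∀ n, τ n < π.prev n t) →
    Tendsto (fun n => F (τ n) (stopAt (approx π n x) (τ n))) atTop (𝓝 (F t (stopLeft x t)))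

/-- Right-continuous functionals. -/
structure RightCont {m : ℕ} {V : Type*} [TopologicalSpace V] (π : PartitionSeq) (Ω : Set (Traj m))
    (F : Functional m V) : Prop where
  a : ∀ x ∈ Ω, ∀ t, Tendsto (fun s => F s (stopAt x s)) (𝓝[≥] t) (𝓝 (F t (stopAt x t)))
  b : ∀ x ∈ Ω, ∀ t, Tendsto (fun s => F s (stopLeft x s)) (𝓝[>] t) (𝓝 (F t (stopAt x t)))
  c : ∀ x ∈ Ω, ∀ t, ∀ τ : ℕ → ℝ≥0, Tendsto τ atTop (𝓝 t) → (∀ n, π.prev n t ≤ τ n) →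
    Tendsto (fun n => F (τ n) (stopAt (approx π n x) (τ n))) atTop (𝓝 (F t (stopAt x t)))
  d : ∀ x ∈ Ω, ∀ t, ∀ τ : ℕ → ℝ≥0, Tendsto τ atTop (𝓝 t) → (∀ n, π.prev n t < τ n) →
    Tendsto (fun n => F (τ n) (stopLeft (approx π n x) (τ n))) atTop (𝓝 (F t (stopAt x t)))

/-- The `π`-topology on `Λ`: the initial topology of the functionals `Λ → ℝ` that are both
left- and right-continuous. -/
@[reducible] def piTopology {m : ℕ} (π : PartitionSeq) (Ω : Set (Traj m)) :
    TopologicalSpace (domain Ω) :=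
  ⨅ F : {F : Functional m ℝ // LeftCont π Ω F ∧ RightCont π Ω F},
    TopologicalSpace.induced (fun z : domain Ω => F.1 z.1.1 z.1.2) inferInstance

/-- `F ∈ C_π(Λ)`. -/
def PiContinuous {m : ℕ} (π : PartitionSeq) (Ω : Set (Traj m)) (F : Functional m ℝ) : Prop :=
  Continuous[piTopology π Ω, inferInstance] (fun z : domain Ω => F z.1.1 z.1.2)

/-- Locally bounded functionals: bounded on `[0, T]` along `x^n`, uniformly in large `n`. -/
def LocBounded {m : ℕ} {V : Type*} [Norm V] (π : PartitionSeq) (Ω : Set (Traj m))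
    (F : Functional m V) : Prop :=
  ∀ x ∈ Ω, ∀ T : ℝ≥0, ∃ n₀ : ℕ, ∃ K : ℝ, ∀ n ≥ n₀, ∀ t ≤ T, ‖F t (stopAt (approx π n x) t)‖ ≤ K

/-! ### Differentiability -/

/-- The horizontal derivative exists on `Λ`. -/
def HorizDifferentiable {m : ℕ} (Ω : Set (Traj m)) (F : Functional m ℝ) : Prop :=
  ∀ z ∈ domain Ω, ∃ d : ℝ,
    Tendsto (fun h : ℝ≥0 => (F (z.1 + h) z.2 - F z.1 z.2) / (h : ℝ)) (𝓝[>] 0) (𝓝 d)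

/-- The horizontal derivative `𝒟F`. -/
def horizDeriv {m : ℕ} (F : Functional m ℝ) : Functional m ℝ :=
  fun t x => limUnder (𝓝[>] (0 : ℝ≥0)) (fun h : ℝ≥0 => (F (t + h) x - F t x) / (h : ℝ))

/-- The vertical derivative exists on `Λ`. -/
def VertDifferentiable {m : ℕ} (Ω : Set (Traj m)) (F : Functional m ℝ) : Prop :=
  ∀ z ∈ domain Ω, DifferentiableAt ℝ (fun e => F z.1 (bump z.2 z.1 e)) 0

/-- The vertical derivative `∇ₓF`. -/
def vertDeriv {m : ℕ} (F : Functional m ℝ) : Functional m (EuclideanSpace ℝ (Fin m)) :=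
  fun t x => gradient (fun e => F t (bump x t e)) 0

/-- Class `𝒮`. -/
structure ClassS {m : ℕ} (π : PartitionSeq) (Ω : Set (Traj m)) (F : Functional m ℝ) : Prop where
  continuous : PiContinuous π Ω F
  horizDiff : HorizDifferentiable Ω F
  vertDiff : VertDifferentiable Ω F
  horiz_rightCont : RightCont π Ω (horizDeriv F)
  horiz_locBounded : LocBounded π Ω (horizDeriv F)
  vert_leftCont : LeftCont π Ω (vertDeriv F)
  vert_strictlyCausal : StrictlyCausal Ω (vertDeriv F)

/-- Class `ℳ`. -/
def ClassM {m : ℕ} (π : PartitionSeq) (Ω : Set (Traj m)) (F : Functional m ℝ) : Prop :=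
  ClassS π Ω F ∧ ∀ z ∈ domain Ω, horizDeriv F z.1 z.2 = 0

/-- Class `ℳ_b`. -/
def ClassMb {m : ℕ} (π : PartitionSeq) (Ω : Set (Traj m)) (F : Functional m ℝ) : Prop :=
  ClassM π Ω F ∧ LocBounded π Ω (vertDeriv F)

/-- `𝔏_b(Λ)`: the functionals that coincide on `Λ` with `∇ₓF` for some `F ∈ ℳ_b(Λ)`. -/
def Lb {m : ℕ} (π : PartitionSeq) (Ω : Set (Traj m)) :
    Set (Functional m (EuclideanSpace ℝ (Fin m))) :=
  {φ | ∃ F : Functional m ℝ, ClassMb π Ω F ∧ ∀ z ∈ domain Ω, φ z.1 z.2 = vertDeriv F z.1 z.2}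

/-! ### Pathwise integrals -/

/-- `∑_{t_i ≤ t} φ(t_i, x^n_{t_i-}) · (x(t_{i+1}) - x(t_i))`. -/
def riemannSum {m : ℕ} (π : PartitionSeq) (φ : Functional m (EuclideanSpace ℝ (Fin m)))
    (t : ℝ≥0) (x : Traj m) (n : ℕ) : ℝ :=
  ∑ s ∈ (π.pts n).filter (fun s => s ≤ t),
    inner ℝ (φ s (stopLeft (approx π n x) s)) (x (π.next n s) - x s)

/-- The pathwise integral `(∫ φ dx)(t, x)`, the limit of the left Riemann sums. -/
def pathIntegral {m : ℕ} (π : PartitionSeq) (φ : Functional m (EuclideanSpace ℝ (Fin m))) :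
    Functional m ℝ :=
  fun t x => limUnder atTop (riemannSum π φ t x)

/-- `Λ`-integrable functionals: the left Riemann sums along every `x ∈ Ω` converge at every time `t`,
the limit is a function of `(t, x_t)`, and it is a continuous functional. -/
structure PathIntegrable {m : ℕ} (π : PartitionSeq) (Ω : Set (Traj m))
    (φ : Functional m (EuclideanSpace ℝ (Fin m))) : Prop where
  leftCont : LeftCont π Ω (leftVersion φ)
  tendsto : ∀ x ∈ Ω, ∀ t,
    Tendsto (riemannSum π φ t x) atTop (𝓝 (pathIntegral π φ t (stopAt x t)))
  continuous : PiContinuous π Ω (pathIntegral π φ)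

/-- `{φ, ψ}(t, x) = (ψ ∫ φ dx + φ ∫ ψ dx)(t, x_{t-})`. -/
def bracket {m : ℕ} (π : PartitionSeq) (φ ψ : Functional m (EuclideanSpace ℝ (Fin m))) :
    Functional m (EuclideanSpace ℝ (Fin m)) :=
  leftVersion fun t x => pathIntegral π φ t x • ψ t x + pathIntegral π ψ t x • φ t x

end CausalCalculus

end

open CausalCalculus

/-! Write `φ = ∇F` on the domain with `F ∈ ℳ_b`. Since `𝒟F = 0` and `F` is continuous, `F` does not
move while the path is frozen (`ClassM.horizConst`). Since `∇F` is strictly causal, `e ↦ F(t, x_t +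
e 1_{[t,∞)})` is affine on the convex set of admissible bumps, so for every jump `F(t, x_t) = F(t,
x_{t-}) + φ(t, x_{t-}) · Δx(t)` (`ClassS.jump_eq`). These two facts, together with continuity of `F`
and the regularity of `φ`, form `IsPrimitive`. The path `x^n` is a step path whose jump at `t_i > 0`
is `x(t_{i+1}) - x(t_i)`; so `F` telescopes along `x^n` into Riemann sums, and right-continuity of
`F` gives `∫ φ dx = F - F(0, ·)`.

Let `A` and `B` be the integrals of `φ` and `ψ`, and `C = ∑ ∫ φ_i ψ_j d[x_i, x_j]`. The product `AB`
has jump `A_- (ψ · Δx) + B_- (φ · Δx) + (φ · Δx)(ψ · Δx)`, and the last term is the jump of `C`. If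
`C` is continuous and horizontally constant, then `AB - C` is a primitive of `{φ, ψ}`, vanishes at
time `0`, and hence equals `∫ {φ, ψ} dx`. This is the claim (`isPrimitive_bracketPrimitive`).

The analytic work is the continuity of `C`. It requires limits of quadratic sums jointly in `(n, s)
→ (∞, t)`: the limit is `C(t)` when `s ≥ t'_n` and `C(t)` minus its jump when `s < t'_n`. For sums
of squared increments this follows from `J₁` convergence, because at a jump of the limit the time
change must eventually send `t` exactly to `t'_n` (`eventually_timeChange_eq_prev`). Weighted sums
at a fixed time converge to Stieltjes integrals by dominated convergence after a quantile change of
variables (`IsWeightLimit.tendsto_sum`), and polarization handles mixed entries. A comparison with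
the sums of `|x(t_{i+1}) - x(t_i)|²` makes the convergence joint (`tendsto_crossSum_sub`). -/

namespace CausalCalculus

/-! ### Stopped paths -/

section Paths

variable {m : ℕ} {x y : Traj m} {s t : ℝ≥0}

/-- The jump `Δx(t) = x(t) - x(t-)`. -/
noncomputable def jump {m : ℕ} (x : Traj m) (t : ℝ≥0) : EuclideanSpace ℝ (Fin m) :=
  x t - Function.leftLim x t

/-- The value at `t` matters because `Function.leftLim` falls back on it at `t = 0` and where no
left limit exists; in exchange, no regularity of the functions is needed. -/
theorem leftLim_congr {E : Type*} [TopologicalSpace E] [T2Space E] {x y : ℝ≥0 → E} {t : ℝ≥0}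
    (h : ∀ s < t, x s = y s) (ht : x t = y t) :
    Function.leftLim x t = Function.leftLim y t := by
  have h' : x =ᶠ[𝓝[<] t] y := by
    filter_upwards [self_mem_nhdsWithin] with s hs using h s hs
  rcases (𝓝[<] t).eq_or_neBot with hne | hne
  · rw [leftLim_eq_of_eq_bot _ hne, leftLim_eq_of_eq_bot _ hne, ht]
  · by_cases hl : ∃ l, Tendsto x (𝓝[<] t) (𝓝 l)
    · obtain ⟨l, hl⟩ := hl
      rw [leftLim_eq_of_tendsto hl, leftLim_eq_of_tendsto (hl.congr' h')]
    · rw [leftLim_eq_of_not_tendsto _ hl, leftLim_eq_of_not_tendsto _ (by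
        simpa only [← tendsto_congr' h'] using hl), ht]

theorem leftLim_zero {E : Type*} [TopologicalSpace E] (x : ℝ≥0 → E) :
    Function.leftLim x 0 = x 0 :=
  leftLim_eq_of_isBot isBot_bot

theorem IsCadlag.tendsto_leftLim {E : Type*} [TopologicalSpace E] [T2Space E] {x : ℝ≥0 → E}
    (hx : IsCadlag x) (t : ℝ≥0) : Tendsto x (𝓝[<] t) (𝓝 (Function.leftLim x t)) :=
  tendsto_leftLim_of_tendsto (hx t).2

theorem IsCadlag.tendsto_right {E : Type*} [TopologicalSpace E] {x : ℝ≥0 → E}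
    (hx : IsCadlag x) (t : ℝ≥0) : Tendsto x (𝓝[≥] t) (𝓝 (x t)) := (hx t).1

/-- The left limit only depends on the values before `t`, for paths with left limits. -/
theorem leftLim_congr_of_pos {E : Type*} [TopologicalSpace E] [T2Space E] {x y : ℝ≥0 → E}
    (hx : ∃ l, Tendsto x (𝓝[<] t) (𝓝 l)) (ht : 0 < t) (h : ∀ s < t, x s = y s) :
    Function.leftLim x t = Function.leftLim y t := by
  have hne : (𝓝[<] t).NeBot := nhdsLT_neBot_of_exists_lt ⟨0, ht⟩
  obtain ⟨l, hl⟩ := hx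
  have h' : x =ᶠ[𝓝[<] t] y := by
    filter_upwards [self_mem_nhdsWithin] with s hs using h s hs
  rw [leftLim_eq_of_tendsto hl, leftLim_eq_of_tendsto (hl.congr' h')]

theorem stopAt_apply_of_le (h : s ≤ t) : stopAt x t s = x s := by simp [stopAt, h]

theorem stopAt_apply_of_ge (h : t ≤ s) : stopAt x t s = x t := by simp [stopAt, h]

theorem stopAt_stopAt_of_le (h : s ≤ t) : stopAt (stopAt x t) s = stopAt x s := by
  funext r; simp [stopAt, h]

theorem stopAt_stopAt_of_ge (h : t ≤ s) : stopAt (stopAt x t) s = stopAt x t := by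
  funext r; simp [stopAt, min_assoc, h]

theorem stopLeft_apply_of_lt (h : s < t) : stopLeft x t s = x s := by simp [stopLeft, h]

theorem stopLeft_apply_of_ge (h : t ≤ s) : stopLeft x t s = Function.leftLim x t := by
  simp [stopLeft, h.not_gt]

theorem stopAt_congr (h : ∀ r ≤ t, x r = y r) : stopAt x t = stopAt y t := by
  funext r; exact h _ (min_le_right _ _)

theorem stopLeft_congr (h : ∀ r < t, x r = y r) (ht : x t = y t) :
    stopLeft x t = stopLeft y t := by
  funext r
  unfold stopLeft
  rw [leftLim_congr h ht]
  split_ifs with hr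
  · exact h r hr
  · rfl

theorem stopLeft_congr_of_pos (hx : IsCadlag x) (ht : 0 < t) (h : ∀ r < t, x r = y r) :
    stopLeft x t = stopLeft y t := by
  funext r
  unfold stopLeft
  rw [leftLim_congr_of_pos (hx t).2 ht h]
  split_ifs with hr
  · exact h r hr
  · rfl

theorem stopLeft_stopAt_of_le (h : s ≤ t) : stopLeft (stopAt x t) s = stopLeft x s :=
  stopLeft_congr (fun _ hr => stopAt_apply_of_le (hr.le.trans h)) (stopAt_apply_of_le h)

theorem leftLim_stopLeft : Function.leftLim (stopLeft x t) t = Function.leftLim x t := by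
  have h' : x =ᶠ[𝓝[<] t] stopLeft x t := by
    filter_upwards [self_mem_nhdsWithin] with s hs using (stopLeft_apply_of_lt hs).symm
  rcases (𝓝[<] t).eq_or_neBot with hne | hne
  · rw [leftLim_eq_of_eq_bot _ hne, stopLeft_apply_of_ge le_rfl]
  · by_cases hl : ∃ l, Tendsto x (𝓝[<] t) (𝓝 l)
    · obtain ⟨l, hl⟩ := hl
      rw [leftLim_eq_of_tendsto hl, leftLim_eq_of_tendsto (hl.congr' h')]
    · rw [leftLim_eq_of_not_tendsto (stopLeft x t) (by
        simpa only [← tendsto_congr' h'] using hl), stopLeft_apply_of_ge le_rfl]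

theorem stopLeft_stopLeft : stopLeft (stopLeft x t) t = stopLeft x t := by
  funext r
  by_cases hr : r < t
  · simp [stopLeft, hr]
  · rw [stopLeft_apply_of_ge (not_lt.1 hr), stopLeft_apply_of_ge (not_lt.1 hr), leftLim_stopLeft]

theorem stopAt_stopLeft_of_ge (h : t ≤ s) : stopAt (stopLeft x t) s = stopLeft x t := by
  funext r
  unfold stopAt
  rcases le_total r s with hr | hr
  · rw [min_eq_left hr]
  · rw [min_eq_right hr, stopLeft_apply_of_ge h, stopLeft_apply_of_ge (h.trans hr)]

theorem stopLeft_zero : stopLeft x 0 = stopAt x 0 := by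
  funext r
  rw [stopLeft_apply_of_ge zero_le, stopAt_apply_of_ge zero_le, leftLim_zero]

theorem stopAt_zero_congr (h : x 0 = y 0) : stopAt x 0 = stopAt y 0 :=
  stopAt_congr fun r hr => by rwa [nonpos_iff_eq_zero.1 hr]

theorem stopLeft_apply_zero : stopLeft x t 0 = x 0 := by
  rcases eq_or_ne t 0 with rfl | ht
  · rw [stopLeft_apply_of_ge le_rfl, leftLim_zero]
  · exact stopLeft_apply_of_lt (pos_iff_ne_zero.2 ht)

theorem jump_zero : jump x 0 = 0 := by simp [jump, leftLim_zero]

theorem jump_stopLeft : jump (stopLeft x t) t = 0 := by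
  simp [jump, leftLim_stopLeft, stopLeft_apply_of_ge]

theorem jump_stopAt_of_le (h : s ≤ t) : jump (stopAt x t) s = jump x s := by
  unfold jump
  rw [leftLim_congr (fun _ hr => stopAt_apply_of_le (hr.le.trans h)) (stopAt_apply_of_le h),
    stopAt_apply_of_le h]

/-- If `x` is constant on a left neighbourhood `[s, t)` of `t`, then `x_{t-} = x_s`. -/
theorem leftLim_of_const_before (hst : s < t) (h : ∀ r, s ≤ r → r < t → x r = x s) :
    Function.leftLim x t = x s := by
  have hne : (𝓝[<] t).NeBot := nhdsLT_neBot_of_exists_lt ⟨s, hst⟩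
  refine leftLim_eq_of_tendsto (tendsto_const_nhds.congr' ?_)
  filter_upwards [Ioo_mem_nhdsLT hst] with r hr using (h r hr.1.le hr.2).symm

theorem stopLeft_of_const_before (hst : s < t) (h : ∀ r, s ≤ r → r < t → x r = x s) :
    stopLeft x t = stopAt x s := by
  funext r
  rcases lt_or_ge r t with hr | hr
  · rw [stopLeft_apply_of_lt hr]
    rcases le_total r s with hrs | hrs
    · rw [stopAt_apply_of_le hrs]
    · rw [stopAt_apply_of_ge hrs, h r hrs hr]
  · rw [stopLeft_apply_of_ge hr, stopAt_apply_of_ge (hst.le.trans hr), leftLim_of_const_before hst h]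

theorem stopLeft_stopAt_of_lt (h : t < s) : stopLeft (stopAt x t) s = stopAt x t := by
  rw [stopLeft_of_const_before h, stopAt_stopAt_of_le le_rfl]
  intro r hr _
  rw [stopAt_apply_of_ge hr, stopAt_apply_of_ge le_rfl]

/-! ### Paths with an added jump. -/

section Bump

variable {e e' : EuclideanSpace ℝ (Fin m)}

theorem bump_zero : bump x t 0 = stopAt x t := by funext r; simp [bump]

theorem bump_apply_of_lt (h : s < t) : bump x t e s = x s := by
  simp [bump, h.not_ge, stopAt_apply_of_le h.le]

theorem bump_apply_of_ge (h : t ≤ s) : bump x t e s = x t + e := by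
  simp [bump, h, stopAt_apply_of_ge h]

theorem stopAt_bump : stopAt (bump x t e) t = bump x t e := by
  funext r
  rcases lt_or_ge r t with hr | hr
  · rw [stopAt_apply_of_le hr.le]
  · rw [stopAt_apply_of_ge hr, bump_apply_of_ge hr, bump_apply_of_ge le_rfl]

theorem bump_bump : bump (bump x t e) t e' = bump x t (e + e') := by
  funext r
  rcases lt_or_ge r t with hr | hr
  · simp [bump_apply_of_lt hr]
  · simp [bump_apply_of_ge hr, bump_apply_of_ge le_rfl, add_assoc]

/-- Removing the jump is itself a bump. This is why genericity asks for `-Δx(t) ∈ U`: it puts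
`x_{t-}` in `Ω` and on the convex set where the vertical derivative is known. -/
theorem bump_neg_jump : bump x t (-jump x t) = stopLeft x t := by
  funext r
  rcases lt_or_ge r t with hr | hr
  · rw [bump_apply_of_lt hr, stopLeft_apply_of_lt hr]
  · rw [bump_apply_of_ge hr, stopLeft_apply_of_ge hr, jump]; abel

/-- False at `t = 0`, where `x(0-) = x(0)` makes the bump part of the left limit. Time `0` therefore
needs separate treatment wherever strict causality is used. -/
theorem stopLeft_bump (hx : IsCadlag x) (ht : 0 < t) : stopLeft (bump x t e) t = stopLeft x t :=
  (stopLeft_congr_of_pos hx ht fun _ hr => (bump_apply_of_lt hr).symm).symm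

theorem jump_bump (hx : IsCadlag x) (ht : 0 < t) : jump (bump x t e) t = jump x t + e := by
  unfold jump
  rw [← leftLim_congr_of_pos (hx t).2 ht fun _ hr => (bump_apply_of_lt hr).symm,
    bump_apply_of_ge le_rfl]
  abel

end Bump

end Paths

/-! ### Partitions -/

namespace PartitionSeq

variable {π : PartitionSeq} {n : ℕ} {s t p : ℝ≥0}

theorem le_last (hp : p ∈ π.pts n) : p ≤ (π.pts n).sup id := Finset.le_sup (f := id) hp

theorem last_mem : (π.pts n).sup id ∈ π.pts n := by
  obtain ⟨i, hi, h⟩ := Finset.exists_mem_eq_sup (π.pts n) ⟨0, π.zero_mem n⟩ id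
  rw [h]; exact hi

theorem next_mem : π.next n t ∈ π.pts n := by
  unfold next
  split_ifs with h
  · exact (Finset.mem_filter.1 (Finset.min'_mem _ h)).1
  · exact last_mem

theorem lt_next_of_lt (hp : p ∈ π.pts n) (h : t < p) : t < π.next n t := by
  have h' : ((π.pts n).filter (fun s => t < s)).Nonempty := ⟨p, Finset.mem_filter.2 ⟨hp, h⟩⟩
  unfold next
  rw [dif_pos h']
  exact (Finset.mem_filter.1 (Finset.min'_mem _ h')).2

theorem next_le_of_lt (hp : p ∈ π.pts n) (h : t < p) : π.next n t ≤ p := by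
  have h' : ((π.pts n).filter (fun s => t < s)).Nonempty := ⟨p, Finset.mem_filter.2 ⟨hp, h⟩⟩
  unfold next
  rw [dif_pos h']
  exact Finset.min'_le _ _ (Finset.mem_filter.2 ⟨hp, h⟩)

theorem next_eq_last (h : (π.pts n).sup id ≤ t) : π.next n t = (π.pts n).sup id := by
  unfold next
  rw [dif_neg]
  rintro ⟨p, hp⟩
  rw [Finset.mem_filter] at hp
  exact (hp.2.trans_le (le_last hp.1)).not_ge h

theorem le_next (hp : p ∈ π.pts n) : p ≤ π.next n p := by
  rcases lt_or_ge p ((π.pts n).sup id) with h | h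
  · exact (lt_next_of_lt last_mem h).le
  · rw [next_eq_last h]; exact le_last hp

/-- `next` is constant between consecutive partition points. -/
theorem next_congr (hst : s ≤ t) (h : ∀ p ∈ π.pts n, s < p → t < p) :
    π.next n s = π.next n t := by
  have : (π.pts n).filter (fun r => s < r) = (π.pts n).filter (fun r => t < r) := by
    ext p
    simp only [Finset.mem_filter]
    exact ⟨fun hp => ⟨hp.1, h p hp.1 hp.2⟩, fun hp => ⟨hp.1, hst.trans_lt hp.2⟩⟩
  unfold next
  simp only [this]

theorem prev_mem : π.prev n t ∈ π.pts n := by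
  unfold prev
  rcases ((π.pts n).filter (fun s => s < t)).eq_empty_or_nonempty with h | h
  · rw [h]; exact π.zero_mem n
  · obtain ⟨i, hi, h⟩ := Finset.exists_mem_eq_sup _ h id
    rw [h]; exact (Finset.mem_filter.1 hi).1

theorem prev_le : π.prev n t ≤ t :=
  Finset.sup_le fun _ hb => (Finset.mem_filter.1 hb).2.le

theorem prev_zero : π.prev n 0 = 0 := nonpos_iff_eq_zero.1 prev_le

theorem prev_lt (ht : 0 < t) : π.prev n t < t :=
  (Finset.sup_lt_iff (by simpa using ht)).2 fun _ hb => (Finset.mem_filter.1 hb).2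

theorem le_prev (hp : p ∈ π.pts n) (h : p < t) : p ≤ π.prev n t :=
  Finset.le_sup (f := id) (Finset.mem_filter.2 ⟨hp, h⟩)

theorem le_next_prev (ht : t ≤ (π.pts n).sup id) : t ≤ π.next n (π.prev n t) := by
  rcases eq_or_ne t 0 with rfl | h0
  · exact zero_le
  by_contra! h
  have h1 := le_prev next_mem h
  exact (lt_next_of_lt last_mem ((prev_lt (pos_iff_ne_zero.2 h0)).trans_le ht)).not_ge h1

/-- For `t > 0`, the inequalities `p < t ≤ next p` single out `t'_n` among the partition points. -/
theorem prev_eq (hp : p ∈ π.pts n) (h : p < t) (h' : t ≤ π.next n p) : π.prev n t = p := by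
  refine le_antisymm ?_ (le_prev hp h)
  by_contra! hlt
  exact (((prev_lt (pos_of_gt h)).trans_le h').trans_le (next_le_of_lt prev_mem hlt)).false

theorem next_prev_eq (hp : p ∈ π.pts n) (h0 : 0 < p) : π.next n (π.prev n p) = p :=
  le_antisymm (next_le_of_lt hp (prev_lt h0)) (le_next_prev (le_last hp))

theorem eventually_le_last (π : PartitionSeq) (t : ℝ≥0) :
    ∀ᶠ n in atTop, t ≤ (π.pts n).sup id :=
  π.tendsto_last.eventually_ge_atTop t

end PartitionSeq

theorem approx_const {m : ℕ} {π : PartitionSeq} {n : ℕ} {x : Traj m} {s t : ℝ≥0} (hst : s ≤ t)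
    (h : ∀ p ∈ π.pts n, s < p → t < p) : approx π n x t = approx π n x s := by
  unfold approx
  rw [PartitionSeq.next_congr hst h]

/-- On `[t_i, t_{i+1})` the path `x^n` already has the later value `x(t_{i+1})`. Hence its left
limit at a partition point is the value of `x` there, and its jumps are exactly the increments in
the Riemann sums. -/
theorem leftLim_approx {m : ℕ} {π : PartitionSeq} {n : ℕ} {x : Traj m} {p : ℝ≥0}
    (hp : p ∈ π.pts n) (h0 : 0 < p) : Function.leftLim (approx π n x) p = x p := by
  rw [leftLim_of_const_before (PartitionSeq.prev_lt (π := π) (n := n) h0)]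
  · unfold approx
    rw [PartitionSeq.next_prev_eq hp h0]
  · intro r h1 h2
    refine approx_const h1 fun q hq hlt => ?_
    by_contra! h
    exact (PartitionSeq.le_prev hq (h.trans_lt h2)).not_gt hlt

theorem jump_approx {m : ℕ} {π : PartitionSeq} {n : ℕ} {x : Traj m} {p : ℝ≥0}
    (hp : p ∈ π.pts n) (h0 : 0 < p) : jump (approx π n x) p = x (π.next n p) - x p := by
  rw [jump, leftLim_approx hp h0, approx]

/-! ### Limits along partitions -/

section Limits

/-- Times `(n, s)` with `n → ∞`, `s → t` and `s ≥ t'_n`. -/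
def rightFilter (π : PartitionSeq) (t : ℝ≥0) : Filter (ℕ × ℝ≥0) :=
  (atTop ×ˢ 𝓝 t) ⊓ 𝓟 {p | π.prev p.1 t ≤ p.2}

/-- Times `(n, s)` with `n → ∞`, `s → t` and `s < t'_n`. -/
def leftFilter (π : PartitionSeq) (t : ℝ≥0) : Filter (ℕ × ℝ≥0) :=
  (atTop ×ˢ 𝓝 t) ⊓ 𝓟 {p | p.2 < π.prev p.1 t}

theorem tendsto_rightFilter {π : PartitionSeq} {t : ℝ≥0} {τ : ℕ → ℝ≥0}
    (hτ : Tendsto τ atTop (𝓝 t)) (h : ∀ᶠ n in atTop, π.prev n t ≤ τ n) :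
    Tendsto (fun n => (n, τ n)) atTop (rightFilter π t) :=
  tendsto_inf.2 ⟨tendsto_id.prodMk hτ, tendsto_principal.2 h⟩

theorem tendsto_leftFilter {π : PartitionSeq} {t : ℝ≥0} {τ : ℕ → ℝ≥0}
    (hτ : Tendsto τ atTop (𝓝 t)) (h : ∀ᶠ n in atTop, τ n < π.prev n t) :
    Tendsto (fun n => (n, τ n)) atTop (leftFilter π t) :=
  tendsto_inf.2 ⟨tendsto_id.prodMk hτ, tendsto_principal.2 h⟩

theorem tendsto_rightFilter_const (π : PartitionSeq) (t : ℝ≥0) :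
    Tendsto (fun n => (n, t)) atTop (rightFilter π t) :=
  tendsto_rightFilter tendsto_const_nhds (Eventually.of_forall fun _ => PartitionSeq.prev_le)

/-- Sequential criterion for limits along sets of pairs `(n, s)`. -/
theorem tendsto_prod_of_seq {α : Type*} {f : ℕ → ℝ≥0 → α} {S : ℕ → Set ℝ≥0} {t : ℝ≥0}
    {l : Filter α} (d : ℕ → ℝ≥0) (hd : Tendsto d atTop (𝓝 t)) (hdS : ∀ n, d n ∈ S n)
    (h : ∀ τ : ℕ → ℝ≥0, Tendsto τ atTop (𝓝 t) → (∀ n, τ n ∈ S n) →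
      Tendsto (fun n => f n (τ n)) atTop l) :
    Tendsto (fun p : ℕ × ℝ≥0 => f p.1 p.2) ((atTop ×ˢ 𝓝 t) ⊓ 𝓟 {p | p.2 ∈ S p.1}) l := by
  classical
  refine tendsto_of_subseq_tendsto fun p hp => ?_
  obtain ⟨hp1, hpS⟩ := tendsto_inf.1 hp
  rw [tendsto_principal] at hpS
  have hn : Tendsto (fun k => (p k).1) atTop atTop := tendsto_fst.comp hp1
  have ht : Tendsto (fun k => (p k).2) atTop (𝓝 t) := tendsto_snd.comp hp1
  obtain ⟨φ, hφ, hφn⟩ := strictMono_subseq_of_tendsto_atTop hn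
  refine ⟨φ, ?_⟩
  set ν : ℕ → ℕ := fun k => (p (φ k)).1 with hν
  have hνm : StrictMono ν := hφn
  -- The hypothesis speaks of full sequences with every term in `S n`. The subsequence gives times
  -- only at the indices `ν k`, and admissible ones only eventually; `d` fills all the gaps.
  set σ : ℕ → ℝ≥0 := fun k => if (p (φ k)).2 ∈ S (ν k) then (p (φ k)).2 else d (ν k) with hσ
  have hσeq : ∀ᶠ k in atTop, σ k = (p (φ k)).2 := by
    filter_upwards [hφ.tendsto_atTop.eventually hpS] with k hk
    exact if_pos hk
  have hσt : Tendsto σ atTop (𝓝 t) :=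
    (ht.comp hφ.tendsto_atTop).congr' (hσeq.mono fun k hk => hk.symm)
  set τ : ℕ → ℝ≥0 := Function.extend ν σ d with hτ
  have hτν : ∀ k, τ (ν k) = σ k := fun k => hνm.injective.extend_apply σ d k
  have hτS : ∀ n, τ n ∈ S n := by
    intro n
    by_cases hk : ∃ k, ν k = n
    · obtain ⟨k, rfl⟩ := hk
      rw [hτν, hσ]
      dsimp only
      split_ifs with h1
      · exact h1
      · exact hdS _
    · rw [hτ, Function.extend_apply' _ _ _ hk]; exact hdS n
  have hτt : Tendsto τ atTop (𝓝 t) := by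
    rw [tendsto_def]
    intro V hV
    obtain ⟨K, hK⟩ := eventually_atTop.1 (hσt.eventually hV)
    filter_upwards [hd.eventually hV, eventually_ge_atTop (ν K)] with n hn1 hn2
    by_cases hk : ∃ k, ν k = n
    · obtain ⟨k, rfl⟩ := hk
      change τ (ν k) ∈ V
      rw [hτν]
      exact hK k (hνm.le_iff_le.1 hn2)
    · change τ n ∈ V
      rw [hτ, Function.extend_apply' _ _ _ hk]; exact hn1
  refine ((h τ hτt hτS).comp hνm.tendsto_atTop).congr' ?_
  filter_upwards [hσeq] with k hk
  change f (ν k) (τ (ν k)) = f (ν k) (p (φ k)).2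
  rw [hτν, hk]

/-- Left limits inherit joint limits. -/
theorem tendsto_leftLimits {ι : Type*} {A : Filter ι} {f g : ι → ℝ≥0 → ℝ} {t : ℝ≥0}
    {W W' : Set (ι × ℝ≥0)} {L : ℝ}
    (hf : Tendsto (fun p : ι × ℝ≥0 => f p.1 p.2) ((A ×ˢ 𝓝 t) ⊓ 𝓟 W) (𝓝 L))
    (hW : ∀ p ∈ W', 0 < p.2 ∧ ∀ᶠ σ in 𝓝[<] p.2, (p.1, σ) ∈ W)
    (hg : ∀ᶠ p in A ×ˢ 𝓝 t, Tendsto (f p.1) (𝓝[<] p.2) (𝓝 (g p.1 p.2))) :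
    Tendsto (fun p : ι × ℝ≥0 => g p.1 p.2) ((A ×ˢ 𝓝 t) ⊓ 𝓟 W') (𝓝 L) := by
  -- Closed neighbourhoods are used so that membership passes from the values of `f` to their left
  -- limits.
  rw [(closed_nhds_basis L).tendsto_right_iff]
  rintro C ⟨hC, hCc⟩
  have h1 := hf.eventually hC
  rw [eventually_inf_principal] at h1 ⊢
  obtain ⟨P, hP, Q, hQ, hPQ⟩ := eventually_prod_iff.1 h1
  obtain ⟨U, hU, hUo, htU⟩ := eventually_nhds_iff.1 hQ
  filter_upwards [hg, hP.prod_mk (hUo.mem_nhds htU)] with p hp1 hp2 hpW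
  obtain ⟨h0, h2⟩ := hW p hpW
  have hne : (𝓝[<] p.2).NeBot := nhdsLT_neBot_of_exists_lt ⟨0, h0⟩
  refine hCc.mem_of_tendsto hp1 ?_
  filter_upwards [h2, mem_nhdsWithin_of_mem_nhds (hUo.mem_nhds hp2.2)] with σ hσ1 hσ2
  exact hPQ hp2.1 (hU σ hσ2) hσ1

/-- Iterated limits inherit joint limits. -/
theorem tendsto_nhdsWithin_of_prod {f : ℕ → ℝ≥0 → ℝ} {J : ℝ≥0 → ℝ} {t : ℝ≥0}
    {S : Set (ℕ × ℝ≥0)} {E : Set ℝ≥0} {L : ℝ}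
    (hf : Tendsto (fun p : ℕ × ℝ≥0 => f p.1 p.2) ((atTop ×ˢ 𝓝 t) ⊓ 𝓟 S) (𝓝 L))
    (hJ : ∀ s ∈ E, Tendsto (fun n => f n s) atTop (𝓝 (J s)))
    (hE : ∀ s ∈ E, ∀ᶠ n in atTop, (n, s) ∈ S) : Tendsto J (𝓝[E] t) (𝓝 L) := by
  rw [(closed_nhds_basis L).tendsto_right_iff]
  rintro C ⟨hC, hCc⟩
  have h1 := hf.eventually hC
  rw [eventually_inf_principal] at h1
  obtain ⟨P, hP, Q, hQ, hPQ⟩ := eventually_prod_iff.1 h1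
  rw [eventually_nhdsWithin_iff]
  filter_upwards [hQ] with s hs hsE
  refine hCc.mem_of_tendsto (hJ s hsE) ?_
  filter_upwards [hP, hE s hsE] with n hn1 hn2
  exact hPQ hn1 hs hn2

end Limits

namespace PartitionSeq

variable {π : PartitionSeq}

theorem VanishingMesh.tendsto_next (hπ : π.VanishingMesh) {t : ℝ≥0} {p : ℕ → ℝ≥0}
    (hp : Tendsto p atTop (𝓝 t)) (hmem : ∀ᶠ n in atTop, p n ∈ π.pts n) :
    Tendsto (fun n => π.next n (p n)) atTop (𝓝 t) := by
  have h1 : Tendsto (fun n => (π.next n (p n) : ℝ) - p n) atTop (𝓝 0) := by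
    rw [Metric.tendsto_atTop']
    intro ε hε
    have hlt : ∀ᶠ n in atTop, p n < t + 1 := hp.eventually (gt_mem_nhds (by simp))
    obtain ⟨N, hN⟩ := eventually_atTop.1 ((hπ (t + 1) ε hε).and (hmem.and hlt))
    refine ⟨N, fun n hn => ?_⟩
    obtain ⟨h1, h2, h3⟩ := hN n hn.le
    have h4 : (p n : ℝ) ≤ π.next n (p n) := by exact_mod_cast le_next h2
    rw [Real.dist_eq, sub_zero, abs_of_nonneg (by linarith)]
    exact h1 _ h2 h3.le
  have h2 : Tendsto (fun n => (p n : ℝ)) atTop (𝓝 (t : ℝ)) := NNReal.tendsto_coe.2 hp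
  have h3 := h1.add h2
  simp only [sub_add_cancel, zero_add] at h3
  exact NNReal.tendsto_coe.1 h3

theorem VanishingMesh.tendsto_prev (hπ : π.VanishingMesh) (t : ℝ≥0) :
    Tendsto (fun n => π.prev n t) atTop (𝓝 t) := by
  rw [← NNReal.tendsto_coe, Metric.tendsto_atTop']
  intro ε hε
  obtain ⟨N, hN⟩ := eventually_atTop.1 ((hπ t ε hε).and (π.eventually_le_last t))
  refine ⟨N, fun n hn => ?_⟩
  obtain ⟨h1, h2⟩ := hN n hn.le
  have h3 := h1 _ prev_mem (prev_le (π := π) (n := n) (t := t))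
  have h4 : (t : ℝ) ≤ π.next n (π.prev n t) := by exact_mod_cast le_next_prev h2
  have h5 : (π.prev n t : ℝ) ≤ t := by exact_mod_cast prev_le (π := π) (n := n) (t := t)
  rw [Real.dist_eq, abs_sub_comm, abs_of_nonneg (by linarith)]
  linarith

theorem VanishingMesh.eventually_lt_prev (hπ : π.VanishingMesh) {s t : ℝ≥0} (h : s < t) :
    ∀ᶠ n in atTop, s < π.prev n t :=
  (hπ.tendsto_prev t).eventually (lt_mem_nhds h)

theorem VanishingMesh.tendsto_next_prev (hπ : π.VanishingMesh) (t : ℝ≥0) :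
    Tendsto (fun n => π.next n (π.prev n t)) atTop (𝓝 t) :=
  hπ.tendsto_next (hπ.tendsto_prev t) (Eventually.of_forall fun _ => prev_mem)

/-- Partition intervals that start in `[0, s]` end before `t > s`, for large `n`. -/
theorem VanishingMesh.eventually_next_lt (hπ : π.VanishingMesh) {s t : ℝ≥0} (h : s < t) :
    ∀ᶠ n in atTop, ∀ p ∈ π.pts n, p ≤ s → π.next n p < t := by
  filter_upwards [hπ s (t - s) (by simpa using h)] with n hn p hp hps
  have h1 := hn p hp hps
  have h2 : (p : ℝ) ≤ s := by exact_mod_cast hps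
  have : (π.next n p : ℝ) < t := by linarith
  exact_mod_cast this

end PartitionSeq

theorem IsCadlag.tendsto_prev {E : Type*} [TopologicalSpace E] [T2Space E] {π : PartitionSeq}
    (hπ : π.VanishingMesh) {x : ℝ≥0 → E} (hx : IsCadlag x) {t : ℝ≥0} (ht : 0 < t) :
    Tendsto (fun n => x (π.prev n t)) atTop (𝓝 (Function.leftLim x t)) :=
  (hx.tendsto_leftLim t).comp (tendsto_nhdsWithin_iff.2
    ⟨hπ.tendsto_prev t, Eventually.of_forall fun _ => PartitionSeq.prev_lt ht⟩)

theorem IsCadlag.tendsto_next_prev {E : Type*} [TopologicalSpace E] {π : PartitionSeq}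
    (hπ : π.VanishingMesh) {x : ℝ≥0 → E} (hx : IsCadlag x) (t : ℝ≥0) :
    Tendsto (fun n => x (π.next n (π.prev n t))) atTop (𝓝 (x t)) :=
  (hx.tendsto_right t).comp (tendsto_nhdsWithin_iff.2
    ⟨hπ.tendsto_next_prev t,
      (π.eventually_le_last t).mono fun _ h => PartitionSeq.le_next_prev h⟩)

/-- The increments of `x` over the partition intervals `[t_i, t_{i+1})` that end at or after `t`
converge to the jump at `t`. -/
theorem IsCadlag.tendsto_increment_prev {m : ℕ} {π : PartitionSeq} (hπ : π.VanishingMesh)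
    {x : Traj m} (hx : IsCadlag x) (t : ℝ≥0) :
    Tendsto (fun n => x (π.next n (π.prev n t)) - x (π.prev n t)) atTop (𝓝 (jump x t)) := by
  rcases eq_or_ne t 0 with rfl | ht
  · have h := (hx.tendsto_next_prev hπ 0).sub_const (x 0)
    simpa [jump_zero, PartitionSeq.prev_zero] using h
  · exact (hx.tendsto_next_prev hπ t).sub (hx.tendsto_prev hπ (pos_iff_ne_zero.2 ht))

/-! ### Domains -/

section Domain

variable {m : ℕ} {π : PartitionSeq} {Ω : Set (Traj m)} {x : Traj m} {s t : ℝ≥0}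

theorem IsGeneric.stopAt_mem (hΩ : IsGeneric π Ω) (hx : x ∈ Ω) (t : ℝ≥0) : stopAt x t ∈ Ω := by
  obtain ⟨U, hU, -, -, h⟩ := hΩ.bump_mem x hx t
  rw [← bump_zero]
  exact h 0 (mem_of_mem_nhds hU)

theorem IsGeneric.stopLeft_mem (hΩ : IsGeneric π Ω) (hx : x ∈ Ω) (t : ℝ≥0) :
    stopLeft x t ∈ Ω := by
  obtain ⟨U, -, -, hU, h⟩ := hΩ.bump_mem x hx t
  rw [← bump_neg_jump]
  exact h _ hU

theorem mk_mem_domain (hx : x ∈ Ω) (h : stopAt x t = x) : (t, x) ∈ domain Ω :=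
  ⟨t, x, hx, by rw [h]⟩

theorem IsGeneric.mem_domain_iff (hΩ : IsGeneric π Ω) :
    (t, x) ∈ domain Ω ↔ x ∈ Ω ∧ stopAt x t = x := by
  refine ⟨?_, fun h => mk_mem_domain h.1 h.2⟩
  rintro ⟨s, y, hy, h⟩
  obtain ⟨rfl, rfl⟩ := Prod.mk.inj h
  exact ⟨hΩ.stopAt_mem hy _, stopAt_stopAt_of_le le_rfl⟩

theorem stopAt_mem_domain (hx : x ∈ Ω) (t : ℝ≥0) : (t, stopAt x t) ∈ domain Ω := ⟨t, x, hx, rfl⟩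

theorem IsGeneric.stopAt_mem_domain_of_le (hΩ : IsGeneric π Ω) (hx : x ∈ Ω) (h : t ≤ s) :
    (s, stopAt x t) ∈ domain Ω :=
  mk_mem_domain (hΩ.stopAt_mem hx t) (stopAt_stopAt_of_ge h)

theorem IsGeneric.stopLeft_mem_domain (hΩ : IsGeneric π Ω) (hx : x ∈ Ω) (t : ℝ≥0) :
    (t, stopLeft x t) ∈ domain Ω :=
  mk_mem_domain (hΩ.stopLeft_mem hx t) (stopAt_stopLeft_of_ge le_rfl)

/-- The horizon `T + 1` is positive, as `approx_mem` demands, and leaves room for times that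
converge to `T` from above. -/
theorem IsGeneric.eventually_approx (hΩ : IsGeneric π Ω) (hx : x ∈ Ω) (T : ℝ≥0) :
    ∀ᶠ n in atTop, stopAt (approx π n x) (T + 1) ∈ Ω := by
  obtain ⟨N, hN⟩ := hΩ.approx_mem x hx (T + 1) (by positivity)
  exact eventually_atTop.2 ⟨N, hN⟩

theorem IsGeneric.approx_mem_domain (hΩ : IsGeneric π Ω) (hx : x ∈ Ω) (T : ℝ≥0) :
    ∀ᶠ n in atTop, ∀ t ≤ T, (t, stopAt (approx π n x) t) ∈ domain Ω ∧
      (t, stopLeft (approx π n x) t) ∈ domain Ω := by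
  filter_upwards [hΩ.eventually_approx hx T] with n hn t ht
  have ht' : t ≤ T + 1 := ht.trans (by simp)
  rw [← stopAt_stopAt_of_le (x := approx π n x) ht', ← stopLeft_stopAt_of_le (x := approx π n x) ht']
  exact ⟨stopAt_mem_domain hn t, hΩ.stopLeft_mem_domain hn t⟩

end Domain

/-! ### Regularity -/

section Regularity

variable {m : ℕ} {π : PartitionSeq} {Ω : Set (Traj m)}

theorem eventually_le_add_one {τ : ℕ → ℝ≥0} {t : ℝ≥0} (hτ : Tendsto τ atTop (𝓝 t)) :
    ∀ᶠ n in atTop, τ n ≤ t + 1 :=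
  hτ.eventually (Iic_mem_nhds (by simp))

theorem LeftCont.congr {V : Type*} [TopologicalSpace V] {F G : Functional m V}
    (hΩ : IsGeneric π Ω) (hF : LeftCont π Ω F)
    (h : ∀ z ∈ domain Ω, F z.1 z.2 = G z.1 z.2) : LeftCont π Ω G where
  a x hx t := by
    rw [← h _ (hΩ.stopLeft_mem_domain hx t)]
    exact (hF.a x hx t).congr fun s => h _ (hΩ.stopLeft_mem_domain hx s)
  b x hx t := by
    rw [← h _ (hΩ.stopLeft_mem_domain hx t)]
    exact (hF.b x hx t).congr fun s => h _ (stopAt_mem_domain hx s)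
  c x hx t τ hτ hp := by
    rw [← h _ (hΩ.stopLeft_mem_domain hx t)]
    refine (hF.c x hx t τ hτ hp).congr' ?_
    filter_upwards [hΩ.approx_mem_domain hx (t + 1), eventually_le_add_one hτ] with n h1 h2
    exact h _ (h1 _ h2).2
  d x hx t τ hτ hp := by
    rw [← h _ (hΩ.stopLeft_mem_domain hx t)]
    refine (hF.d x hx t τ hτ hp).congr' ?_
    filter_upwards [hΩ.approx_mem_domain hx (t + 1), eventually_le_add_one hτ] with n h1 h2
    exact h _ (h1 _ h2).1

theorem RightCont.congr {V : Type*} [TopologicalSpace V] {F G : Functional m V}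
    (hΩ : IsGeneric π Ω) (hF : RightCont π Ω F)
    (h : ∀ z ∈ domain Ω, F z.1 z.2 = G z.1 z.2) : RightCont π Ω G where
  a x hx t := by
    rw [← h _ (stopAt_mem_domain hx t)]
    exact (hF.a x hx t).congr fun s => h _ (stopAt_mem_domain hx s)
  b x hx t := by
    rw [← h _ (stopAt_mem_domain hx t)]
    exact (hF.b x hx t).congr fun s => h _ (hΩ.stopLeft_mem_domain hx s)
  c x hx t τ hτ hp := by
    rw [← h _ (stopAt_mem_domain hx t)]
    refine (hF.c x hx t τ hτ hp).congr' ?_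
    filter_upwards [hΩ.approx_mem_domain hx (t + 1), eventually_le_add_one hτ] with n h1 h2
    exact h _ (h1 _ h2).1
  d x hx t τ hτ hp := by
    rw [← h _ (stopAt_mem_domain hx t)]
    refine (hF.d x hx t τ hτ hp).congr' ?_
    filter_upwards [hΩ.approx_mem_domain hx (t + 1), eventually_le_add_one hτ] with n h1 h2
    exact h _ (h1 _ h2).2

theorem rightCont_const {V : Type*} [TopologicalSpace V] (v : V) :
    RightCont π Ω (fun _ _ => v) :=
  ⟨fun _ _ _ => tendsto_const_nhds, fun _ _ _ => tendsto_const_nhds,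
    fun _ _ _ _ _ _ => tendsto_const_nhds, fun _ _ _ _ _ _ => tendsto_const_nhds⟩

theorem LeftCont.leftVersion {V : Type*} [TopologicalSpace V] {F : Functional m V}
    (hF : LeftCont π Ω F) : LeftCont π Ω (leftVersion F) := by
  have key : ∀ (x : Traj m) t, CausalCalculus.leftVersion F t (stopAt x t) = F t (stopLeft x t) :=
    fun x t => by rw [CausalCalculus.leftVersion, stopLeft_stopAt_of_le le_rfl]
  have key' : ∀ (x : Traj m) t,
      CausalCalculus.leftVersion F t (stopLeft x t) = F t (stopLeft x t) :=
    fun x t => by rw [CausalCalculus.leftVersion, stopLeft_stopLeft]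
  constructor
  · intro x hx t
    simp only [key']
    exact hF.a x hx t
  · intro x hx t
    simp only [key, key']
    exact (hF.a x hx t).mono_left (nhdsWithin_mono _ Iio_subset_Iic_self)
  · intro x hx t τ hτ hp
    simp only [key']
    exact hF.c x hx t τ hτ hp
  · intro x hx t τ hτ hp
    simp only [key, key']
    exact hF.c x hx t τ hτ fun n => (hp n).le

theorem LeftCont.comp₂ {V W X : Type*} [TopologicalSpace V] [TopologicalSpace W]
    [TopologicalSpace X] {F : Functional m V} {G : Functional m W} {g : V → W → X}
    (hg : Continuous fun p : V × W => g p.1 p.2)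
    (hF : LeftCont π Ω F) (hG : LeftCont π Ω G) : LeftCont π Ω (fun t x => g (F t x) (G t x)) where
  a x hx t := (hg.tendsto _).comp ((hF.a x hx t).prodMk_nhds (hG.a x hx t))
  b x hx t := (hg.tendsto _).comp ((hF.b x hx t).prodMk_nhds (hG.b x hx t))
  c x hx t τ hτ hp := (hg.tendsto _).comp ((hF.c x hx t τ hτ hp).prodMk_nhds (hG.c x hx t τ hτ hp))
  d x hx t τ hτ hp := (hg.tendsto _).comp ((hF.d x hx t τ hτ hp).prodMk_nhds (hG.d x hx t τ hτ hp))

/-- Functionals that are left- and right-continuous are continuous. -/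
theorem piContinuous_of_leftCont_rightCont {F : Functional m ℝ} (hl : LeftCont π Ω F)
    (hr : RightCont π Ω F) : PiContinuous π Ω F := by
  unfold PiContinuous
  rw [continuous_iff_le_induced]
  exact iInf_le (fun F : {F : Functional m ℝ // LeftCont π Ω F ∧ RightCont π Ω F} =>
    TopologicalSpace.induced (fun z : domain Ω => F.1 z.1.1 z.1.2) inferInstance) ⟨F, hl, hr⟩

/-- Convergence in an initial topology is tested on the generating functionals. Points outside the
domain are replaced by the limit `z`, which changes nothing eventually. -/
theorem PiContinuous.tendsto {F : Functional m ℝ} (hF : PiContinuous π Ω F) {ι : Type*}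
    {l : Filter ι} {p : ι → ℝ≥0 × Traj m} {z : ℝ≥0 × Traj m} (hz : z ∈ domain Ω)
    (hp : ∀ᶠ i in l, p i ∈ domain Ω)
    (h : ∀ G : Functional m ℝ, LeftCont π Ω G → RightCont π Ω G →
      Tendsto (fun i => G (p i).1 (p i).2) l (𝓝 (G z.1 z.2))) :
    Tendsto (fun i => F (p i).1 (p i).2) l (𝓝 (F z.1 z.2)) := by
  classical
  let q : ι → domain Ω := fun i => if hi : p i ∈ domain Ω then ⟨p i, hi⟩ else ⟨z, hz⟩
  have hq : ∀ᶠ i in l, (q i : ℝ≥0 × Traj m) = p i := by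
    filter_upwards [hp] with i hi
    simp [q, hi]
  have h1 : Tendsto q l (@nhds _ (piTopology π Ω) ⟨z, hz⟩) := by
    unfold piTopology
    rw [nhds_iInf, tendsto_iInf]
    intro G
    rw [nhds_induced, tendsto_comap_iff]
    refine (h G.1 G.2.1 G.2.2).congr' ?_
    filter_upwards [hq] with i hi
    simp only [Function.comp, hi]
  have h2 := (@Continuous.tendsto _ _ (piTopology π Ω) _ _ hF ⟨z, hz⟩).comp h1
  refine h2.congr' ?_
  filter_upwards [hq] with i hi
  simp only [Function.comp, hi]

/-- Each clause is convergence to a fixed point of the domain, and such convergence passes from the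
generators to every continuous functional. -/
theorem PiContinuous.leftCont (hΩ : IsGeneric π Ω) {F : Functional m ℝ}
    (hF : PiContinuous π Ω F) : LeftCont π Ω F where
  a x hx t := hF.tendsto (p := fun s => (s, stopLeft x s)) (hΩ.stopLeft_mem_domain hx t)
    (Eventually.of_forall fun s => hΩ.stopLeft_mem_domain hx s) fun G hl _ => hl.a x hx t
  b x hx t := hF.tendsto (p := fun s => (s, stopAt x s)) (hΩ.stopLeft_mem_domain hx t)
    (Eventually.of_forall fun s => stopAt_mem_domain hx s) fun G hl _ => hl.b x hx t
  c x hx t τ hτ hp := hF.tendsto (p := fun n => (τ n, stopLeft (approx π n x) (τ n)))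
    (hΩ.stopLeft_mem_domain hx t)
    (by filter_upwards [hΩ.approx_mem_domain hx (t + 1), eventually_le_add_one hτ] with n h1 h2
        exact (h1 _ h2).2)
    fun G hl _ => hl.c x hx t τ hτ hp
  d x hx t τ hτ hp := hF.tendsto (p := fun n => (τ n, stopAt (approx π n x) (τ n)))
    (hΩ.stopLeft_mem_domain hx t)
    (by filter_upwards [hΩ.approx_mem_domain hx (t + 1), eventually_le_add_one hτ] with n h1 h2
        exact (h1 _ h2).1)
    fun G hl _ => hl.d x hx t τ hτ hp

theorem PiContinuous.rightCont (hΩ : IsGeneric π Ω) {F : Functional m ℝ}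
    (hF : PiContinuous π Ω F) : RightCont π Ω F where
  a x hx t := hF.tendsto (p := fun s => (s, stopAt x s)) (stopAt_mem_domain hx t)
    (Eventually.of_forall fun s => stopAt_mem_domain hx s) fun G _ hr => hr.a x hx t
  b x hx t := hF.tendsto (p := fun s => (s, stopLeft x s)) (stopAt_mem_domain hx t)
    (Eventually.of_forall fun s => hΩ.stopLeft_mem_domain hx s) fun G _ hr => hr.b x hx t
  c x hx t τ hτ hp := hF.tendsto (p := fun n => (τ n, stopAt (approx π n x) (τ n)))
    (stopAt_mem_domain hx t)
    (by filter_upwards [hΩ.approx_mem_domain hx (t + 1), eventually_le_add_one hτ] with n h1 h2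
        exact (h1 _ h2).1)
    fun G _ hr => hr.c x hx t τ hτ hp
  d x hx t τ hτ hp := hF.tendsto (p := fun n => (τ n, stopLeft (approx π n x) (τ n)))
    (stopAt_mem_domain hx t)
    (by filter_upwards [hΩ.approx_mem_domain hx (t + 1), eventually_le_add_one hτ] with n h1 h2
        exact (h1 _ h2).2)
    fun G _ hr => hr.d x hx t τ hτ hp

theorem PiContinuous.congr {F G : Functional m ℝ} (hF : PiContinuous π Ω F)
    (h : ∀ z ∈ domain Ω, F z.1 z.2 = G z.1 z.2) : PiContinuous π Ω G := by
  unfold PiContinuous at *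
  have : (fun z : domain Ω => G z.1.1 z.1.2) = fun z : domain Ω => F z.1.1 z.1.2 := by
    funext z; exact (h _ z.2).symm
  rwa [this]

theorem PiContinuous.comp₂ {F G : Functional m ℝ} {g : ℝ → ℝ → ℝ}
    (hg : Continuous fun p : ℝ × ℝ => g p.1 p.2) (hF : PiContinuous π Ω F)
    (hG : PiContinuous π Ω G) : PiContinuous π Ω (fun t x => g (F t x) (G t x)) := by
  have key : ∀ (X : Type _) [TopologicalSpace X] (f f' : X → ℝ), Continuous f → Continuous f' →
      Continuous fun z => g (f z) (f' z) := fun X _ f f' hf hf' => hg.comp (hf.prodMk hf')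
  exact @key _ (piTopology π Ω) _ _ hF hG

theorem PiContinuous.sub {F G : Functional m ℝ} (hF : PiContinuous π Ω F)
    (hG : PiContinuous π Ω G) : PiContinuous π Ω (fun t x => F t x - G t x) :=
  hF.comp₂ (g := fun a b => a - b) (by fun_prop) hG

theorem PiContinuous.mul {F G : Functional m ℝ} (hF : PiContinuous π Ω F)
    (hG : PiContinuous π Ω G) : PiContinuous π Ω (fun t x => F t x * G t x) :=
  hF.comp₂ (g := fun a b => a * b) (by fun_prop) hG

/-- A functional is continuous as soon as the limits along stopped paths `x_s` and `x^n_s` are the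
right ones. -/
theorem piContinuous_of_tendsto (hΩ : IsGeneric π Ω) {G : Functional m ℝ}
    (hb : ∀ x ∈ Ω, ∀ t, Tendsto (fun s => G s (stopAt x s)) (𝓝[<] t) (𝓝 (G t (stopLeft x t))))
    (ha : ∀ x ∈ Ω, ∀ t, Tendsto (fun s => G s (stopAt x s)) (𝓝[≥] t) (𝓝 (G t (stopAt x t))))
    (hd : ∀ x ∈ Ω, ∀ t, 0 < t → Tendsto (fun p : ℕ × ℝ≥0 => G p.2 (stopAt (approx π p.1 x) p.2))
      (leftFilter π t) (𝓝 (G t (stopLeft x t))))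
    (hc : ∀ x ∈ Ω, ∀ t, Tendsto (fun p : ℕ × ℝ≥0 => G p.2 (stopAt (approx π p.1 x) p.2))
      (rightFilter π t) (𝓝 (G t (stopAt x t)))) : PiContinuous π Ω G := by
  -- Values at `x^n_{s-}` are left limits of values at stopped paths, by `hb` applied to the path
  -- `x^n` itself. All clauses involving `stopLeft` are then left limits of the four given ones.
  have hlim : ∀ x ∈ Ω, ∀ t, ∀ᶠ p : ℕ × ℝ≥0 in atTop ×ˢ 𝓝 t,
      Tendsto (fun s => G s (stopAt (approx π p.1 x) s)) (𝓝[<] p.2)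
        (𝓝 (G p.2 (stopLeft (approx π p.1 x) p.2))) := by
    intro x hx t
    filter_upwards [(hΩ.eventually_approx hx t).prod_mk (gt_mem_nhds (show t < t + 1 by simp))]
      with p hp
    have h1 := hb _ hp.1 p.2
    rw [stopLeft_stopAt_of_le hp.2.le] at h1
    refine h1.congr' ?_
    filter_upwards [self_mem_nhdsWithin] with s hs
    rw [stopAt_stopAt_of_le ((le_of_lt hs).trans hp.2.le)]
  -- The one-point index type lets `tendsto_leftLimits` serve the fixed path `x` as well.
  have hlim' : ∀ x ∈ Ω, ∀ t, ∀ᶠ p : Unit × ℝ≥0 in pure () ×ˢ 𝓝 t,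
      Tendsto (fun s => G s (stopAt x s)) (𝓝[<] p.2) (𝓝 (G p.2 (stopLeft x p.2))) :=
    fun x hx t => Eventually.of_forall fun p => hb x hx p.2
  have hunit : ∀ (t : ℝ≥0) (E : Set ℝ≥0), Tendsto (fun s => ((), s)) (𝓝[E] t)
      ((pure () ×ˢ 𝓝 t) ⊓ 𝓟 {p : Unit × ℝ≥0 | p.2 ∈ E}) := fun t E =>
    tendsto_inf.2 ⟨(tendsto_pure.2 (Eventually.of_forall fun _ => rfl)).prodMk
      (tendsto_id.mono_left nhdsWithin_le_nhds), tendsto_principal.2 self_mem_nhdsWithin⟩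
  have hunit' : ∀ (t : ℝ≥0) (E : Set ℝ≥0), Tendsto (fun p : Unit × ℝ≥0 => p.2)
      ((pure () ×ˢ 𝓝 t) ⊓ 𝓟 {p : Unit × ℝ≥0 | p.2 ∈ E}) (𝓝[E] t) := fun t E =>
    tendsto_nhdsWithin_iff.2 ⟨tendsto_snd.mono_left inf_le_left,
      eventually_inf_principal.2 (Eventually.of_forall fun _ h => h)⟩
  refine piContinuous_of_leftCont_rightCont ⟨?_, hb, ?_, ?_⟩ ⟨ha, ?_, ?_, ?_⟩
  · intro x hx t
    rcases eq_or_ne t 0 with rfl | ht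
    · refine tendsto_const_nhds.congr' ?_
      filter_upwards [self_mem_nhdsWithin] with s hs
      rw [nonpos_iff_eq_zero.1 (mem_Iic.1 hs)]
    · have h1 := tendsto_leftLimits (A := pure ()) (f := fun _ s => G s (stopAt x s))
        (g := fun _ s => G s (stopLeft x s)) (W := {p | p.2 ∈ Iio t})
        (W' := {p : Unit × ℝ≥0 | p.2 ∈ Ioc 0 t}) ((hb x hx t).comp (hunit' t _)) (by
          rintro p ⟨h0, h1⟩
          refine ⟨h0, ?_⟩
          filter_upwards [self_mem_nhdsWithin] with σ hσ using lt_of_lt_of_le hσ h1) (hlim' x hx t)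
      have h2 := h1.comp (hunit t (Ioc 0 t))
      rwa [nhdsWithin_Ioc_eq_nhdsLE (pos_iff_ne_zero.2 ht)] at h2
  · intro x hx t τ hτ hp
    rcases eq_or_ne t 0 with rfl | ht
    · have h0 : ∀ n, τ n = 0 := fun n =>
        nonpos_iff_eq_zero.1 ((hp n).trans_eq PartitionSeq.prev_zero)
      simp only [h0, stopLeft_zero]
      exact (hc x hx 0).comp (tendsto_rightFilter_const π 0)
    · have h1 := tendsto_leftLimits (f := fun n s => G s (stopAt (approx π n x) s))
        (g := fun n s => G s (stopLeft (approx π n x) s))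
        (W' := {p : ℕ × ℝ≥0 | 0 < p.2 ∧ p.2 ≤ π.prev p.1 t}) (hd x hx t (pos_iff_ne_zero.2 ht)) (by
          rintro p ⟨h0, h1⟩
          refine ⟨h0, ?_⟩
          filter_upwards [self_mem_nhdsWithin] with σ hσ using lt_of_lt_of_le hσ h1) (hlim x hx t)
      exact h1.comp (tendsto_inf.2 ⟨tendsto_id.prodMk hτ, tendsto_principal.2
        ((hτ.eventually (lt_mem_nhds (pos_iff_ne_zero.2 ht))).mono fun n hn => ⟨hn, hp n⟩)⟩)
  · intro x hx t τ hτ hp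
    have ht : 0 < t := (pos_of_gt (hp 0)).trans_le PartitionSeq.prev_le
    exact (hd x hx t ht).comp (tendsto_leftFilter hτ (Eventually.of_forall hp))
  · intro x hx t
    have h1 := tendsto_leftLimits (A := pure ()) (f := fun _ s => G s (stopAt x s))
      (g := fun _ s => G s (stopLeft x s)) (W := {p | p.2 ∈ Ici t})
      (W' := {p : Unit × ℝ≥0 | p.2 ∈ Ioi t}) ((ha x hx t).comp (hunit' t _)) (by
        intro p hp
        refine ⟨pos_of_gt hp, ?_⟩
        filter_upwards [Ioo_mem_nhdsLT hp] with σ hσ using hσ.1.le) (hlim' x hx t)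
    exact h1.comp (hunit t (Ioi t))
  · intro x hx t τ hτ hp
    exact (hc x hx t).comp (tendsto_rightFilter hτ (Eventually.of_forall hp))
  · intro x hx t τ hτ hp
    have h1 := tendsto_leftLimits (f := fun n s => G s (stopAt (approx π n x) s))
      (g := fun n s => G s (stopLeft (approx π n x) s))
      (W' := {p : ℕ × ℝ≥0 | π.prev p.1 t < p.2}) (hc x hx t) (by
        intro p hp
        refine ⟨pos_of_gt hp, ?_⟩
        filter_upwards [Ioo_mem_nhdsLT hp] with σ hσ using hσ.1.le) (hlim x hx t)
    exact h1.comp (tendsto_inf.2 ⟨tendsto_id.prodMk hτ, tendsto_principal.2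
      (Eventually.of_forall hp)⟩)

end Regularity

/-! ### Functionals of class `ℳ` along paths -/

/-- A function with constant gradient on a convex set is affine there: the mean value inequality,
applied after subtracting the linear part, has constant `0`. -/
theorem sub_eq_inner_of_hasGradientAt {E : Type*} [NormedAddCommGroup E] [InnerProductSpace ℝ E]
    [CompleteSpace E] {f : E → ℝ} {U : Set E} (hU : Convex ℝ U) {v : E}
    (hf : ∀ e ∈ U, HasGradientAt f v e) {a b : E} (ha : a ∈ U) (hb : b ∈ U) :
    f b - f a = inner ℝ v (b - a) := by
  have h := hU.norm_image_sub_le_of_norm_hasFDerivWithin_le' (C := 0)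
    (φ := InnerProductSpace.toDual ℝ E v) (fun e he => (hf e he).hasFDerivAt.hasFDerivWithinAt)
    (fun e _ => by simp) ha hb
  rw [zero_mul, norm_le_zero_iff, sub_eq_zero] at h
  simpa using h

section ClassM

variable {m : ℕ} {π : PartitionSeq} {Ω : Set (Traj m)}

/-- The value of `G` does not change as long as the path stays constant. -/
def HorizConst (Ω : Set (Traj m)) (G : Functional m ℝ) : Prop :=
  ∀ x ∈ Ω, ∀ t s, t ≤ s → G s (stopAt x t) = G t (stopAt x t)

/-- For `s > t` the path `x_t` has no jump at `s`, so the left limit at `s` given by left-continuity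
and the right limit given by right-continuity coincide. -/
theorem PiContinuous.continuous_horiz (hΩ : IsGeneric π Ω) {F : Functional m ℝ}
    (hF : PiContinuous π Ω F) {x : Traj m} (hx : x ∈ Ω) (t : ℝ≥0) :
    ContinuousOn (fun s => F s (stopAt x t)) (Ici t) := by
  have hy := hΩ.stopAt_mem hx t
  intro s hs
  have hr : ContinuousWithinAt (fun s => F s (stopAt x t)) (Ici s) s := by
    have h := (hF.rightCont hΩ).a _ hy s
    rw [stopAt_stopAt_of_ge hs] at h
    refine h.congr' ?_
    filter_upwards [self_mem_nhdsWithin] with r hr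
    rw [stopAt_stopAt_of_ge (le_trans hs hr)]
  rcases eq_or_lt_of_le (mem_Ici.1 hs) with rfl | hts
  · exact hr
  have hl : ContinuousWithinAt (fun s => F s (stopAt x t)) (Iio s) s := by
    have h := (hF.leftCont hΩ).b _ hy s
    rw [stopLeft_stopAt_of_lt hts] at h
    refine h.congr' ?_
    filter_upwards [Ioo_mem_nhdsLT hts] with r hr
    rw [stopAt_stopAt_of_ge hr.1.le]
  have h : ContinuousAt (fun s => F s (stopAt x t)) s :=
    continuousAt_iff_continuous_left'_right'.2 ⟨hl, hr.mono Ioi_subset_Ici_self⟩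
  exact h.continuousWithinAt

/-- A continuous function with vanishing right derivative is constant. The frozen path stays in the
domain at all later times, so `𝒟F = 0` supplies that right derivative. -/
theorem ClassM.horizConst (hΩ : IsGeneric π Ω) {F : Functional m ℝ} (hF : ClassM π Ω F) :
    HorizConst Ω F := by
  intro x hx t s hts
  set f : ℝ → ℝ := fun r => F (t + r.toNNReal) (stopAt x t) with hf
  have hmaps : ∀ r : ℝ, t + r.toNNReal ∈ Ici t := fun r => by simp
  have hcont : ContinuousOn f (Icc 0 ((s - t : ℝ≥0) : ℝ)) := by
    have h1 := hF.1.continuous.continuous_horiz hΩ hx t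
    have h2 : Continuous fun r : ℝ => t + r.toNNReal := by fun_prop
    exact h1.comp h2.continuousOn fun r _ => hmaps r
  have hderiv : ∀ r ∈ Ico 0 ((s - t : ℝ≥0) : ℝ), HasDerivWithinAt f 0 (Ici r) r := by
    intro r hr
    have hmem : (t + r.toNNReal, stopAt x t) ∈ domain Ω :=
      hΩ.stopAt_mem_domain_of_le hx (hmaps r)
    obtain ⟨d, hd⟩ := hF.1.horizDiff _ hmem
    have h0 := hF.2 _ hmem
    have hd0 : d = 0 := by
      rw [← h0]
      have hne : (𝓝[>] (0 : ℝ≥0)).NeBot := inferInstance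
      exact hd.limUnder_eq.symm
    subst hd0
    rw [hasDerivWithinAt_iff_tendsto_slope]
    have hmap : Tendsto (fun u : ℝ => (u - r).toNNReal) (𝓝[Ici r \ {r}] r) (𝓝[>] 0) := by
      refine tendsto_nhdsWithin_iff.2 ⟨?_, ?_⟩
      · have : Continuous fun u : ℝ => (u - r).toNNReal := by fun_prop
        have h := this.tendsto r
        simp only [sub_self, Real.toNNReal_zero] at h
        exact h.mono_left nhdsWithin_le_nhds
      · filter_upwards [self_mem_nhdsWithin] with u hu
        have : r < u := lt_of_le_of_ne hu.1 (Ne.symm hu.2)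
        simpa using this
    refine (hd.comp hmap).congr' ?_
    filter_upwards [self_mem_nhdsWithin] with u hu
    have hru : r ≤ u := hu.1
    have h1 : t + r.toNNReal + (u - r).toNNReal = t + u.toNNReal := by
      rw [add_assoc, ← Real.toNNReal_add hr.1 (by linarith)]
      congr 2; ring
    simp only [Function.comp, slope_def_field, hf, h1, Real.coe_toNNReal _ (sub_nonneg.2 hru)]
  have hconst := constant_of_has_deriv_right_zero hcont hderiv
  have h := hconst _ (right_mem_Icc.2 (NNReal.coe_nonneg (s - t)))
  simpa [hf, add_tsub_cancel_of_le hts] using h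

/-- By strict causality the gradient at every bump `e ∈ U` is the same vector `∇F(t, x_{t-})`. Hence
`F` is affine on `U`, and the claim compares `e = 0` with `e = -Δx(t)`. At `t = 0` there is no jump.
-/
theorem ClassS.jump_eq (hΩ : IsGeneric π Ω) {F : Functional m ℝ} (hF : ClassS π Ω F)
    {x : Traj m} (hx : x ∈ Ω) (t : ℝ≥0) :
    F t (stopAt x t) = F t (stopLeft x t) + inner ℝ (vertDeriv F t (stopLeft x t)) (jump x t) := by
  rcases eq_or_ne t 0 with rfl | ht
  · simp [jump_zero, stopLeft_zero]
  replace ht := pos_iff_ne_zero.2 ht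
  obtain ⟨U, hU, hUc, hUj, hUΩ⟩ := hΩ.bump_mem x hx t
  have hgrad : ∀ e ∈ U,
      HasGradientAt (fun e => F t (bump x t e)) (vertDeriv F t (stopLeft x t)) e := by
    intro e he
    have hmem : (t, bump x t e) ∈ domain Ω := mk_mem_domain (hUΩ e he) stopAt_bump
    have h1 := (hF.vertDiff _ hmem).hasGradientAt
    have h2 := hF.vert_strictlyCausal _ hmem
    simp only [leftVersion, stopLeft_bump (hΩ.cadlag x hx) ht] at h2
    change HasGradientAt _ (vertDeriv F t (bump x t e)) 0 at h1
    rw [h2] at h1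
    simp only [bump_bump] at h1
    have h3 := h1.hasFDerivAt
    have h4 := (hasFDerivAt_comp_add_left (f := fun e => F t (bump x t e)) e).1 h3
    rw [add_zero] at h4
    exact h4
  have h := sub_eq_inner_of_hasGradientAt hUc hgrad hUj (mem_of_mem_nhds hU)
  rw [zero_sub, neg_neg, bump_zero] at h
  have h' : bump x t (-(x t - Function.leftLim x t)) = stopLeft x t := bump_neg_jump
  rw [h'] at h
  linarith [h, show inner ℝ (vertDeriv F t (stopLeft x t)) (x t - Function.leftLim x t) =
    inner ℝ (vertDeriv F t (stopLeft x t)) (jump x t) from rfl]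

end ClassM

/-! ### Telescoping along step paths -/

/-- Induction on the number of partition points in `(0, t]`: removing the last one, `p`, leaves
exactly those in `(0, π.prev n p]`. -/
theorem eq_sum_of_jumps {π : PartitionSeq} {n : ℕ} {g c : ℝ≥0 → ℝ} {T : ℝ≥0}
    (hconst : ∀ s t, s ≤ t → t ≤ T → (∀ p ∈ π.pts n, s < p → t < p) → g t = g s)
    (hjump : ∀ p ∈ π.pts n, 0 < p → p ≤ T → g p = g (π.prev n p) + c p) :
    ∀ t ≤ T, g t = g 0 + ∑ s ∈ (π.pts n).filter (fun s => 0 < s ∧ s ≤ t), c s := by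
  suffices H : ∀ k : ℕ, ∀ t ≤ T, ((π.pts n).filter (fun s => 0 < s ∧ s ≤ t)).card = k →
      g t = g 0 + ∑ s ∈ (π.pts n).filter (fun s => 0 < s ∧ s ≤ t), c s from
    fun t ht => H _ t ht rfl
  intro k
  induction k with
  | zero =>
    intro t ht hk
    rw [Finset.card_eq_zero] at hk
    rw [hk, Finset.sum_empty, add_zero]
    refine hconst 0 t zero_le ht fun p hp h0 => ?_
    by_contra! h
    exact Finset.notMem_empty p (hk ▸ Finset.mem_filter.2 ⟨hp, h0, h⟩)
  | succ k ih =>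
    intro t ht hk
    have hne : ((π.pts n).filter (fun s => 0 < s ∧ s ≤ t)).Nonempty := by
      rw [← Finset.card_pos, hk]; exact Nat.succ_pos k
    set p := ((π.pts n).filter (fun s => 0 < s ∧ s ≤ t)).max' hne with hp
    have hpm := Finset.max'_mem _ hne
    rw [← hp, Finset.mem_filter] at hpm
    obtain ⟨hpp, hp0, hpt⟩ := hpm
    have hmax : ∀ q ∈ π.pts n, p < q → t < q := by
      intro q hq hpq
      by_contra! h
      exact (Finset.le_max' _ q (Finset.mem_filter.2 ⟨hq, hp0.trans hpq, h⟩)).not_gt hpq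
    have hins : (π.pts n).filter (fun s => 0 < s ∧ s ≤ t) =
        insert p ((π.pts n).filter (fun s => 0 < s ∧ s ≤ π.prev n p)) := by
      ext q
      simp only [Finset.mem_filter, Finset.mem_insert]
      constructor
      · rintro ⟨hq, h0, hqt⟩
        rcases lt_trichotomy q p with h | h | h
        · exact Or.inr ⟨hq, h0, PartitionSeq.le_prev hq h⟩
        · exact Or.inl h
        · exact absurd hqt (hmax q hq h).not_ge
      · rintro (rfl | ⟨hq, h0, hqp⟩)
        · exact ⟨hpp, hp0, hpt⟩
        · exact ⟨hq, h0, hqp.trans (PartitionSeq.prev_le.trans hpt)⟩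
    have hnot : p ∉ (π.pts n).filter (fun s => 0 < s ∧ s ≤ π.prev n p) := fun h =>
      (PartitionSeq.prev_lt hp0).not_ge (Finset.mem_filter.1 h).2.2
    have hcard : ((π.pts n).filter (fun s => 0 < s ∧ s ≤ π.prev n p)).card = k := by
      rw [hins, Finset.card_insert_of_notMem hnot] at hk
      exact Nat.succ_injective hk
    rw [hins, Finset.sum_insert hnot, hconst p t hpt ht hmax, hjump p hpp hp0 (hpt.trans ht),
      ih _ (PartitionSeq.prev_le.trans (hpt.trans ht)) hcard]
    ring

/-- Isolates the summand at `t_0 = 0`, which telescoping along `x^n` cannot produce because no path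
jumps at `0`. -/
theorem filter_le_eq_insert_zero (π : PartitionSeq) (n : ℕ) (t : ℝ≥0) :
    (π.pts n).filter (fun s => s ≤ t) =
      insert 0 ((π.pts n).filter (fun s => 0 < s ∧ s ≤ t)) := by
  ext q
  simp only [Finset.mem_filter, Finset.mem_insert]
  constructor
  · rintro ⟨hq, h⟩
    rcases eq_or_ne q 0 with h0 | h0
    · exact Or.inl h0
    · exact Or.inr ⟨hq, pos_iff_ne_zero.2 h0, h⟩
  · rintro (rfl | ⟨hq, -, h⟩)
    · exact ⟨π.zero_mem n, zero_le⟩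
    · exact ⟨hq, h⟩

section Telescope

variable {m : ℕ} {π : PartitionSeq} {Ω : Set (Traj m)} {x : Traj m} {n : ℕ}

/-- The path `x^n` does not change between partition points. -/
theorem stopAt_approx_congr {s t : ℝ≥0} (hst : s ≤ t)
    (h : ∀ p ∈ π.pts n, s < p → t < p) : stopAt (approx π n x) t = stopAt (approx π n x) s := by
  funext r
  unfold stopAt
  rcases le_total r s with hr | hr
  · rw [min_eq_left hr, min_eq_left (hr.trans hst)]
  · rw [min_eq_right hr]
    exact approx_const (le_min hr hst) fun p hp hsp => (min_le_right _ _).trans_lt (h p hp hsp)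

theorem stopLeft_approx {p : ℝ≥0} (h0 : 0 < p) :
    stopLeft (approx π n x) p = stopAt (approx π n x) (π.prev n p) := by
  refine stopLeft_of_const_before (PartitionSeq.prev_lt h0) fun r h1 h2 => ?_
  refine approx_const h1 fun q hq hlt => ?_
  by_contra! h
  exact (PartitionSeq.le_prev hq (h.trans_lt h2)).not_gt hlt

/-- Along a step path a horizontally constant functional changes only at partition points, and there
only through its jump term `C`. -/
theorem HorizConst.eq_sum {G : Functional m ℝ} (hG : HorizConst Ω G)
    {C : ℝ≥0 → Traj m → ℝ}
    (hC : ∀ x ∈ Ω, ∀ t, G t (stopAt x t) = G t (stopLeft x t) + C t x) {T : ℝ≥0}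
    (hn : stopAt (approx π n x) T ∈ Ω) {t : ℝ≥0} (ht : t ≤ T) :
    G t (stopAt (approx π n x) t) = G 0 (stopAt (approx π n x) 0) +
      ∑ s ∈ (π.pts n).filter (fun s => 0 < s ∧ s ≤ t), C s (stopAt (approx π n x) T) := by
  have hhor : ∀ s t, s ≤ t → t ≤ T → G t (stopAt (approx π n x) s) =
      G s (stopAt (approx π n x) s) := by
    intro s t hst ht
    have h := hG _ hn s t hst
    rwa [stopAt_stopAt_of_le (hst.trans ht)] at h
  refine eq_sum_of_jumps (π := π) (n := n) (g := fun s => G s (stopAt (approx π n x) s))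
    (T := T) ?_ ?_ t ht
  · intro s t hst ht h
    simp only [stopAt_approx_congr hst h]
    exact hhor s t hst ht
  · intro p hp h0 hpT
    have h := hC _ hn p
    rw [stopAt_stopAt_of_le hpT, stopLeft_stopAt_of_le hpT, stopLeft_approx h0,
      hhor _ _ PartitionSeq.prev_le hpT] at h
    exact h

end Telescope

/-! ### Primitives and pathwise integrals -/

section Primitive

variable {m : ℕ} {π : PartitionSeq} {Ω : Set (Traj m)}

/-- `F` is a primitive of the integrand `φ`. -/
structure IsPrimitive (π : PartitionSeq) (Ω : Set (Traj m)) (F : Functional m ℝ)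
    (φ : Functional m (EuclideanSpace ℝ (Fin m))) : Prop where
  continuous : PiContinuous π Ω F
  horizConst : HorizConst Ω F
  jump_eq : ∀ x ∈ Ω, ∀ t,
    F t (stopAt x t) = F t (stopLeft x t) + inner ℝ (φ t (stopLeft x t)) (jump x t)
  leftCont : LeftCont π Ω φ
  causal : StrictlyCausal Ω φ
  bounded : ∀ x ∈ Ω, ∀ T : ℝ≥0, ∃ K : ℝ, ∀ᶠ n in atTop, ∀ t ≤ T,
    ‖φ t (stopLeft (approx π n x) t)‖ ≤ K

/-- Trades differentiability for the jump relation, which is all that later arguments need of `F`.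
Local boundedness moves from `x^n_t` to `x^n_{t-}` by strict causality. -/
theorem exists_isPrimitive_of_mem_Lb (hΩ : IsGeneric π Ω)
    {φ : Functional m (EuclideanSpace ℝ (Fin m))} (hφ : φ ∈ Lb π Ω) :
    ∃ F, IsPrimitive π Ω F φ := by
  obtain ⟨F, hF, h⟩ := hφ
  have hcausal : StrictlyCausal Ω φ := by
    rintro ⟨t, x⟩ hz
    obtain ⟨hx, hxt⟩ := hΩ.mem_domain_iff.1 hz
    have h1 := h _ (hΩ.stopLeft_mem_domain hx t)
    have h2 := hF.1.1.vert_strictlyCausal _ hz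
    simp only [leftVersion] at h2 ⊢
    rw [h1, ← h2]
    exact h _ hz
  refine ⟨F, hF.1.1.continuous, hF.1.horizConst hΩ, fun x hx t => ?_,
    hF.1.1.vert_leftCont.congr hΩ fun z hz => (h z hz).symm, hcausal, fun x hx T => ?_⟩
  · rw [h _ (hΩ.stopLeft_mem_domain hx t)]
    exact hF.1.1.jump_eq hΩ hx t
  · obtain ⟨n₀, K, hK⟩ := hF.2 x hx T
    refine ⟨K, ?_⟩
    filter_upwards [hΩ.approx_mem_domain hx T, eventually_ge_atTop n₀] with n h1 h2 t ht
    have h3 := hcausal _ (h1 t ht).1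
    simp only [leftVersion, stopLeft_stopAt_of_le le_rfl] at h3
    rw [← h3, h _ (h1 t ht).1]
    exact hK n h2 t ht

/-- The increments of `x^n` against an integrand, at partition points. -/
theorem jump_stopAt_approx {n : ℕ} {x : Traj m} {T p : ℝ≥0} (hp : p ∈ π.pts n) (h0 : 0 < p)
    (hpT : p ≤ T) : jump (stopAt (approx π n x) T) p = x (π.next n p) - x p := by
  rw [jump_stopAt_of_le hpT, jump_approx hp h0]

variable {F : Functional m ℝ} {φ : Functional m (EuclideanSpace ℝ (Fin m))}

theorem tendsto_increment_zero (hπ : π.VanishingMesh) {x : Traj m} (hx : IsCadlag x) :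
    Tendsto (fun n => x (π.next n 0) - x 0) atTop (𝓝 0) := by
  have h := hx.tendsto_increment_prev hπ 0
  simpa [PartitionSeq.prev_zero, jump_zero] using h

/-- The Riemann sum is `F(t, x^n_t) - F(0, x^n_0)` plus its summand at `0`. That summand vanishes in
the limit because `x(t_1) → x(0)`; the rest converges by right-continuity of `F`. -/
theorem IsPrimitive.tendsto_riemannSum (hπ : π.VanishingMesh) (hΩ : IsGeneric π Ω)
    (hF : IsPrimitive π Ω F φ) {x : Traj m} (hx : x ∈ Ω) (t : ℝ≥0) :
    Tendsto (riemannSum π φ t x) atTop (𝓝 (F t (stopAt x t) - F 0 (stopAt x 0))) := by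
  have hr := hF.continuous.rightCont hΩ
  have h1 := hr.c x hx t (fun _ => t) tendsto_const_nhds fun _ => PartitionSeq.prev_le
  have h2 := hr.c x hx 0 (fun _ => 0) tendsto_const_nhds fun _ => PartitionSeq.prev_le
  have h3 := hF.leftCont.c x hx 0 (fun _ => 0) tendsto_const_nhds fun _ => zero_le
  have h4 := h3.inner (𝕜 := ℝ) (tendsto_increment_zero hπ (hΩ.cadlag x hx))
  have h5 := h4.add (h1.sub h2)
  rw [inner_zero_right, zero_add] at h5
  refine h5.congr' ?_
  filter_upwards [hΩ.eventually_approx hx t] with n hn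
  have h6 := hF.horizConst.eq_sum (C := fun t x => inner ℝ (φ t (stopLeft x t)) (jump x t))
    hF.jump_eq hn (t := t) (by simp)
  rw [h6, riemannSum, filter_le_eq_insert_zero, Finset.sum_insert (by simp)]
  congr 1
  rw [add_sub_cancel_left]
  refine Finset.sum_congr rfl fun s hs => ?_
  obtain ⟨hs1, hs2, hs3⟩ := Finset.mem_filter.1 hs
  have hs4 : s ≤ t + 1 := hs3.trans (by simp)
  rw [stopLeft_stopAt_of_le hs4, jump_stopAt_approx hs1 hs2 hs4]

/-- The sums along `x` and along `x_t` can differ, since the last increment looks past `t`; their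
limits agree because `F` sees only `x_t`. -/
theorem IsPrimitive.pathIntegral_eq (hπ : π.VanishingMesh) (hΩ : IsGeneric π Ω)
    (hF : IsPrimitive π Ω F φ) {x : Traj m} (hx : x ∈ Ω) (t : ℝ≥0) :
    pathIntegral π φ t (stopAt x t) = F t (stopAt x t) - F 0 (stopAt x 0) := by
  have h := hF.tendsto_riemannSum hπ hΩ (hΩ.stopAt_mem hx t) t
  rw [stopAt_stopAt_of_le le_rfl, stopAt_stopAt_of_le zero_le] at h
  exact h.limUnder_eq

/-- Since `x^n(0) = x(t_1)`, the initial value along `x^n` depends on `n`; right-continuity of `F`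
at time `0` makes it converge. -/
theorem piContinuous_initial (hΩ : IsGeneric π Ω) (hF : PiContinuous π Ω F) :
    PiContinuous π Ω (fun _ x => F 0 (stopAt x 0)) := by
  have happrox : ∀ x ∈ Ω, Tendsto (fun n => F 0 (stopAt (approx π n x) 0)) atTop
      (𝓝 (F 0 (stopAt x 0))) := fun x hx =>
    (hF.rightCont hΩ).c x hx 0 (fun _ => 0) tendsto_const_nhds fun _ => PartitionSeq.prev_le
  have h1 : ∀ (x : Traj m) s, stopAt (stopLeft x s) 0 = stopAt x 0 := fun x s =>
    stopAt_zero_congr stopLeft_apply_zero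
  have h2 : ∀ (x : Traj m) s, stopAt (stopAt x s) 0 = stopAt x 0 := fun x s =>
    stopAt_stopAt_of_le zero_le
  refine piContinuous_of_tendsto hΩ ?_ ?_ ?_ ?_ <;> intro x hx t
  · simp only [h1, h2]; exact tendsto_const_nhds
  · simp only [h2]; exact tendsto_const_nhds
  · intro _
    simp only [h1, h2]
    exact (happrox x hx).comp (tendsto_fst.mono_left inf_le_left)
  · simp only [h2]
    exact (happrox x hx).comp (tendsto_fst.mono_left inf_le_left)

/-- The integral is the primitive normalised to vanish at time `0`; subtracting the initial value
preserves every clause. -/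
theorem IsPrimitive.isPrimitive_pathIntegral (hπ : π.VanishingMesh) (hΩ : IsGeneric π Ω)
    (hF : IsPrimitive π Ω F φ) : IsPrimitive π Ω (pathIntegral π φ) φ where
  continuous := by
    refine (hF.continuous.sub (piContinuous_initial hΩ hF.continuous)).congr ?_
    rintro ⟨t, x⟩ hz
    obtain ⟨hx, hxt⟩ := hΩ.mem_domain_iff.1 hz
    have h := hF.pathIntegral_eq hπ hΩ hx t
    rw [hxt] at h
    exact h.symm
  horizConst x hx t s hts := by
    have h1 := hF.pathIntegral_eq hπ hΩ (hΩ.stopAt_mem hx t) s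
    rw [stopAt_stopAt_of_ge hts, stopAt_stopAt_of_le zero_le, hF.horizConst x hx t s hts] at h1
    rw [h1, hF.pathIntegral_eq hπ hΩ hx t]
  jump_eq x hx t := by
    have h1 := hF.pathIntegral_eq hπ hΩ (hΩ.stopLeft_mem hx t) t
    rw [stopAt_stopLeft_of_ge le_rfl,
      stopAt_zero_congr (x := stopLeft x t) (y := x) stopLeft_apply_zero] at h1
    rw [h1, hF.pathIntegral_eq hπ hΩ hx t, hF.jump_eq x hx t]
    ring
  leftCont := hF.leftCont
  causal := hF.causal
  bounded := hF.bounded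

theorem IsPrimitive.pathIntegral_zero (hπ : π.VanishingMesh) (hΩ : IsGeneric π Ω)
    (hF : IsPrimitive π Ω F φ) {x : Traj m} (hx : x ∈ Ω) :
    pathIntegral π φ 0 (stopAt x 0) = 0 := by
  rw [hF.pathIntegral_eq hπ hΩ hx 0, sub_self]

theorem IsPrimitive.pathIntegrable (hπ : π.VanishingMesh) (hΩ : IsGeneric π Ω)
    (hF : IsPrimitive π Ω F φ) : PathIntegrable π Ω φ where
  leftCont := hF.leftCont.leftVersion
  tendsto x hx t := by
    rw [hF.pathIntegral_eq hπ hΩ hx t]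
    exact hF.tendsto_riemannSum hπ hΩ hx t
  continuous := (hF.isPrimitive_pathIntegral hπ hΩ).continuous

/-- Continuous functionals are bounded along `x^n_{t-}`, locally uniformly in `t`. -/
theorem PiContinuous.bounded (hπ : π.VanishingMesh) (hΩ : IsGeneric π Ω)
    (hF : PiContinuous π Ω F) {x : Traj m} (hx : x ∈ Ω) (T : ℝ≥0) :
    ∃ K : ℝ, ∀ᶠ n in atTop, ∀ t ≤ T, |F t (stopLeft (approx π n x) t)| ≤ K := by
  -- Near `(∞, t)` a pair `(n, s)` lies on one side of `t'_n`, and each side has a limit;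
  -- compactness of `[0, T]` then makes the bound uniform. The sequence `t + 1 / (n + 1)` below only
  -- witnesses that the right side is nonempty.
  have hloc : ∀ t : ℝ≥0, ∃ K : ℝ, ∀ᶠ p : ℕ × ℝ≥0 in atTop ×ˢ 𝓝 t,
      |F p.2 (stopLeft (approx π p.1 x) p.2)| ≤ K := by
    intro t
    have h1 := tendsto_prod_of_seq (f := fun n s => F s (stopLeft (approx π n x) s))
      (S := fun n => Iic (π.prev n t)) _ (hπ.tendsto_prev t) (fun n => self_mem_Iic)
      fun τ hτ h => (hF.leftCont hΩ).c x hx t τ hτ h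
    have hlim : Tendsto (fun n : ℕ => t + (1 / ((n : ℝ≥0) + 1))) atTop (𝓝 t) := by
      have h := tendsto_one_div_add_atTop_nhds_zero_nat (𝕜 := ℝ≥0)
      simpa using h.const_add t
    have h2 := tendsto_prod_of_seq (f := fun n s => F s (stopLeft (approx π n x) s))
      (S := fun n => Ioi (π.prev n t)) (t := t) _ hlim
      (fun n => PartitionSeq.prev_le.trans_lt (lt_add_of_pos_right _ (by positivity)))
      fun τ hτ h => (hF.rightCont hΩ).d x hx t τ hτ h
    refine ⟨max (|F t (stopLeft x t)| + 1) (|F t (stopAt x t)| + 1), ?_⟩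
    have e1 := h1.abs.eventually (gt_mem_nhds (lt_add_one _))
    have e2 := h2.abs.eventually (gt_mem_nhds (lt_add_one _))
    rw [eventually_inf_principal] at e1 e2
    filter_upwards [e1, e2] with p hp1 hp2
    rcases le_or_gt p.2 (π.prev p.1 t) with h | h
    · exact (hp1 h).le.trans (le_max_left _ _)
    · exact (hp2 h).le.trans (le_max_right _ _)
  have hc : IsCompact (Iic T) := by
    rw [← Icc_bot]; exact isCompact_Icc
  refine hc.induction_on (p := fun s => ∃ K : ℝ, ∀ᶠ n in atTop, ∀ t ∈ s,
    |F t (stopLeft (approx π n x) t)| ≤ K) ?_ ?_ ?_ ?_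
  · exact ⟨0, by simp⟩
  · rintro s s' hss ⟨K, hK⟩
    exact ⟨K, hK.mono fun n h t ht => h t (hss ht)⟩
  · rintro s s' ⟨K, hK⟩ ⟨K', hK'⟩
    refine ⟨max K K', ?_⟩
    filter_upwards [hK, hK'] with n h h' t ht
    rcases ht with ht | ht
    · exact (h t ht).trans (le_max_left _ _)
    · exact (h' t ht).trans (le_max_right _ _)
  · intro t _
    obtain ⟨K, hK⟩ := hloc t
    obtain ⟨P, hP, Q, hQ, hPQ⟩ := eventually_prod_iff.1 hK
    exact ⟨{s | Q s}, mem_nhdsWithin_of_mem_nhds hQ, K, hP.mono fun n hn s hs => hPQ hn hs⟩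

end Primitive

/-! ### Partial sums of weights and their limits -/

section Weights

/-- `∑_{t_i ≤ t} a_n(t_i)`. -/
noncomputable def partialSum (π : PartitionSeq) (a : ℕ → ℝ≥0 → ℝ) (n : ℕ) (t : ℝ≥0) : ℝ :=
  ∑ s ∈ (π.pts n).filter (fun s => s ≤ t), a n s

theorem partialSum_mono {π : PartitionSeq} {a : ℕ → ℝ≥0 → ℝ} (ha : ∀ n s, 0 ≤ a n s) (n : ℕ) :
    Monotone (partialSum π a n) := fun _ _ hst =>
  Finset.sum_le_sum_of_subset_of_nonneg
    (Finset.monotone_filter_right _ fun _ _ h => h.trans hst) fun _ _ _ => ha _ _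

/-- The partial sums only change at partition points. -/
theorem partialSum_sub_eq {π : PartitionSeq} {a : ℕ → ℝ≥0 → ℝ} {n : ℕ} {s p : ℝ≥0} (hsp : s < p)
    (h : ∀ q ∈ π.pts n, q < p → q ≤ s) :
    partialSum π a n p - partialSum π a n s = if p ∈ π.pts n then a n p else 0 := by
  unfold partialSum
  split_ifs with hp
  · have : (π.pts n).filter (fun s => s ≤ p) =
        insert p ((π.pts n).filter (fun r => r ≤ s)) := by
      ext q
      simp only [Finset.mem_filter, Finset.mem_insert]
      constructor
      · rintro ⟨hq, hqp⟩
        rcases eq_or_lt_of_le hqp with h1 | h1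
        · exact Or.inl h1
        · exact Or.inr ⟨hq, h q hq h1⟩
      · rintro (rfl | ⟨hq, hqs⟩)
        · exact ⟨hp, le_rfl⟩
        · exact ⟨hq, hqs.trans hsp.le⟩
    rw [this, Finset.sum_insert (by simp [hsp])]
    ring
  · have : (π.pts n).filter (fun s => s ≤ p) = (π.pts n).filter (fun r => r ≤ s) := by
      ext q
      simp only [Finset.mem_filter]
      constructor
      · rintro ⟨hq, hqp⟩
        exact ⟨hq, h q hq (lt_of_le_of_ne hqp fun h => hp (h ▸ hq))⟩
      · rintro ⟨hq, hqs⟩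
        exact ⟨hq, hqs.trans hsp.le⟩
    rw [this, sub_self]

/-- The partial sums of the nonnegative weights `a_n` converge to `u`, on either side of the
points `t'_n`. -/
structure IsWeightLimit (π : PartitionSeq) (a : ℕ → ℝ≥0 → ℝ) (u : ℝ≥0 → ℝ) : Prop where
  nonneg : ∀ n s, 0 ≤ a n s
  cadlag : IsCadlag u
  zero : u 0 = 0
  right : ∀ t, Tendsto (fun p : ℕ × ℝ≥0 => partialSum π a p.1 p.2) (rightFilter π t) (𝓝 (u t))
  left : ∀ t, Tendsto (fun p : ℕ × ℝ≥0 => partialSum π a p.1 p.2) (leftFilter π t)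
    (𝓝 (Function.leftLim u t))

theorem IsWeightLimit.tendsto {π : PartitionSeq} {a : ℕ → ℝ≥0 → ℝ} {u : ℝ≥0 → ℝ}
    (h : IsWeightLimit π a u) (t : ℝ≥0) :
    Tendsto (fun n => partialSum π a n t) atTop (𝓝 (u t)) := by
  have h1 := (h.right t).comp (tendsto_rightFilter_const π t)
  exact h1

theorem IsWeightLimit.tendsto_prev {π : PartitionSeq} (hπ : π.VanishingMesh)
    {a : ℕ → ℝ≥0 → ℝ} {u : ℝ≥0 → ℝ} (h : IsWeightLimit π a u) (t : ℝ≥0) :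
    Tendsto (fun n => partialSum π a n (π.prev n t)) atTop (𝓝 (u t)) := by
  have h1 := (h.right t).comp
    (tendsto_rightFilter (hπ.tendsto_prev t) (Eventually.of_forall fun _ => le_rfl))
  exact h1

theorem IsWeightLimit.mono {π : PartitionSeq} {a : ℕ → ℝ≥0 → ℝ} {u : ℝ≥0 → ℝ}
    (h : IsWeightLimit π a u) : Monotone u := fun s t hst =>
  le_of_tendsto_of_tendsto' (h.tendsto s) (h.tendsto t) fun n => partialSum_mono h.nonneg n hst

/-- The Stieltjes function of a limit of weights. -/
noncomputable def IsWeightLimit.stieltjes {π : PartitionSeq} {a : ℕ → ℝ≥0 → ℝ} {u : ℝ≥0 → ℝ}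
    (h : IsWeightLimit π a u) : StieltjesFunction ℝ≥0 where
  toFun := u
  mono' := h.mono
  right_continuous' t := (h.cadlag t).1

end Weights

/-! ### Quadratic variation along a direction -/

section QuadVar

variable {m : ℕ} {π : PartitionSeq}

/-- `(c · (x(t_{i+1}) - x(t_i)))²`. -/
noncomputable def sqIncrement (π : PartitionSeq) (x : Traj m) (c : EuclideanSpace ℝ (Fin m)) (n : ℕ)
    (s : ℝ≥0) : ℝ :=
  (inner ℝ c (x (π.next n s) - x s)) ^ 2

theorem tendsto_symm_of_tendstoUniformly {l : ℕ → (ℝ≥0 ≃o ℝ≥0)}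
    (hl : TendstoUniformly (fun n s => l n s) (fun s => s) atTop) (t : ℝ≥0) :
    Tendsto (fun p : ℕ × ℝ≥0 => (l p.1).symm p.2) (atTop ×ˢ 𝓝 t) (𝓝 t) := by
  rw [Metric.tendstoUniformly_iff] at hl
  rw [Metric.tendsto_nhds]
  intro ε hε
  filter_upwards [(hl (ε / 2) (by positivity)).prod_mk (Metric.ball_mem_nhds t (half_pos hε))]
    with p hp
  have h1 := hp.1 ((l p.1).symm p.2)
  rw [OrderIso.apply_symm_apply] at h1
  have h2 : dist p.2 t < ε / 2 := hp.2
  linarith [dist_triangle ((l p.1).symm p.2) p.2 t]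

/-! ### Time changes realising `J₁` convergence. -/

section TimeChange

variable {x : Traj m} {c : EuclideanSpace ℝ (Fin m)} {u : ℝ≥0 → ℝ} {l : ℕ → (ℝ≥0 ≃o ℝ≥0)}

/-- The uniform convergence is read at `(l n)⁻¹ s`, which stays in a compact set. Limits of partial
sums thereby become limits of `u` along `(l n)⁻¹ s`. -/
theorem tendsto_partialSum_sub_timeChange {a : ℕ → ℝ≥0 → ℝ}
    (hl : TendstoUniformly (fun n s => l n s) (fun s => s) atTop)
    (hu : ∀ N : ℝ≥0, TendstoUniformlyOn (fun n s => partialSum π a n (l n s)) u atTop (Iic N))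
    (t : ℝ≥0) :
    Tendsto (fun p : ℕ × ℝ≥0 => partialSum π a p.1 p.2 - u ((l p.1).symm p.2))
      (atTop ×ˢ 𝓝 t) (𝓝 0) := by
  have h := hu (t + 1)
  rw [Metric.tendstoUniformlyOn_iff] at h
  rw [Metric.tendsto_nhds]
  intro ε hε
  have h1 : ∀ᶠ p : ℕ × ℝ≥0 in atTop ×ˢ 𝓝 t, (l p.1).symm p.2 ≤ t + 1 :=
    (tendsto_symm_of_tendstoUniformly hl t).eventually (Iic_mem_nhds (by simp))
  filter_upwards [h1, tendsto_fst.eventually (h ε hε)] with p h2 h3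
  have h4 := h3 _ h2
  rw [OrderIso.apply_symm_apply] at h4
  rw [Real.dist_eq, sub_zero, ← Real.dist_eq, dist_comm]
  exact h4

/-- A jump of `u` can only come from a single summand, at `l n t`, which must then be a partition
point with a non-vanishing increment of `x` after it. The interval starting at `l n t` shrinks to
`t`, so its increment avoids tending to `0` only if it straddles `t`: `l n t < t ≤ next`. This
identifies `l n t` as `t'_n`. -/
theorem eventually_timeChange_eq_prev (hπ : π.VanishingMesh) (hx : IsCadlag x) (hu' : IsCadlag u)
    (hl : TendstoUniformly (fun n s => l n s) (fun s => s) atTop)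
    (hu : ∀ N : ℝ≥0, TendstoUniformlyOn
      (fun n s => partialSum π (sqIncrement π x c) n (l n s)) u atTop (Iic N))
    {t : ℝ≥0} (ht : 0 < t) (hjump : u t ≠ Function.leftLim u t) :
    ∀ᶠ n in atTop, l n t = π.prev n t := by
  set S := partialSum π (sqIncrement π x c) with hS
  have hp : Tendsto (fun n => l n t) atTop (𝓝 t) := hl.tendsto_at t
  have hp0 : ∀ n, 0 < l n t := fun n => pos_of_gt ((l n).strictMono ht)
  -- The first entry leaves no partition point strictly between `l n (σ n)` and `l n t`; the second
  -- forces `σ n → t`.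
  set σ : ℕ → ℝ≥0 := fun n => max ((l n).symm (π.prev n (l n t))) (t - 1 / ((n : ℝ≥0) + 1)) with hσ
  have hσt : ∀ n, σ n < t := by
    intro n
    refine max_lt ?_ (tsub_lt_self ht (by positivity))
    rw [OrderIso.symm_apply_lt]
    exact PartitionSeq.prev_lt (hp0 n)
  have hσlim : Tendsto σ atTop (𝓝 t) := by
    refine tendsto_of_tendsto_of_tendsto_of_le_of_le ?_ tendsto_const_nhds
      (fun n => le_max_right _ _) (fun n => (hσt n).le)
    have h := (tendsto_const_nhds (x := t)).sub (tendsto_one_div_add_atTop_nhds_zero_nat (𝕜 := ℝ≥0))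
    rwa [tsub_zero] at h
  have hstep : ∀ n, S n (l n t) - S n (l n (σ n)) =
      if l n t ∈ π.pts n then sqIncrement π x c n (l n t) else 0 := by
    intro n
    refine partialSum_sub_eq ((l n).strictMono (hσt n)) fun q hq hqp => ?_
    exact (PartitionSeq.le_prev hq hqp).trans ((l n).symm_apply_le.1 (le_max_left _ _))
  have hlim : Tendsto (fun n => S n (l n t) - S n (l n (σ n))) atTop
      (𝓝 (u t - Function.leftLim u t)) := by
    have h1 : Tendsto (fun n => S n (l n t)) atTop (𝓝 (u t)) := (hu t).tendsto_at (self_mem_Iic)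
    have h2 : Tendsto (fun n => u (σ n)) atTop (𝓝 (Function.leftLim u t)) :=
      (hu'.tendsto_leftLim t).comp (tendsto_nhdsWithin_iff.2 ⟨hσlim, Eventually.of_forall hσt⟩)
    have h3 : Tendsto (fun n => S n (l n (σ n)) - u (σ n)) atTop (𝓝 0) := by
      rw [Metric.tendsto_nhds]
      intro ε hε
      filter_upwards [Metric.tendstoUniformlyOn_iff.1 (hu t) ε hε] with n hn
      have h := hn (σ n) (hσt n).le
      rwa [Real.dist_eq, sub_zero, ← Real.dist_eq, dist_comm]
    have h4 := h3.add h2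
    simp only [sub_add_cancel, zero_add] at h4
    exact h1.sub h4
  have hD : u t - Function.leftLim u t ≠ 0 := sub_ne_zero.2 hjump
  have hmem : ∀ᶠ n in atTop, l n t ∈ π.pts n := by
    filter_upwards [hlim.eventually_ne hD] with n hn
    by_contra h
    rw [hstep, if_neg h] at hn
    exact hn rfl
  have hlim' : Tendsto (fun n => sqIncrement π x c n (l n t)) atTop
      (𝓝 (u t - Function.leftLim u t)) := by
    refine hlim.congr' ?_
    filter_upwards [hmem] with n hn
    rw [hstep, if_pos hn]
  have hnext := hπ.tendsto_next hp hmem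
  -- If both endpoints of the interval fell on the same side of `t` infinitely often, `x` would have
  -- the same limit at both, and the squared increment would tend to `0` instead of the jump of `u`.
  have hcontra : ∀ (E : Set ℕ) (v : EuclideanSpace ℝ (Fin m)),
      Tendsto (fun n => x (l n t)) (atTop ⊓ 𝓟 E) (𝓝 v) →
      Tendsto (fun n => x (π.next n (l n t))) (atTop ⊓ 𝓟 E) (𝓝 v) →
      (atTop ⊓ 𝓟 E).NeBot → False := by
    intro E v h1 h2 hne
    have h3 : Tendsto (fun n => sqIncrement π x c n (l n t)) (atTop ⊓ 𝓟 E)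
        (𝓝 ((inner ℝ c (v - v)) ^ 2)) :=
      ((tendsto_const_nhds (x := c)).inner (h2.sub h1)).pow 2
    have h4 := tendsto_nhds_unique h3 (hlim'.mono_left inf_le_left)
    rw [sub_self, inner_zero_right] at h4
    exact hD (by rw [← h4]; norm_num)
  have hlt : ∀ᶠ n in atTop, l n t < t := by
    by_contra h
    rw [not_eventually, frequently_iff_neBot] at h
    simp only [not_lt] at h
    refine hcontra {n | t ≤ l n t} (x t) ?_ ?_ h
    · exact (hx.tendsto_right t).comp (tendsto_nhdsWithin_iff.2 ⟨hp.mono_left inf_le_left,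
        eventually_inf_principal.2 (Eventually.of_forall fun _ h => h)⟩)
    · refine (hx.tendsto_right t).comp (tendsto_nhdsWithin_iff.2 ⟨hnext.mono_left inf_le_left,
        eventually_inf_principal.2 ?_⟩)
      filter_upwards [hmem] with n hn h
      exact le_trans h (PartitionSeq.le_next hn)
  have hle : ∀ᶠ n in atTop, t ≤ π.next n (l n t) := by
    by_contra h
    rw [not_eventually, frequently_iff_neBot] at h
    simp only [not_le] at h
    refine hcontra {n | π.next n (l n t) < t} (Function.leftLim x t) ?_ ?_ h
    · refine (hx.tendsto_leftLim t).comp (tendsto_nhdsWithin_iff.2 ⟨hp.mono_left inf_le_left,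
        eventually_inf_principal.2 ?_⟩)
      filter_upwards [hmem] with n hn h
      exact lt_of_le_of_lt (PartitionSeq.le_next hn) h
    · exact (hx.tendsto_leftLim t).comp (tendsto_nhdsWithin_iff.2 ⟨hnext.mono_left inf_le_left,
        eventually_inf_principal.2 (Eventually.of_forall fun _ h => h)⟩)
  filter_upwards [hmem, hlt, hle] with n h1 h2 h3
  exact (PartitionSeq.prev_eq h1 h2 h3).symm

/-- Limits of partial sums of squared increments from `J₁` convergence. -/
theorem isWeightLimit_of_timeChange (hπ : π.VanishingMesh) (hx : IsCadlag x) (hu' : IsCadlag u)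
    (hl : TendstoUniformly (fun n s => l n s) (fun s => s) atTop)
    (hu : ∀ N : ℝ≥0, TendstoUniformlyOn
      (fun n s => partialSum π (sqIncrement π x c) n (l n s)) u atTop (Iic N)) :
    IsWeightLimit π (sqIncrement π x c) u := by
  have hsymm := tendsto_symm_of_tendstoUniformly hl
  have hsub := tendsto_partialSum_sub_timeChange hl hu
  have hcont : ∀ t, u t = Function.leftLim u t → ContinuousAt u t := by
    intro t h
    refine continuousAt_iff_continuous_left'_right'.2
      ⟨?_, (hu'.tendsto_right t).mono_left (nhdsWithin_mono _ Ioi_subset_Ici_self)⟩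
    have h1 := hu'.tendsto_leftLim t
    rw [← h] at h1
    exact h1
  have hpos : ∀ t, u t ≠ Function.leftLim u t → 0 < t := by
    intro t h
    rw [pos_iff_ne_zero]
    rintro rfl
    exact h (leftLim_zero u).symm
  have hright : ∀ t, Tendsto (fun p : ℕ × ℝ≥0 => partialSum π (sqIncrement π x c) p.1 p.2)
      (rightFilter π t) (𝓝 (u t)) := by
    intro t
    have h1 : Tendsto (fun p : ℕ × ℝ≥0 => u ((l p.1).symm p.2)) (rightFilter π t) (𝓝 (u t)) := by
      by_cases h : u t = Function.leftLim u t
      · exact (hcont t h).tendsto.comp ((hsymm t).mono_left inf_le_left)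
      -- At a jump `l n t = t'_n` eventually, so `t'_n ≤ s` says exactly `t ≤ (l n)⁻¹ s`, and
      -- right-continuity of `u` suffices.
      · refine (hu'.tendsto_right t).comp (tendsto_nhdsWithin_iff.2
          ⟨(hsymm t).mono_left inf_le_left, eventually_inf_principal.2 ?_⟩)
        filter_upwards [tendsto_fst.eventually
          (eventually_timeChange_eq_prev hπ hx hu' hl hu (hpos t h) h)] with p hp hle
        refine (l p.1).le_symm_apply.2 ?_
        rw [hp]; exact hle
    have h2 := ((hsub t).mono_left inf_le_left).add h1
    simp only [sub_add_cancel, zero_add] at h2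
    exact h2
  have hleft : ∀ t, Tendsto (fun p : ℕ × ℝ≥0 => partialSum π (sqIncrement π x c) p.1 p.2)
      (leftFilter π t) (𝓝 (Function.leftLim u t)) := by
    intro t
    have h1 : Tendsto (fun p : ℕ × ℝ≥0 => u ((l p.1).symm p.2)) (leftFilter π t)
        (𝓝 (Function.leftLim u t)) := by
      by_cases h : u t = Function.leftLim u t
      · rw [← h]
        exact (hcont t h).tendsto.comp ((hsymm t).mono_left inf_le_left)
      · refine (hu'.tendsto_leftLim t).comp (tendsto_nhdsWithin_iff.2
          ⟨(hsymm t).mono_left inf_le_left, eventually_inf_principal.2 ?_⟩)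
        filter_upwards [tendsto_fst.eventually
          (eventually_timeChange_eq_prev hπ hx hu' hl hu (hpos t h) h)] with p hp hle
        refine (l p.1).symm_apply_lt.2 ?_
        rw [hp]; exact hle
    have h2 := ((hsub t).mono_left inf_le_left).add h1
    simp only [sub_add_cancel, zero_add] at h2
    exact h2
  -- For `u 0 = 0`: the partial sum at time `0` is the one squared increment over the first
  -- interval, which tends to `0`.
  have hinc := ((tendsto_const_nhds (x := c)).inner (𝕜 := ℝ) (hx.tendsto_increment_prev hπ 0)).pow 2
  simp only [PartitionSeq.prev_zero, jump_zero, inner_zero_right] at hinc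
  refine ⟨fun n s => sq_nonneg _, hu', ?_, hright, hleft⟩
  refine tendsto_nhds_unique ((hright 0).comp (tendsto_rightFilter_const π 0))
    ((hinc.congr fun n => ?_).trans (by norm_num))
  simp only [Function.comp, partialSum]
  rw [filter_le_eq_insert_zero, Finset.sum_insert (by simp),
    Finset.filter_false_of_mem (fun s _ h => h.1.not_ge h.2), Finset.sum_empty, add_zero,
    sqIncrement]

end TimeChange

/-! ### From matrix-valued variation to scalar sums of squares. -/

/-- `c' q c`. -/
noncomputable def quadForm (c : EuclideanSpace ℝ (Fin m)) (q : Matrix (Fin m) (Fin m) ℝ) : ℝ :=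
  ∑ i, ∑ j, c i * c j * q i j

theorem quadForm_qvSum (x : Traj m) (c : EuclideanSpace ℝ (Fin m)) (n : ℕ) (t : ℝ≥0) :
    quadForm c (qvSum π x n t) = partialSum π (sqIncrement π x c) n t := by
  unfold quadForm qvSum partialSum sqIncrement
  have h : ∀ s, (inner ℝ c (x (π.next n s) - x s)) ^ 2 = ∑ i, ∑ j, c i * c j *
      ((x (π.next n s) i - x s i) * (x (π.next n s) j - x s j)) := by
    intro s
    rw [PiLp.inner_apply, sq, Finset.sum_mul_sum]
    refine Finset.sum_congr rfl fun i _ => Finset.sum_congr rfl fun j _ => ?_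
    simp only [RCLike.inner_apply, conj_trivial, PiLp.sub_apply]
    ring
  simp only [h]
  conv_rhs => rw [Finset.sum_comm]
  refine Finset.sum_congr rfl fun i _ => ?_
  conv_rhs => rw [Finset.sum_comm]
  refine Finset.sum_congr rfl fun j _ => ?_
  simp only [Matrix.sum_apply, Matrix.vecMulVec_apply, Finset.mul_sum]

theorem continuous_quadForm (c : EuclideanSpace ℝ (Fin m)) : Continuous (quadForm c) := by
  unfold quadForm
  fun_prop

theorem uniformContinuous_matrix_apply (i j : Fin m) :
    UniformContinuous fun q : Matrix (Fin m) (Fin m) ℝ => q i j :=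
  (Pi.uniformContinuous_proj (fun _ : Fin m => ℝ) j).comp
    (Pi.uniformContinuous_proj (fun _ : Fin m => Fin m → ℝ) i)

theorem uniformContinuous_sum {α ι : Type*} [UniformSpace α] {f : ι → α → ℝ} (s : Finset ι)
    (h : ∀ i, UniformContinuous (f i)) : UniformContinuous fun a => ∑ i ∈ s, f i a := by
  classical
  induction s using Finset.induction_on with
  | empty => simpa using uniformContinuous_const
  | insert i s hi ih =>
    simp only [Finset.sum_insert hi]
    exact (h i).add ih

theorem uniformContinuous_quadForm (c : EuclideanSpace ℝ (Fin m)) :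
    UniformContinuous (quadForm c) := by
  unfold quadForm
  refine uniformContinuous_sum _ fun i => uniformContinuous_sum _ fun j => ?_
  exact (uniformContinuous_matrix_apply i j).const_mul' (c i * c j)

/-- A quadratic form is uniformly continuous in the matrix, so one time change for `[x]` serves all
directions `c`; the scalar sums have nonnegative weights. -/
theorem HasQuadVar.isWeightLimit (hπ : π.VanishingMesh) {x : Traj m} (hx : IsCadlag x)
    {q : ℝ≥0 → Matrix (Fin m) (Fin m) ℝ} (hq : HasQuadVar π x q)
    (c : EuclideanSpace ℝ (Fin m)) :
    IsWeightLimit π (sqIncrement π x c) fun t => quadForm c (q t) := by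
  obtain ⟨hqc, l, hl, hu⟩ := hq
  refine isWeightLimit_of_timeChange hπ hx (fun t => ⟨?_, ?_⟩) hl fun N => ?_
  · exact (continuous_quadForm c).continuousAt.comp_continuousWithinAt (hqc t).1
  · obtain ⟨v, hv⟩ := (hqc t).2
    exact ⟨_, ((continuous_quadForm c).tendsto v).comp hv⟩
  · have h := (uniformContinuous_quadForm c).comp_tendstoUniformlyOn (hu N)
    refine h.congr (Eventually.of_forall fun n s _ => ?_)
    exact quadForm_qvSum x c n (l n s)

theorem hasQuadVar_quadVar {x : Traj m} (hx : x ∈ finiteQV m π) :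
    HasQuadVar π x (quadVar π x) := by
  have h := hx.2
  unfold quadVar
  rw [dif_pos h]
  exact h.choose_spec

end QuadVar

/-! ### Quantile functions -/

section Quantile

variable {v : ℝ≥0 → ℝ} {y M : ℝ} {s : ℝ≥0}

/-- The generalized inverse of a nondecreasing function. -/
noncomputable def quantile (v : ℝ≥0 → ℝ) (y : ℝ) : ℝ≥0 := sInf {s | y ≤ v s}

theorem quantile_le (h : y ≤ v s) : quantile v y ≤ s := csInf_le' h

/-- Right-continuity makes the infimum attained. With `quantile_le` this gives the Galois connection
`quantile v y ≤ s ↔ y ≤ v s`. -/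
theorem le_of_quantile_le (hmono : Monotone v) (hrc : ∀ s, ContinuousWithinAt v (Ici s) s)
    (hy : ∃ s, y ≤ v s) (h : quantile v y ≤ s) : y ≤ v s := by
  have h1 : ∀ r, s < r → y ≤ v r := by
    intro r hr
    obtain ⟨q, hq, hqr⟩ := exists_lt_of_csInf_lt hy (lt_of_le_of_lt h hr)
    exact le_trans hq (hmono hqr.le)
  have h2 : Tendsto v (𝓝[>] s) (𝓝 (v s)) :=
    (hrc s).mono_left (nhdsWithin_mono _ Ioi_subset_Ici_self)
  exact ge_of_tendsto h2 (by filter_upwards [self_mem_nhdsWithin] with r hr using h1 r hr)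

theorem aemeasurable_quantile (hM : ∃ t, v t = M) :
    AEMeasurable (quantile v) (volume.restrict (Ioc 0 M)) := by
  refine aemeasurable_restrict_of_monotoneOn measurableSet_Ioc fun y _ z hz hyz => ?_
  obtain ⟨t, ht⟩ := hM
  exact csInf_le_csInf (OrderBot.bddBelow _) ⟨t, by simpa [ht] using hz.2⟩
    fun s hs => le_trans hyz hs

/-- A finite measure on `[0, ∞)` is the image of Lebesgue measure under its quantile function. -/
theorem map_quantile {μ : Measure ℝ≥0} [IsFiniteMeasure μ] (hmono : Monotone v)
    (hrc : ∀ s, ContinuousWithinAt v (Ici s) s)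
    (hμ : ∀ s, μ (Iic s) = ENNReal.ofReal (v s)) (hM : ∃ t, v t = M) (hle : ∀ s, v s ≤ M) :
    (volume.restrict (Ioc 0 M)).map (quantile v) = μ := by
  have hae := aemeasurable_quantile (v := v) hM
  have : IsFiniteMeasure ((volume.restrict (Ioc 0 M)).map (quantile v)) :=
    Measure.isFiniteMeasure_map _ _
  refine Measure.ext_of_Iic _ _ fun s => ?_
  rw [Measure.map_apply_of_aemeasurable hae measurableSet_Iic, hμ,
    Measure.restrict_apply' measurableSet_Ioc]
  have h : quantile v ⁻¹' Iic s ∩ Ioc 0 M = Ioc 0 (v s) := by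
    obtain ⟨t, ht⟩ := hM
    ext y
    constructor
    · rintro ⟨h1, h2, h3⟩
      exact ⟨h2, le_of_quantile_le hmono hrc ⟨t, ht ▸ h3⟩ h1⟩
    · rintro ⟨h1, h2⟩
      exact ⟨quantile_le h2, h1, h2.trans (hle s)⟩
  rw [h, Real.volume_Ioc, sub_zero]

/-- Turns integrals against varying measures into Lebesgue integrals on the line, where dominated
convergence applies. -/
theorem integral_eq_quantile {μ : Measure ℝ≥0} [IsFiniteMeasure μ] (hmono : Monotone v)
    (hrc : ∀ s, ContinuousWithinAt v (Ici s) s)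
    (hμ : ∀ s, μ (Iic s) = ENNReal.ofReal (v s)) (hM : ∃ t, v t = M) (hle : ∀ s, v s ≤ M)
    {f : ℝ≥0 → ℝ} (hf : AEStronglyMeasurable f μ) :
    AEStronglyMeasurable (fun y => f (quantile v y)) (volume.restrict (Ioc 0 M)) ∧
      ∫ s, f s ∂μ = ∫ y, (Ioc 0 M).indicator (fun y => f (quantile v y)) y := by
  have hmap := map_quantile hmono hrc hμ hM hle
  have hae := aemeasurable_quantile (v := v) hM
  rw [← hmap] at hf
  refine ⟨hf.comp_aemeasurable hae, ?_⟩
  rw [← hmap, integral_map hae hf, integral_indicator measurableSet_Ioc]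

end Quantile

/-! ### Convergence of weighted sums -/

section WeightedSums

variable {π : PartitionSeq}

/-- A limit at `s` along times before the partition point `s'_n` is a genuine limit, for all but
countably many `s`. -/
theorem countable_not_tendsto (hπ : π.VanishingMesh) {f : ℕ → ℝ≥0 → ℝ} {h : ℝ≥0 → ℝ}
    (hf : ∀ t, Tendsto (fun p : ℕ × ℝ≥0 => f p.1 p.2)
      ((atTop ×ˢ 𝓝 t) ⊓ 𝓟 {p | p.2 ≤ π.prev p.1 t}) (𝓝 (h t))) :
    {t | ¬ Tendsto (fun p : ℕ × ℝ≥0 => f p.1 p.2) (atTop ×ˢ 𝓝 t) (𝓝 (h t))}.Countable := by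
  set B : ℕ → Set ℝ≥0 := fun k => {t | ¬ ∀ᶠ p : ℕ × ℝ≥0 in atTop ×ˢ 𝓝 t,
    dist (f p.1 p.2) (h t) < 1 / ((k : ℝ) + 1)} with hB
  have hsub : {t | ¬ Tendsto (fun p : ℕ × ℝ≥0 => f p.1 p.2) (atTop ×ˢ 𝓝 t) (𝓝 (h t))} ⊆
      ⋃ k, B k := by
    intro t ht
    by_contra hcon
    simp only [hB, mem_iUnion, mem_ofPred_eq, not_exists, not_not] at hcon
    refine ht (Metric.tendsto_nhds.2 fun ε hε => ?_)
    obtain ⟨k, hk⟩ := exists_nat_one_div_lt hε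
    exact (hcon k).mono fun p hp => hp.trans hk
  refine (countable_iUnion fun k => ?_).mono hsub
  -- For `s < t` close to `t`, all pairs near `(∞, s)` lie before `t'_n`, because `t'_n → t`. There
  -- `f` is close to `h t`, hence so is `h s`, and `s ∉ B k`. A set without left accumulation points
  -- is countable.
  have hisol : ∀ t, 𝓝[B k ∩ Iio t] t = ⊥ := by
    intro t
    set ε : ℝ := 1 / ((k : ℝ) + 1) with hε
    have hε0 : 0 < ε := by positivity
    have h1 := (Metric.tendsto_nhds.1 (hf t)) (ε / 2) (by positivity)
    rw [eventually_inf_principal] at h1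
    obtain ⟨P, hP, Q, hQ, hPQ⟩ := eventually_prod_iff.1 h1
    obtain ⟨U, hU, hUo, htU⟩ := eventually_nhds_iff.1 hQ
    rw [← empty_mem_iff_bot, mem_nhdsWithin]
    refine ⟨U, hUo, htU, ?_⟩
    rintro s ⟨hsU, hsB, hst⟩
    refine hsB ?_
    have hst' : s < t := hst
    have h2 : ∀ᶠ p : ℕ × ℝ≥0 in atTop ×ˢ 𝓝 s, dist (f p.1 p.2) (h t) < ε / 2 := by
      obtain ⟨r, hsr, hrt⟩ := exists_between hst'
      filter_upwards [hP.prod_mk (hUo.mem_nhds hsU),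
        (hπ.eventually_lt_prev hrt).prod_mk (gt_mem_nhds hsr)] with p hp1 hp2
      exact hPQ hp1.1 (hU _ hp1.2) (hp2.2.trans hp2.1).le
    have h3 : dist (h s) (h t) ≤ ε / 2 := by
      have h4 := (hf s).comp (show Tendsto (fun n => (n, π.prev n s)) atTop _ from
        tendsto_inf.2 ⟨tendsto_id.prodMk (hπ.tendsto_prev s),
          tendsto_principal.2 (Eventually.of_forall fun n => le_refl (π.prev n s))⟩)
      have h5 := (tendsto_id.prodMk (hπ.tendsto_prev s)).eventually h2
      exact le_of_tendsto (h4.dist tendsto_const_nhds) (h5.mono fun n hn => hn.le)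
    filter_upwards [h2] with p hp
    rw [dist_comm] at h3
    linarith [dist_triangle (f p.1 p.2) (h t) (h s)]
  have hset : B k = {t ∈ B k | 𝓝[B k ∩ Iio t] t = ⊥} := by
    ext t; exact ⟨fun h => ⟨h, hisol t⟩, fun h => h.1⟩
  rw [hset]
  exact countable_setOfPred_isolated_left_within

theorem continuousWithinAt_min {u : ℝ≥0 → ℝ} (hu : ∀ s, ContinuousWithinAt u (Ici s) s)
    (t s : ℝ≥0) : ContinuousWithinAt (fun s => u (min s t)) (Ici s) s := by
  have h : Continuous fun r : ℝ≥0 => min r t := by fun_prop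
  exact ContinuousWithinAt.comp (g := u) (f := fun r => min r t) (hu (min s t))
    h.continuousWithinAt fun r hr => min_le_min_right t hr

theorem continuousWithinAt_partialSum_min (a : ℕ → ℝ≥0 → ℝ) (n : ℕ) (t s : ℝ≥0) :
    ContinuousWithinAt (fun s => partialSum π a n (min s t)) (Ici s) s := by
  refine continuousWithinAt_min (fun s => ?_) t s
  have h1 : ∀ᶠ r in 𝓝[≥] s, ∀ q ∈ π.pts n, q ≤ r → q ≤ s := by
    rw [Finset.eventually_all]
    intro q _
    rcases le_or_gt q s with h | h
    · exact Eventually.of_forall fun _ _ => h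
    · filter_upwards [mem_nhdsWithin_of_mem_nhds (gt_mem_nhds h)] with r hr hqr
      exact absurd hqr (not_le.2 hr)
  refine tendsto_const_nhds.congr' ?_
  filter_upwards [h1, self_mem_nhdsWithin] with r hr hsr
  unfold partialSum
  refine Finset.sum_congr (Finset.filter_congr fun q hq => ?_) fun _ _ => rfl
  exact ⟨fun h => h.trans hsr, fun h => hr q hq h⟩

theorem sum_eq_quantile {a : ℕ → ℝ≥0 → ℝ} (ha : ∀ n s, 0 ≤ a n s) (f : ℝ≥0 → ℝ) (n : ℕ)
    (t : ℝ≥0) :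
    AEStronglyMeasurable (fun y => f (quantile (fun s => partialSum π a n (min s t)) y))
        (volume.restrict (Ioc 0 (partialSum π a n t))) ∧
      ∑ s ∈ (π.pts n).filter (fun s => s ≤ t), f s * a n s =
        ∫ y, (Ioc 0 (partialSum π a n t)).indicator
          (fun y => f (quantile (fun s => partialSum π a n (min s t)) y)) y := by
  -- The discrete measure with atoms `a n s`; its distribution function is the partial sum stopped
  -- at `t`.
  set μ : Measure ℝ≥0 := ∑ s ∈ (π.pts n).filter (fun s => s ≤ t),
    ENNReal.ofReal (a n s) • Measure.dirac s with hμ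
  have hint : ∀ s, Integrable f (ENNReal.ofReal (a n s) • Measure.dirac s) := fun s =>
    Integrable.smul_measure (integrable_dirac (by simp)) ENNReal.ofReal_ne_top
  have hfin : IsFiniteMeasure μ := by
    refine ⟨?_⟩
    simp [hμ, Measure.finsetSum_apply]
  have hIic : ∀ s, μ (Iic s) = ENNReal.ofReal (partialSum π a n (min s t)) := by
    intro s
    rw [hμ, Measure.finsetSum_apply, partialSum, ENNReal.ofReal_sum_of_nonneg fun i _ => ha n i]
    simp only [Measure.smul_apply, Measure.dirac_apply' _ measurableSet_Iic, smul_eq_mul]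
    have : (π.pts n).filter (fun r => r ≤ min s t) =
        ((π.pts n).filter (fun r => r ≤ t)).filter (fun r => r ≤ s) := by
      ext r; simp only [Finset.mem_filter, le_min_iff]; tauto
    rw [this, Finset.sum_filter _ _ (s := (π.pts n).filter (fun r => r ≤ t))]
    refine Finset.sum_congr rfl fun r _ => ?_
    by_cases hr : r ≤ s <;> simp [indicator, hr]
  have hmono : Monotone fun s => partialSum π a n (min s t) := fun s r hsr =>
    partialSum_mono ha n (min_le_min_right t hsr)
  have hrc := continuousWithinAt_partialSum_min (π := π) a n t
  have h := integral_eq_quantile (M := partialSum π a n t) hmono hrc hIic ⟨t, by simp⟩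
    (fun s => partialSum_mono ha n (min_le_right _ _)) (f := f)
    (integrable_finsetSum_measure.2 fun s _ => hint s).aestronglyMeasurable
  refine ⟨h.1, ?_⟩
  rw [← h.2, hμ, integral_finsetSum_measure fun s _ => hint s]
  refine Finset.sum_congr rfl fun s _ => ?_
  rw [integral_smul_measure, integral_dirac, ENNReal.toReal_ofReal (ha n s), smul_eq_mul, mul_comm]

variable {a : ℕ → ℝ≥0 → ℝ} {u : ℝ≥0 → ℝ}

/-- Sums with weights `f_n(t_i) a_n(t_i)` converge to Stieltjes integrals. -/
theorem IsWeightLimit.tendsto_sum (hπ : π.VanishingMesh) (hu : IsWeightLimit π a u)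
    {f : ℕ → ℝ≥0 → ℝ} {h : ℝ≥0 → ℝ} (hh : Measurable h)
    (hf : ∀ t, Tendsto (fun p : ℕ × ℝ≥0 => f p.1 p.2)
      ((atTop ×ˢ 𝓝 t) ⊓ 𝓟 {p | p.2 ≤ π.prev p.1 t}) (𝓝 (h t)))
    {t : ℝ≥0} {K : ℝ} (hK : ∀ᶠ n in atTop, ∀ s ≤ t, |f n s| ≤ K) :
    Tendsto (fun n => ∑ s ∈ (π.pts n).filter (fun s => s ≤ t), f n s * a n s) atTop
      (𝓝 (∫ s in Ioc 0 t, h s ∂hu.stieltjes.measure)) := by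
  set v : ℝ≥0 → ℝ := fun s => u (min s t) with hv
  set w : ℕ → ℝ≥0 → ℝ := fun n s => partialSum π a n (min s t) with hw
  have hvmono : Monotone v := fun s r hsr => hu.mono (min_le_min_right t hsr)
  have hvrc := continuousWithinAt_min (fun s => (hu.cadlag s).1) t
  have hu0 : ∀ s, 0 ≤ u s := fun s => hu.zero ▸ hu.mono zero_le
  have hfin : IsFiniteMeasure (hu.stieltjes.measure.restrict (Ioc 0 t)) :=
    ⟨by rw [Measure.restrict_apply_univ, StieltjesFunction.measure_Ioc]; exact ENNReal.ofReal_lt_top⟩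
  have hIic : ∀ s, hu.stieltjes.measure.restrict (Ioc 0 t) (Iic s) = ENNReal.ofReal (v s) := by
    intro s
    rw [Measure.restrict_apply measurableSet_Iic, inter_comm, Ioc_inter_Iic,
      StieltjesFunction.measure_Ioc, min_comm]
    change ENNReal.ofReal (u (min s t) - u 0) = _
    rw [hu.zero, sub_zero]
  have hq := integral_eq_quantile (M := u t) hvmono hvrc hIic ⟨t, by simp [hv]⟩
    (fun s => hu.mono (min_le_right _ _)) (f := h) hh.aestronglyMeasurable
  have hsum := fun n => sum_eq_quantile (π := π) hu.nonneg (f n) n t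
  rw [hq.2]
  simp only [(hsum _).2]
  have hMn := hu.tendsto t
  set D : Set ℝ≥0 := {t | ¬ Tendsto (fun p : ℕ × ℝ≥0 => f p.1 p.2) (atTop ×ˢ 𝓝 t) (𝓝 (h t))}
  have hD : D.Countable := countable_not_tendsto hπ hf
  -- Exceptional levels, all countable: the endpoint of the limiting indicator, the flat levels of
  -- `v` where quantiles may fail to converge, and the levels of the bad times `D`.
  set N : Set ℝ := ({u t} ∪ {c | ∃ r s, r < s ∧ v r = c ∧ v s = c}) ∪ v '' D with hN
  have hNc : N.Countable :=
    ((countable_singleton _).union hvmono.countable_setOfPred_two_preimages).union (hD.image v)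
  refine tendsto_integral_filter_of_dominated_convergence
    ((Ioc 0 (u t + 1)).indicator fun _ => K) ?_ ?_ ?_ ?_
  · refine Eventually.of_forall fun n => ?_
    exact (aestronglyMeasurable_indicator_iff measurableSet_Ioc).2 (hsum n).1
  · filter_upwards [hK, hMn.eventually (gt_mem_nhds (lt_add_one (u t)))] with n hn1 hn2
    refine Eventually.of_forall fun y => ?_
    by_cases hy : y ∈ Ioc 0 (partialSum π a n t)
    · have hy' : y ∈ Ioc 0 (u t + 1) := ⟨hy.1, hy.2.trans hn2.le⟩
      rw [indicator_of_mem hy, indicator_of_mem hy', Real.norm_eq_abs]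
      refine hn1 _ (quantile_le ?_)
      simpa using hy.2
    · rw [indicator_of_notMem hy, norm_zero]
      refine indicator_nonneg (fun _ _ => ?_) _
      exact (abs_nonneg _).trans (hn1 0 zero_le)
  · exact (integrable_indicator_iff measurableSet_Ioc).2 (integrableOn_const (by simp))
  · have hae : ∀ᵐ y : ℝ, y ∉ N := by
      have := hNc.measure_zero (volume : Measure ℝ)
      exact measure_eq_zero_iff_ae_notMem.1 this
    filter_upwards [hae] with y hy
    simp only [hN, mem_union, not_or] at hy
    obtain ⟨⟨hyM, hy2⟩, hyD⟩ := hy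
    replace hyM : y ≠ u t := hyM
    rcases le_or_gt y 0 with hy0 | hy0
    · have h1 : ∀ M : ℝ, y ∉ Ioc 0 M := fun M h => hy0.not_gt h.1
      simp only [indicator_of_notMem (h1 _)]
      exact tendsto_const_nhds
    rcases lt_or_gt_of_ne hyM with hyM' | hyM'
    swap
    · rw [indicator_of_notMem fun h : y ∈ Ioc 0 (u t) => hyM'.not_ge h.2]
      refine tendsto_const_nhds.congr' ?_
      filter_upwards [hMn.eventually (gt_mem_nhds hyM')] with n hn
      rw [indicator_of_notMem fun h : y ∈ Ioc 0 (partialSum π a n t) => hn.not_ge h.2]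
    have hmem : y ∈ Ioc 0 (u t) := ⟨hy0, hyM'.le⟩
    rw [indicator_of_mem hmem]
    have hlim : Tendsto (fun n => f n (quantile (w n) y)) atTop (𝓝 (h (quantile v y))) := by
      set s := quantile v y with hs
      have hex : ∃ r, y ≤ v r := ⟨t, by simpa [hv] using hyM'.le⟩
      have hys : y ≤ v s := le_of_quantile_le hvmono hvrc hex le_rfl
      have hst : s ≤ t := quantile_le (by simpa [hv] using hyM'.le)
      have hwlim : ∀ r, Tendsto (fun n => w n r) atTop (𝓝 (v r)) := fun r => hu.tendsto _
      have hexn : ∀ᶠ n in atTop, ∃ r, y ≤ w n r := by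
        filter_upwards [hMn.eventually (lt_mem_nhds hyM')] with n hn
        exact ⟨t, (by simpa [hw] using hn.le : y ≤ w n t)⟩
      have hqn : Tendsto (fun n => quantile (w n) y) atTop (𝓝 s) := by
        rw [tendsto_order]
        constructor
        · intro r hr
          have h1 : v r < y := by
            by_contra! h
            exact (quantile_le h).not_gt hr
          filter_upwards [(hwlim r).eventually (gt_mem_nhds h1), hexn] with n hn hex
          by_contra! h
          exact (le_of_quantile_le
            (fun p q hpq => partialSum_mono hu.nonneg n (min_le_min_right t hpq))
            (continuousWithinAt_partialSum_min a n t) hex h).not_gt hn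
        · intro r hr
          obtain ⟨q, hsq, hqr⟩ := exists_between hr
          have h1 : y < v q := by
            refine lt_of_le_of_ne (hys.trans (hvmono hsq.le)) fun h => hy2 ?_
            exact ⟨s, q, hsq, le_antisymm (h ▸ hvmono hsq.le) hys, h.symm⟩
          filter_upwards [(hwlim q).eventually (lt_mem_nhds h1)] with n hn
          exact (quantile_le hn.le).trans_lt hqr
      -- At a bad time `y ≠ v s`, so `y < v s`. As the partial sums at `s'_n` tend to `v s`, the
      -- quantiles are eventually at most `s'_n`, where the one-sided limit of `f` is available.
      by_cases hsD : s ∈ D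
      · have h1 : y < v s := lt_of_le_of_ne hys fun h => hyD ⟨s, hsD, h.symm⟩
        have h2 : Tendsto (fun n => w n (π.prev n s)) atTop (𝓝 (v s)) := by
          have h3 := hu.tendsto_prev hπ s
          simp only [hv, hw, min_eq_left hst]
          refine h3.congr fun n => ?_
          rw [min_eq_left (PartitionSeq.prev_le.trans hst)]
        refine (hf s).comp (tendsto_inf.2 ⟨tendsto_id.prodMk hqn, tendsto_principal.2 ?_⟩)
        filter_upwards [h2.eventually (lt_mem_nhds h1)] with n hn
        exact quantile_le hn.le
      · have h1 : Tendsto (fun p : ℕ × ℝ≥0 => f p.1 p.2) (atTop ×ˢ 𝓝 s) (𝓝 (h s)) := by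
          by_contra h
          exact hsD h
        exact h1.comp (tendsto_id.prodMk hqn)
    refine hlim.congr' ?_
    filter_upwards [hMn.eventually (lt_mem_nhds hyM')] with n hn
    have hmemn : y ∈ Ioc 0 (partialSum π a n t) := ⟨hy0, hn.le⟩
    rw [indicator_of_mem hmemn]

end WeightedSums

/-! ### Stieltjes integrals against differences of nondecreasing functions -/

section Stieltjes

theorem eVariationOn_sub_le {α E : Type*} [LinearOrder α] [SeminormedAddCommGroup E]
    (f g : α → E) (s : Set α) :
    eVariationOn (fun x => f x - g x) s ≤ eVariationOn f s + eVariationOn g s := by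
  refine iSup_le fun p => ?_
  refine le_trans ?_ (add_le_add (eVariationOn.sum_le (f := f) (n := p.1) p.2.2.1 p.2.2.2)
    (eVariationOn.sum_le (f := g) (n := p.1) p.2.2.1 p.2.2.2))
  rw [← Finset.sum_add_distrib]
  refine Finset.sum_le_sum fun i _ => ?_
  simp only [sub_eq_add_neg]
  refine (edist_add_add_le _ _ _ _).trans_eq ?_
  rw [edist_neg_neg]

theorem stieltjesIntegral_zero (f g : ℝ≥0 → ℝ) : stieltjesIntegral f g 0 = 0 := by
  unfold stieltjesIntegral
  split_ifs with h
  · simp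
  · rfl

variable (U V : StieltjesFunction ℝ≥0) {g f : ℝ≥0 → ℝ} {t : ℝ≥0} {K : ℝ}

theorem isFiniteMeasure_restrict_Ioc (a b : ℝ≥0) :
    IsFiniteMeasure (U.measure.restrict (Ioc a b)) :=
  ⟨by rw [Measure.restrict_apply_univ, StieltjesFunction.measure_Ioc]
      exact ENNReal.ofReal_lt_top⟩

theorem boundedVariationOn_sub (hg : ∀ s, g s = U s - V s) (t : ℝ≥0) :
    BoundedVariationOn (fun s => g (min s t)) univ := by
  have h : ∀ W : StieltjesFunction ℝ≥0, BoundedVariationOn (fun s => W (min s t)) univ := by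
    intro W
    have hm : MonotoneOn (fun s => W (min s t)) univ := fun s _ r _ hsr =>
      W.mono (min_le_min_right t hsr)
    refine hm.boundedVariationOn (C := max |W 0| |W t|) fun s _ => ?_
    exact abs_le_max_abs_abs (W.mono zero_le) (W.mono (min_le_right _ _))
  simp only [hg]
  exact ne_top_of_le_ne_top (ENNReal.add_ne_top.2 ⟨h U, h V⟩) (eVariationOn_sub_le _ _ _)

/-- The measure of a bounded variation function is expressed through right limits; right-continuity
turns these into values. -/
theorem rightLim_sub_min (hg : ∀ s, g s = U s - V s) (t s : ℝ≥0) :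
    Function.rightLim (fun s => g (min s t)) s = g (min s t) := by
  have h2 := continuousWithinAt_min (u := fun r => U r) U.right_continuous t s
  have h3 := continuousWithinAt_min (u := fun r => V r) V.right_continuous t s
  have h1 : Tendsto (fun s => g (min s t)) (𝓝[≥] s) (𝓝 (g (min s t))) := by
    simp only [hg]
    exact Tendsto.sub h2 h3
  exact rightLim_eq_of_tendsto (h1.mono_left (nhdsWithin_mono _ Ioi_subset_Ici_self))

/-- Both sides agree on half-open intervals, which form a π-system generating the Borel sets, and on
the whole space. -/
theorem vectorMeasure_restrict_eq (hg : ∀ s, g s = U s - V s)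
    (h : BoundedVariationOn (fun s => g (min s t)) univ)
    [IsFiniteMeasure (U.measure.restrict (Ioc 0 t))]
    [IsFiniteMeasure (V.measure.restrict (Ioc 0 t))] :
    h.vectorMeasure.restrict (Ioc 0 t) = (U.measure.restrict (Ioc 0 t)).toSignedMeasure -
      (V.measure.restrict (Ioc 0 t)).toSignedMeasure := by
  have hright := rightLim_sub_min U V hg t
  have hIoc : ∀ a b : ℝ≥0, h.vectorMeasure (Ioc a b ∩ Ioc 0 t) =
      U.measure.real (Ioc a b ∩ Ioc 0 t) - V.measure.real (Ioc a b ∩ Ioc 0 t) := by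
    intro a b
    rw [Ioc_inter_Ioc, max_eq_left zero_le]
    rcases le_or_gt a (min b t) with hab | hab
    · have hW : ∀ W : StieltjesFunction ℝ≥0, W.measure.real (Ioc a (min b t)) =
          W (min b t) - W a := fun W => by
        rw [Measure.real, StieltjesFunction.measure_Ioc,
          ENNReal.toReal_ofReal (sub_nonneg.2 (W.mono hab))]
      rw [h.vectorMeasure_Ioc hab, hright, hright, hW, hW, hg, hg, min_assoc, min_self,
        min_eq_left (hab.trans (min_le_right _ _))]
      ring
    · simp [Ioc_eq_empty_of_le hab.le]
  refine VectorMeasure.ext_of_generateFrom {s | ∃ u v, u ≤ v ∧ s = Ioc u v} ?_ ?_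
    ?_ ?_
  · rintro s ⟨a, b, -, rfl⟩
    rw [VectorMeasure.restrict_apply _ measurableSet_Ioc measurableSet_Ioc, hIoc,
      _root_.sub_apply, Measure.toSignedMeasure_apply_measurable measurableSet_Ioc,
      Measure.toSignedMeasure_apply_measurable measurableSet_Ioc,
      measureReal_restrict_apply measurableSet_Ioc, measureReal_restrict_apply measurableSet_Ioc]
  · rw [BorelSpace.measurable_eq (α := ℝ≥0)]
    convert! borel_eq_generateFrom_Ioc_le ℝ≥0 using 2
    grind only
  · rintro s ⟨a, b, -, rfl⟩ r ⟨c, d, -, rfl⟩ hne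
    rw [Ioc_inter_Ioc] at hne ⊢
    exact ⟨_, _, (nonempty_Ioc.1 hne).le, rfl⟩
  · have h1 := hIoc 0 t
    rw [inter_self] at h1
    rw [VectorMeasure.restrict_apply _ measurableSet_Ioc MeasurableSet.univ, univ_inter, h1,
      _root_.sub_apply, Measure.toSignedMeasure_apply_measurable MeasurableSet.univ,
      Measure.toSignedMeasure_apply_measurable MeasurableSet.univ,
      measureReal_restrict_apply MeasurableSet.univ, measureReal_restrict_apply MeasurableSet.univ,
      univ_inter]

theorem stieltjesIntegral_sub (hg : ∀ s, g s = U s - V s) (hf : Measurable f)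
    (hK : ∀ s ∈ Ioc 0 t, |f s| ≤ K) :
    StieltjesIntegrable f g t ∧ stieltjesIntegral f g t =
      ∫ s in Ioc 0 t, f s ∂U.measure - ∫ s in Ioc 0 t, f s ∂V.measure := by
  have hU := isFiniteMeasure_restrict_Ioc U 0 t
  have hV := isFiniteMeasure_restrict_Ioc V 0 t
  have h := boundedVariationOn_sub U V hg t
  have heq := vectorMeasure_restrict_eq U V hg h
  have hint : ∀ W : StieltjesFunction ℝ≥0, ∀ _ : IsFiniteMeasure (W.measure.restrict (Ioc 0 t)),
      (W.measure.restrict (Ioc 0 t)).toSignedMeasure.Integrable f := by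
    intro W _
    rw [VectorMeasure.Integrable, Measure.variation_toSignedMeasure]
    refine Integrable.of_bound hf.aestronglyMeasurable K ?_
    filter_upwards [ae_restrict_mem measurableSet_Ioc] with s hs using hK s hs
  have hflip : (ContinuousLinearMap.lsmul ℝ ℝ : ℝ →L[ℝ] ℝ →L[ℝ] ℝ) =
      (ContinuousLinearMap.lsmul ℝ ℝ).flip := by
    ext; simp
  refine ⟨⟨h, ?_⟩, ?_⟩
  · rw [VectorMeasure.IntegrableOn, heq]
    exact (hint U hU).sub_vectorMeasure (hint V hV)
  · unfold stieltjesIntegral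
    rw [dif_pos h, heq, VectorMeasure.integral_sub_vectorMeasure (hint U hU) (hint V hV), hflip,
      VectorMeasure.integral_toSignedMeasure, VectorMeasure.integral_toSignedMeasure]

/-- Left-continuous functions are Borel measurable. -/
theorem measurable_of_tendsto_left {h : ℝ≥0 → ℝ}
    (hl : ∀ t, Tendsto h (𝓝[≤] t) (𝓝 (h t))) : Measurable h := by
  -- The largest multiple of `1 / (n + 1)` strictly below `s`; truncated subtraction gives `0` at `s
  -- = 0`. Thus `h ∘ r n` factors through `ℕ` and approximates `h` from the left.
  set r : ℕ → ℝ≥0 → ℝ≥0 := fun n s => ((⌈((n : ℝ≥0) + 1) * s⌉₊ - 1 : ℕ) : ℝ≥0) / ((n : ℝ≥0) + 1)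
  have hle : ∀ (n : ℕ) (s : ℝ≥0), r n s ≤ s := by
    intro n s
    refine div_le_of_le_mul₀ zero_le zero_le ?_
    rw [mul_comm s]
    rcases eq_or_ne s 0 with rfl | hs
    · simp
    · have h1 := Nat.ceil_lt_add_one (a := ((n : ℝ≥0) + 1) * s) zero_le
      have h2 : (⌈((n : ℝ≥0) + 1) * s⌉₊ - 1) + 1 = ⌈((n : ℝ≥0) + 1) * s⌉₊ :=
        Nat.sub_add_cancel (Nat.ceil_pos.2 (by positivity))
      rw [← h2, Nat.cast_add, Nat.cast_one] at h1
      exact (lt_of_add_lt_add_right h1).le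
  have hge : ∀ (n : ℕ) (s : ℝ≥0), s - 1 / ((n : ℝ≥0) + 1) ≤ r n s := by
    intro n s
    rw [tsub_le_iff_right, ← add_div, le_div_iff₀ (by positivity), mul_comm]
    refine (Nat.le_ceil _).trans ?_
    have : ⌈((n : ℝ≥0) + 1) * s⌉₊ ≤ (⌈((n : ℝ≥0) + 1) * s⌉₊ - 1) + 1 := by omega
    exact_mod_cast this
  have hlim : ∀ s, Tendsto (fun n => r n s) atTop (𝓝[≤] s) := by
    intro s
    refine tendsto_nhdsWithin_iff.2 ⟨?_, Eventually.of_forall fun n => hle n s⟩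
    refine tendsto_of_tendsto_of_tendsto_of_le_of_le ?_ tendsto_const_nhds
      (fun n => hge n s) fun n => hle n s
    have h := (tendsto_const_nhds (x := s)).sub (tendsto_one_div_add_atTop_nhds_zero_nat (𝕜 := ℝ≥0))
    rwa [tsub_zero] at h
  refine measurable_of_tendsto_metrizable (f := fun n s => h (r n s)) (fun n => ?_)
    (tendsto_pi_nhds.2 fun s => (hl s).comp (hlim s))
  have h1 : Measurable fun s : ℝ≥0 => ⌈((n : ℝ≥0) + 1) * s⌉₊ :=
    Nat.measurable_ceil.comp (measurable_const_mul _)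
  exact (measurable_from_nat
    (f := fun k => h (((k - 1 : ℕ) : ℝ≥0) / ((n : ℝ≥0) + 1)))).comp h1

end Stieltjes

/-! ### Quadratic sums -/

section QuadraticSums

variable {m : ℕ} {π : PartitionSeq} {Ω : Set (Traj m)}
  {φ ψ : Functional m (EuclideanSpace ℝ (Fin m))} {x : Traj m}

/-- Left-continuous, locally bounded integrands. -/
structure IsIntegrand (π : PartitionSeq) (Ω : Set (Traj m))
    (φ : Functional m (EuclideanSpace ℝ (Fin m))) : Prop where
  leftCont : LeftCont π Ω φ
  bounded : ∀ x ∈ Ω, ∀ T : ℝ≥0, ∃ K : ℝ, ∀ᶠ n in atTop, ∀ t ≤ T,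
    ‖φ t (stopLeft (approx π n x) t)‖ ≤ K

theorem IsPrimitive.isIntegrand {F : Functional m ℝ} (h : IsPrimitive π Ω F φ) :
    IsIntegrand π Ω φ := ⟨h.leftCont, h.bounded⟩

theorem IsIntegrand.tendsto_prod (hπ : π.VanishingMesh) (hφ : IsIntegrand π Ω φ) (hx : x ∈ Ω)
    (t : ℝ≥0) : Tendsto (fun p : ℕ × ℝ≥0 => φ p.2 (stopLeft (approx π p.1 x) p.2))
      ((atTop ×ˢ 𝓝 t) ⊓ 𝓟 {p | p.2 ≤ π.prev p.1 t}) (𝓝 (φ t (stopLeft x t))) :=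
  tendsto_prod_of_seq (f := fun n s => φ s (stopLeft (approx π n x) s))
    (S := fun n => Iic (π.prev n t)) _ (hπ.tendsto_prev t) (fun _ => self_mem_Iic)
    fun τ hτ h => hφ.leftCont.c x hx t τ hτ h

theorem IsIntegrand.tendsto_prev (hπ : π.VanishingMesh) (hφ : IsIntegrand π Ω φ) (hx : x ∈ Ω)
    (t : ℝ≥0) : Tendsto (fun n => φ (π.prev n t) (stopLeft (approx π n x) (π.prev n t))) atTop
      (𝓝 (φ t (stopLeft x t))) :=
  hφ.leftCont.c x hx t _ (hπ.tendsto_prev t) fun _ => le_rfl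

theorem IsIntegrand.norm_le (hπ : π.VanishingMesh) (hφ : IsIntegrand π Ω φ) (hx : x ∈ Ω)
    {T : ℝ≥0} {K : ℝ} (hK : ∀ᶠ n in atTop, ∀ t ≤ T, ‖φ t (stopLeft (approx π n x) t)‖ ≤ K)
    {t : ℝ≥0} (ht : t ≤ T) : ‖φ t (stopLeft x t)‖ ≤ K :=
  le_of_tendsto (hφ.tendsto_prev hπ hx t).norm
    (hK.mono fun _ hn => hn _ (PartitionSeq.prev_le.trans ht))

/-- The summands of the quadratic sums. -/
noncomputable def crossIncrement (π : PartitionSeq)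
    (φ ψ : Functional m (EuclideanSpace ℝ (Fin m))) (x : Traj m) (n : ℕ) (s : ℝ≥0) : ℝ :=
  inner ℝ (φ s (stopLeft (approx π n x) s)) (x (π.next n s) - x s) *
    inner ℝ (ψ s (stopLeft (approx π n x) s)) (x (π.next n s) - x s)

/-- `∑_{i,j} ∫_{(0,t]} φ_i(s, x_{s-}) ψ_j(s, x_{s-}) d[x_i, x_j](s)`. -/
noncomputable def crossIntegral (π : PartitionSeq)
    (φ ψ : Functional m (EuclideanSpace ℝ (Fin m))) : Functional m ℝ := fun t x =>
  ∑ i : Fin m, ∑ j : Fin m, stieltjesIntegral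
    (fun s => φ s (stopLeft x s) i * ψ s (stopLeft x s) j) (fun s => quadVar π x s i j) t

/-! ### Polarization. -/

/-- `(e_i + r e_j) / 2`. -/
noncomputable def polarVec (r : ℝ) (i j : Fin m) : EuclideanSpace ℝ (Fin m) :=
  (1 / 2 : ℝ) • (EuclideanSpace.single i 1 + r • EuclideanSpace.single j 1)

theorem inner_polarVec (r : ℝ) (i j : Fin m) (v : EuclideanSpace ℝ (Fin m)) :
    inner ℝ (polarVec r i j) v = (v i + r * v j) / 2 := by
  simp only [polarVec, inner_smul_left, inner_add_left, EuclideanSpace.inner_single_left]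
  simp
  ring

/-- The value at `r = 1` minus that at `r = -1` is `(q i j + q j i) / 2`, so by symmetry each entry
of `[x]` is a difference of two nondecreasing functions. -/
theorem quadForm_polarVec (r : ℝ) (i j : Fin m) (q : Matrix (Fin m) (Fin m) ℝ) :
    quadForm (polarVec r i j) q = (q i i + r * q i j + r * q j i + r ^ 2 * q j j) / 4 := by
  have h : ∀ k, polarVec r i j k = (1 / 2) * ((if k = i then 1 else 0) +
      r * (if k = j then 1 else 0)) := fun k => by
    simp only [polarVec, PiLp.smul_apply, PiLp.add_apply, PiLp.single_apply, smul_eq_mul]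
  have h2 : ∀ w : Fin m → ℝ, ∑ k, polarVec r i j k * w k = (w i + r * w j) / 2 := by
    intro w
    simp only [h, add_mul, mul_add, Finset.sum_add_distrib, ite_mul, mul_ite, mul_one, mul_zero,
      zero_mul, Finset.sum_ite_eq', Finset.mem_univ, if_true]
    simp
    ring
  unfold quadForm
  have h3 : ∀ k, ∑ l, polarVec r i j k * polarVec r i j l * q k l =
      polarVec r i j k * ((q k i + r * q k j) / 2) := by
    intro k
    rw [← h2 fun l => q k l, Finset.mul_sum]
    simp only [mul_assoc]
  simp only [h3, h2]
  ring

theorem HasQuadVar.symm {q : ℝ≥0 → Matrix (Fin m) (Fin m) ℝ} (hq : HasQuadVar π x q) (t : ℝ≥0)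
    (i j : Fin m) : q t i j = q t j i := by
  obtain ⟨-, l, -, hu⟩ := hq
  have h : Tendsto (fun n => qvSum π x n (l n t)) atTop (𝓝 (q t)) := (hu t).tendsto_at self_mem_Iic
  have h1 := ((uniformContinuous_matrix_apply i j).continuous.tendsto (q t)).comp h
  have h2 := ((uniformContinuous_matrix_apply j i).continuous.tendsto (q t)).comp h
  refine tendsto_nhds_unique h1 (h2.congr fun n => ?_)
  simp only [Function.comp, qvSum, Matrix.sum_apply, Matrix.vecMulVec_apply]
  exact Finset.sum_congr rfl fun s _ => mul_comm _ _

/-- Polarization splits both the sum and the integrator into two parts with nonnegative weights, to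
which `IsWeightLimit.tendsto_sum` applies. -/
theorem tendsto_entry (hπ : π.VanishingMesh) (hΩ : IsGeneric π Ω) (hQ : Ω ⊆ finiteQV m π)
    (hφ : IsIntegrand π Ω φ) (hψ : IsIntegrand π Ω ψ) (hx : x ∈ Ω) (t : ℝ≥0) (i j : Fin m) :
    StieltjesIntegrable (fun s => φ s (stopLeft x s) i * ψ s (stopLeft x s) j)
        (fun s => quadVar π x s i j) t ∧
      Tendsto (fun n => ∑ s ∈ (π.pts n).filter (fun s => s ≤ t),
        (φ s (stopLeft (approx π n x) s) i * ψ s (stopLeft (approx π n x) s) j) *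
          ((x (π.next n s) - x s) i * (x (π.next n s) - x s) j)) atTop
        (𝓝 (stieltjesIntegral (fun s => φ s (stopLeft x s) i * ψ s (stopLeft x s) j)
          (fun s => quadVar π x s i j) t)) := by
  have hq := hasQuadVar_quadVar (hQ hx)
  have hU := hq.isWeightLimit hπ (hΩ.cadlag x hx) (polarVec 1 i j)
  have hV := hq.isWeightLimit hπ (hΩ.cadlag x hx) (polarVec (-1) i j)
  obtain ⟨K, hK⟩ := hφ.bounded x hx t
  obtain ⟨K', hK'⟩ := hψ.bounded x hx t
  have hbound : ∀ v w : EuclideanSpace ℝ (Fin m), ‖v‖ ≤ K → ‖w‖ ≤ K' → |v i * w j| ≤ K * K' := by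
    intro v w hv hw
    rw [abs_mul]
    have h1 : |v i| ≤ K := (PiLp.norm_apply_le v i).trans hv
    have h2 : |w j| ≤ K' := (PiLp.norm_apply_le w j).trans hw
    exact mul_le_mul h1 h2 (abs_nonneg _) ((abs_nonneg _).trans h1)
  have hcoord : ∀ k : Fin m, Continuous fun v : EuclideanSpace ℝ (Fin m) => v k := fun k => by
    fun_prop
  have hmeas : Measurable fun s => φ s (stopLeft x s) i * ψ s (stopLeft x s) j :=
    measurable_of_tendsto_left fun s =>
      (((hcoord i).tendsto _).comp (hφ.leftCont.a x hx s)).mul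
        (((hcoord j).tendsto _).comp (hψ.leftCont.a x hx s))
  have hlim : ∀ t, Tendsto (fun p : ℕ × ℝ≥0 => φ p.2 (stopLeft (approx π p.1 x) p.2) i *
      ψ p.2 (stopLeft (approx π p.1 x) p.2) j)
      ((atTop ×ˢ 𝓝 t) ⊓ 𝓟 {p | p.2 ≤ π.prev p.1 t})
      (𝓝 (φ t (stopLeft x t) i * ψ t (stopLeft x t) j)) := fun t =>
    (((hcoord i).tendsto _).comp (hφ.tendsto_prod hπ hx t)).mul
      (((hcoord j).tendsto _).comp (hψ.tendsto_prod hπ hx t))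
  have hbd : ∀ᶠ n in atTop, ∀ s ≤ t, |φ s (stopLeft (approx π n x) s) i *
      ψ s (stopLeft (approx π n x) s) j| ≤ K * K' := by
    filter_upwards [hK, hK'] with n h1 h2 s hs using hbound _ _ (h1 s hs) (h2 s hs)
  have h1 := hU.tendsto_sum hπ
    (f := fun n s => φ s (stopLeft (approx π n x) s) i * ψ s (stopLeft (approx π n x) s) j)
    hmeas hlim hbd
  have h2 := hV.tendsto_sum hπ
    (f := fun n s => φ s (stopLeft (approx π n x) s) i * ψ s (stopLeft (approx π n x) s) j)
    hmeas hlim hbd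
  have hsub : ∀ s, quadVar π x s i j = hU.stieltjes s - hV.stieltjes s := by
    intro s
    change _ = quadForm (polarVec 1 i j) (quadVar π x s) - quadForm (polarVec (-1) i j) _
    rw [quadForm_polarVec, quadForm_polarVec, hq.symm s j i]
    ring
  obtain ⟨h3, h4⟩ := stieltjesIntegral_sub (t := t) hU.stieltjes hV.stieltjes hsub hmeas
    fun s hs => hbound _ _ (hφ.norm_le hπ hx hK hs.2) (hψ.norm_le hπ hx hK' hs.2)
  refine ⟨h3, ?_⟩
  rw [h4]
  refine (h1.sub h2).congr fun n => ?_
  rw [← Finset.sum_sub_distrib]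
  refine Finset.sum_congr rfl fun s _ => ?_
  simp only [sqIncrement, inner_polarVec]
  ring

theorem crossIncrement_eq (n : ℕ) (s : ℝ≥0) : crossIncrement π φ ψ x n s =
    ∑ i : Fin m, ∑ j : Fin m,
      (φ s (stopLeft (approx π n x) s) i * ψ s (stopLeft (approx π n x) s) j) *
        ((x (π.next n s) - x s) i * (x (π.next n s) - x s) j) := by
  rw [crossIncrement, PiLp.inner_apply, PiLp.inner_apply, Finset.sum_mul_sum]
  refine Finset.sum_congr rfl fun i _ => Finset.sum_congr rfl fun j _ => ?_
  simp only [RCLike.inner_apply, conj_trivial]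
  ring

theorem tendsto_crossSum (hπ : π.VanishingMesh) (hΩ : IsGeneric π Ω) (hQ : Ω ⊆ finiteQV m π)
    (hφ : IsIntegrand π Ω φ) (hψ : IsIntegrand π Ω ψ) (hx : x ∈ Ω) (t : ℝ≥0) :
    Tendsto (fun n => partialSum π (crossIncrement π φ ψ x) n t) atTop
      (𝓝 (crossIntegral π φ ψ t x)) := by
  have h := tendsto_finsetSum Finset.univ fun i _ => tendsto_finsetSum Finset.univ fun j _ =>
    (tendsto_entry hπ hΩ hQ hφ hψ hx t i j).2
  refine h.congr fun n => ?_
  simp only [partialSum, crossIncrement_eq]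
  conv_rhs => rw [Finset.sum_comm]
  refine Finset.sum_congr rfl fun i _ => ?_
  rw [Finset.sum_comm]

end QuadraticSums

/-! ### Limits of quadratic sums -/

section CrossLimits

theorem abs_partialSum_sub_le {π : PartitionSeq} {r b : ℕ → ℝ≥0 → ℝ} {n : ℕ} {C : ℝ} {T : ℝ≥0}
    (hC : 0 ≤ C) (h : ∀ s ≤ T, |r n s| ≤ C * b n s) {σ τ : ℝ≥0} (hσ : σ ≤ T) (hτ : τ ≤ T) :
    |partialSum π r n τ - partialSum π r n σ| ≤
      C * |partialSum π b n τ - partialSum π b n σ| := by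
  wlog hle : σ ≤ τ generalizing σ τ
  · rw [abs_sub_comm, abs_sub_comm (partialSum π b n τ)]
    exact this hτ hσ (le_of_not_ge hle)
  have hsub : (π.pts n).filter (fun s => s ≤ σ) ⊆ (π.pts n).filter (fun s => s ≤ τ) :=
    Finset.monotone_filter_right _ fun s _ hs => hs.trans hle
  have hdiff : ∀ a : ℕ → ℝ≥0 → ℝ, partialSum π a n τ - partialSum π a n σ =
      ∑ s ∈ (π.pts n).filter (fun s => s ≤ τ) \ (π.pts n).filter (fun s => s ≤ σ), a n s :=
    fun a => by rw [partialSum, partialSum, ← Finset.sum_sdiff hsub, add_sub_cancel_right]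
  rw [hdiff, hdiff]
  calc _ ≤ _ := Finset.abs_sum_le_sum_abs _ _
    _ ≤ ∑ s ∈ (π.pts n).filter (fun s => s ≤ τ) \ (π.pts n).filter (fun s => s ≤ σ),
        C * b n s := Finset.sum_le_sum fun s hs =>
          h s ((Finset.mem_filter.1 (Finset.mem_sdiff.1 hs).1).2.trans hτ)
    _ ≤ _ := by
      rw [← Finset.mul_sum]
      exact mul_le_mul_of_nonneg_left (le_abs_self _) hC

variable {m : ℕ} {π : PartitionSeq} {Ω : Set (Traj m)}
  {φ ψ : Functional m (EuclideanSpace ℝ (Fin m))} {x y : Traj m}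

/-- `|x(t_{i+1}) - x(t_i)|²`. -/
noncomputable def sqNormIncrement (π : PartitionSeq) (x : Traj m) (n : ℕ) (s : ℝ≥0) : ℝ :=
  ‖x (π.next n s) - x s‖ ^ 2

theorem partialSum_sqNormIncrement (n : ℕ) (t : ℝ≥0) :
    partialSum π (sqNormIncrement π x) n t =
      ∑ i : Fin m, partialSum π (sqIncrement π x (EuclideanSpace.single i 1)) n t := by
  unfold partialSum
  rw [Finset.sum_comm]
  refine Finset.sum_congr rfl fun s _ => ?_
  rw [sqNormIncrement, EuclideanSpace.real_norm_sq_eq]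
  refine Finset.sum_congr rfl fun i _ => ?_
  rw [sqIncrement, EuclideanSpace.inner_single_left]
  simp

theorem exists_tendsto_sqNorm (hπ : π.VanishingMesh) (hΩ : IsGeneric π Ω)
    (hQ : Ω ⊆ finiteQV m π) (hx : x ∈ Ω) (t : ℝ≥0) :
    (∃ L, Tendsto (fun p : ℕ × ℝ≥0 => partialSum π (sqNormIncrement π x) p.1 p.2)
      (rightFilter π t) (𝓝 L)) ∧
    ∃ L, Tendsto (fun p : ℕ × ℝ≥0 => partialSum π (sqNormIncrement π x) p.1 p.2)
      (leftFilter π t) (𝓝 L) := by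
  have h := fun c => (hasQuadVar_quadVar (hQ hx)).isWeightLimit hπ (hΩ.cadlag x hx) c
  simp only [partialSum_sqNormIncrement]
  exact ⟨⟨_, tendsto_finsetSum _ fun i _ => (h _).right t⟩,
    ⟨_, tendsto_finsetSum _ fun i _ => (h _).left t⟩⟩

/-- The jump `φ(t, x_{t-}) · Δx(t)  ψ(t, x_{t-}) · Δx(t)` of the cross integral. -/
noncomputable def crossJump (φ ψ : Functional m (EuclideanSpace ℝ (Fin m))) : Functional m ℝ :=
  fun t x => inner ℝ (φ t (stopLeft x t)) (jump x t) * inner ℝ (ψ t (stopLeft x t)) (jump x t)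

theorem tendsto_crossIncrement_prev (hπ : π.VanishingMesh) (hΩ : IsGeneric π Ω)
    (hφ : IsIntegrand π Ω φ) (hψ : IsIntegrand π Ω ψ) (hx : x ∈ Ω) (t : ℝ≥0) :
    Tendsto (fun n => crossIncrement π φ ψ x n (π.prev n t)) atTop (𝓝 (crossJump φ ψ t x)) := by
  have h := (hΩ.cadlag x hx).tendsto_increment_prev hπ t
  exact ((hφ.tendsto_prev hπ hx t).inner h).mul ((hψ.tendsto_prev hπ hx t).inner h)

/-- The cross summands have no sign but are dominated by squared norms of increments. Wherever the
sums of these converge along `l`, the cross sums are Cauchy along `l`, so their limit may be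
computed along any one sequence `σ`. -/
theorem tendsto_crossSum_sub (hφ : IsIntegrand π Ω φ) (hψ : IsIntegrand π Ω ψ) (hx : x ∈ Ω)
    {t : ℝ≥0} {l : Filter (ℕ × ℝ≥0)} (hl : l ≤ atTop ×ˢ 𝓝 t)
    (hb : ∃ L, Tendsto (fun p : ℕ × ℝ≥0 => partialSum π (sqNormIncrement π x) p.1 p.2) l (𝓝 L))
    {σ : ℕ → ℝ≥0} (hσ : Tendsto (fun n => (n, σ n)) atTop l) :
    Tendsto (fun p : ℕ × ℝ≥0 => partialSum π (crossIncrement π φ ψ x) p.1 p.2 -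
      partialSum π (crossIncrement π φ ψ x) p.1 (σ p.1)) l (𝓝 0) := by
  obtain ⟨L, hL⟩ := hb
  obtain ⟨K, hK⟩ := hφ.bounded x hx (t + 1)
  obtain ⟨K', hK'⟩ := hψ.bounded x hx (t + 1)
  have hfst : Tendsto Prod.fst l atTop := tendsto_fst.mono_left hl
  have h1 : Tendsto (fun p : ℕ × ℝ≥0 => |K| * |K'| *
      |partialSum π (sqNormIncrement π x) p.1 p.2 -
        partialSum π (sqNormIncrement π x) p.1 (σ p.1)|) l (𝓝 0) := by
    have h := ((hL.sub ((hL.comp hσ).comp hfst)).abs).const_mul (|K| * |K'|)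
    rwa [sub_self, abs_zero, mul_zero] at h
  refine squeeze_zero_norm' ?_ h1
  have hnear : ∀ᶠ s in 𝓝 t, s ≤ t + 1 := ge_mem_nhds (by simp)
  have h2 : ∀ᶠ p in l, p.2 ≤ t + 1 := (tendsto_snd.mono_left hl).eventually hnear
  have h3 : ∀ᶠ n in atTop, σ n ≤ t + 1 :=
    (((tendsto_snd.mono_left hl).comp hσ).eventually hnear)
  filter_upwards [h2, hfst.eventually h3, hfst.eventually hK, hfst.eventually hK']
    with p hp1 hp2 hp3 hp4
  refine abs_partialSum_sub_le (by positivity) (T := t + 1) (fun s hs => ?_) hp2 hp1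
  have hin : ∀ (v w : EuclideanSpace ℝ (Fin m)) (k : ℝ), ‖v‖ ≤ k → |inner ℝ v w| ≤ |k| * ‖w‖ :=
    fun v w k h => (abs_real_inner_le_norm v w).trans
      (mul_le_mul_of_nonneg_right (h.trans (le_abs_self k)) (norm_nonneg _))
  rw [crossIncrement, abs_mul, sqNormIncrement]
  calc _ ≤ (|K| * ‖x (π.next p.1 s) - x s‖) * (|K'| * ‖x (π.next p.1 s) - x s‖) :=
        mul_le_mul (hin _ _ _ (hp3 s hs)) (hin _ _ _ (hp4 s hs)) (abs_nonneg _) (by positivity)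
    _ = _ := by ring

theorem tendsto_crossSum_right (hπ : π.VanishingMesh) (hΩ : IsGeneric π Ω)
    (hQ : Ω ⊆ finiteQV m π) (hφ : IsIntegrand π Ω φ) (hψ : IsIntegrand π Ω ψ) (hx : x ∈ Ω)
    (t : ℝ≥0) : Tendsto (fun p : ℕ × ℝ≥0 => partialSum π (crossIncrement π φ ψ x) p.1 p.2)
      (rightFilter π t) (𝓝 (crossIntegral π φ ψ t x)) := by
  have h1 := tendsto_crossSum_sub (l := rightFilter π t) hφ hψ hx inf_le_left
    (exists_tendsto_sqNorm hπ hΩ hQ hx t).1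
    (tendsto_rightFilter_const π t)
  have h2 := (tendsto_crossSum hπ hΩ hQ hφ hψ hx t).comp
    (tendsto_fst.mono_left (inf_le_left : rightFilter π t ≤ _))
  have h3 := h1.add h2
  simp only [Function.comp, sub_add_cancel, zero_add] at h3
  exact h3

/-- Just before `t'_n` the sum misses precisely the summand at `t'_n`. The interval starting there
straddles `t`, so the missing summand tends to `crossJump`. -/
theorem tendsto_crossSum_left (hπ : π.VanishingMesh) (hΩ : IsGeneric π Ω)
    (hQ : Ω ⊆ finiteQV m π) (hφ : IsIntegrand π Ω φ) (hψ : IsIntegrand π Ω ψ) (hx : x ∈ Ω)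
    {t : ℝ≥0} (ht : 0 < t) :
    Tendsto (fun p : ℕ × ℝ≥0 => partialSum π (crossIncrement π φ ψ x) p.1 p.2)
      (leftFilter π t) (𝓝 (crossIntegral π φ ψ t x - crossJump φ ψ t x)) := by
  -- Times before `t'_n` with no partition point in between, pushed towards `t'_n` so that they
  -- converge to `t`.
  set σ : ℕ → ℝ≥0 := fun n => max (π.prev n (π.prev n t)) (π.prev n t - 1 / ((n : ℝ≥0) + 1))
  have hlt : ∀ᶠ n in atTop, σ n < π.prev n t := by
    filter_upwards [hπ.eventually_lt_prev ht] with n hn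
    exact max_lt (PartitionSeq.prev_lt hn) (tsub_lt_self hn (by positivity))
  have hσt : Tendsto σ atTop (𝓝 t) := by
    have h := (hπ.tendsto_prev t).sub (tendsto_one_div_add_atTop_nhds_zero_nat (𝕜 := ℝ≥0))
    rw [tsub_zero] at h
    exact tendsto_of_tendsto_of_tendsto_of_le_of_le h (hπ.tendsto_prev t)
      (fun n => le_max_right _ _) fun n => max_le PartitionSeq.prev_le tsub_le_self
  have hσ := tendsto_leftFilter hσt hlt
  have h1 := tendsto_crossSum_sub (l := leftFilter π t) hφ hψ hx inf_le_left
    (exists_tendsto_sqNorm hπ hΩ hQ hx t).2 hσ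
  have h2 : Tendsto (fun n => partialSum π (crossIncrement π φ ψ x) n (σ n)) atTop
      (𝓝 (crossIntegral π φ ψ t x - crossJump φ ψ t x)) := by
    have h3 := (tendsto_crossSum_right hπ hΩ hQ hφ hψ hx t).comp
      (tendsto_rightFilter (hπ.tendsto_prev t) (Eventually.of_forall fun _ => le_rfl))
    refine (h3.sub (tendsto_crossIncrement_prev hπ hΩ hφ hψ hx t)).congr' ?_
    filter_upwards [hlt] with n hn
    have h4 := partialSum_sub_eq (a := crossIncrement π φ ψ x) hn fun q hq hqp =>
      (PartitionSeq.le_prev hq hqp).trans (le_max_left _ _)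
    rw [if_pos PartitionSeq.prev_mem] at h4
    simp only [Function.comp]
    linarith
  have h5 := h1.add (h2.comp (tendsto_fst.mono_left (inf_le_left : leftFilter π t ≤ _)))
  simpa using h5

theorem tendsto_crossIntegral_right (hπ : π.VanishingMesh) (hΩ : IsGeneric π Ω)
    (hQ : Ω ⊆ finiteQV m π) (hφ : IsIntegrand π Ω φ) (hψ : IsIntegrand π Ω ψ) (hx : x ∈ Ω)
    (t : ℝ≥0) : Tendsto (fun s => crossIntegral π φ ψ s x) (𝓝[≥] t)
      (𝓝 (crossIntegral π φ ψ t x)) :=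
  tendsto_nhdsWithin_of_prod (f := fun n s => partialSum π (crossIncrement π φ ψ x) n s)
    (tendsto_crossSum_right hπ hΩ hQ hφ hψ hx t)
    (fun s _ => tendsto_crossSum hπ hΩ hQ hφ hψ hx s)
    fun _ hs => Eventually.of_forall fun _ => PartitionSeq.prev_le.trans hs

theorem tendsto_crossIntegral_left (hπ : π.VanishingMesh) (hΩ : IsGeneric π Ω)
    (hQ : Ω ⊆ finiteQV m π) (hφ : IsIntegrand π Ω φ) (hψ : IsIntegrand π Ω ψ) (hx : x ∈ Ω)
    {t : ℝ≥0} (ht : 0 < t) : Tendsto (fun s => crossIntegral π φ ψ s x) (𝓝[<] t)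
      (𝓝 (crossIntegral π φ ψ t x - crossJump φ ψ t x)) :=
  tendsto_nhdsWithin_of_prod (f := fun n s => partialSum π (crossIncrement π φ ψ x) n s)
    (tendsto_crossSum_left hπ hΩ hQ hφ hψ hx ht)
    (fun s _ => tendsto_crossSum hπ hΩ hQ hφ hψ hx s)
    fun _ hs => hπ.eventually_lt_prev hs

theorem crossIntegral_zero : crossIntegral π φ ψ 0 x = 0 := by
  simp [crossIntegral, stieltjesIntegral_zero]

theorem crossJump_zero : crossJump φ ψ 0 x = 0 := by simp [crossJump, jump_zero]

/-- The cross integral at time `s` only depends on the path up to `t > s`. -/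
theorem crossIntegral_congr (hπ : π.VanishingMesh) (hΩ : IsGeneric π Ω)
    (hQ : Ω ⊆ finiteQV m π) (hφ : IsIntegrand π Ω φ) (hψ : IsIntegrand π Ω ψ) (hx : x ∈ Ω)
    (hy : y ∈ Ω) {s t : ℝ≥0} (hst : s < t) (h : ∀ r < t, x r = y r) :
    crossIntegral π φ ψ s x = crossIntegral π φ ψ s y := by
  refine tendsto_nhds_unique (tendsto_crossSum hπ hΩ hQ hφ hψ hx s)
    ((tendsto_crossSum hπ hΩ hQ hφ hψ hy s).congr' ?_)
  filter_upwards [hπ.eventually_next_lt hst] with n hn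
  refine Finset.sum_congr rfl fun p hp => ?_
  obtain ⟨hp, hps⟩ := Finset.mem_filter.1 hp
  have h1 := h _ (hn p hp hps)
  have h2 : stopLeft (approx π n x) p = stopLeft (approx π n y) p :=
    stopLeft_congr (fun r hr => h _
      ((PartitionSeq.next_le_of_lt hp hr).trans_lt (hps.trans_lt hst))) h1
  rw [crossIncrement, crossIncrement, h2, h1, h p (hps.trans_lt hst)]

/-- The sums at time `t` use increments reaching past `t`, so they cannot be compared directly. Both
sides are left limits at `t` of values that depend only on the path before `t`. -/
theorem crossIntegral_sub_crossJump_congr (hπ : π.VanishingMesh) (hΩ : IsGeneric π Ω)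
    (hQ : Ω ⊆ finiteQV m π) (hφ : IsIntegrand π Ω φ) (hψ : IsIntegrand π Ω ψ) (hx : x ∈ Ω)
    (hy : y ∈ Ω) {t : ℝ≥0} (h : ∀ r < t, x r = y r) :
    crossIntegral π φ ψ t x - crossJump φ ψ t x =
      crossIntegral π φ ψ t y - crossJump φ ψ t y := by
  rcases eq_or_ne t 0 with rfl | ht
  · simp only [crossIntegral_zero, crossJump_zero]
  replace ht := pos_iff_ne_zero.2 ht
  have hne : (𝓝[<] t).NeBot := nhdsLT_neBot_of_exists_lt ⟨0, ht⟩
  refine tendsto_nhds_unique (tendsto_crossIntegral_left hπ hΩ hQ hφ hψ hx ht)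
    ((tendsto_crossIntegral_left hπ hΩ hQ hφ hψ hy ht).congr' ?_)
  filter_upwards [self_mem_nhdsWithin] with s hs
  exact (crossIntegral_congr hπ hΩ hQ hφ hψ hx hy hs h).symm

theorem crossIntegral_stopAt (hπ : π.VanishingMesh) (hΩ : IsGeneric π Ω)
    (hQ : Ω ⊆ finiteQV m π) (hφ : IsIntegrand π Ω φ) (hψ : IsIntegrand π Ω ψ) (hx : x ∈ Ω)
    (t : ℝ≥0) : crossIntegral π φ ψ t (stopAt x t) = crossIntegral π φ ψ t x := by
  have h := crossIntegral_sub_crossJump_congr hπ hΩ hQ hφ hψ (hΩ.stopAt_mem hx t) hx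
    fun r hr => stopAt_apply_of_le hr.le
  have h1 : crossJump φ ψ t (stopAt x t) = crossJump φ ψ t x := by
    rw [crossJump, crossJump, stopLeft_stopAt_of_le le_rfl, jump_stopAt_of_le le_rfl]
  linarith

theorem crossIntegral_stopLeft (hπ : π.VanishingMesh) (hΩ : IsGeneric π Ω)
    (hQ : Ω ⊆ finiteQV m π) (hφ : IsIntegrand π Ω φ) (hψ : IsIntegrand π Ω ψ) (hx : x ∈ Ω)
    (t : ℝ≥0) : crossIntegral π φ ψ t (stopLeft x t) =
      crossIntegral π φ ψ t x - crossJump φ ψ t x := by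
  have h := crossIntegral_sub_crossJump_congr hπ hΩ hQ hφ hψ (hΩ.stopLeft_mem hx t) hx
    fun r hr => stopLeft_apply_of_lt hr
  have h1 : crossJump φ ψ t (stopLeft x t) = 0 := by simp [crossJump, jump_stopLeft]
  rwa [h1, sub_zero] at h

theorem crossIntegral_jump_eq (hπ : π.VanishingMesh) (hΩ : IsGeneric π Ω)
    (hQ : Ω ⊆ finiteQV m π) (hφ : IsIntegrand π Ω φ) (hψ : IsIntegrand π Ω ψ) (hx : x ∈ Ω)
    (t : ℝ≥0) : crossIntegral π φ ψ t (stopAt x t) =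
      crossIntegral π φ ψ t (stopLeft x t) + crossJump φ ψ t x := by
  rw [crossIntegral_stopAt hπ hΩ hQ hφ hψ hx, crossIntegral_stopLeft hπ hΩ hQ hφ hψ hx,
    sub_add_cancel]

/-- All increments of the frozen path over intervals starting at or after `t` vanish. -/
theorem horizConst_crossIntegral (hπ : π.VanishingMesh) (hΩ : IsGeneric π Ω)
    (hQ : Ω ⊆ finiteQV m π) (hφ : IsIntegrand π Ω φ) (hψ : IsIntegrand π Ω ψ) :
    HorizConst Ω (crossIntegral π φ ψ) := by
  intro x hx t s hts
  have hy := hΩ.stopAt_mem hx t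
  refine tendsto_nhds_unique (tendsto_crossSum hπ hΩ hQ hφ hψ hy s)
    ((tendsto_crossSum hπ hΩ hQ hφ hψ hy t).congr fun n => ?_)
  refine Finset.sum_subset (Finset.monotone_filter_right _ fun r _ hr => hr.trans hts)
    fun p hp hpt => ?_
  have hp' := (Finset.mem_filter.1 hp).1
  have htp : t ≤ p := by
    by_contra! hlt
    exact hpt (Finset.mem_filter.2 ⟨hp', hlt.le⟩)
  simp [crossIncrement, stopAt_apply_of_ge htp,
    stopAt_apply_of_ge (htp.trans (PartitionSeq.le_next hp'))]

/-- Along `x^n`, the cross integral is a quadratic sum. -/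
theorem crossIntegral_approx (hπ : π.VanishingMesh) (hΩ : IsGeneric π Ω)
    (hQ : Ω ⊆ finiteQV m π) (hφ : IsIntegrand π Ω φ) (hψ : IsIntegrand π Ω ψ) {n : ℕ}
    {t T : ℝ≥0} (hn : stopAt (approx π n x) T ∈ Ω) (ht : t ≤ T) :
    crossIntegral π φ ψ t (stopAt (approx π n x) t) =
      partialSum π (crossIncrement π φ ψ x) n t - crossIncrement π φ ψ x n 0 := by
  have h := (horizConst_crossIntegral hπ hΩ hQ hφ hψ).eq_sum
    (fun x hx t => crossIntegral_jump_eq hπ hΩ hQ hφ hψ hx t) hn ht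
  rw [h, crossIntegral_zero, zero_add, partialSum, filter_le_eq_insert_zero,
    Finset.sum_insert (by simp), add_sub_cancel_left]
  refine Finset.sum_congr rfl fun s hs => ?_
  obtain ⟨hs1, hs2, hs3⟩ := Finset.mem_filter.1 hs
  have hs4 : s ≤ T := hs3.trans ht
  rw [crossJump, stopLeft_stopAt_of_le hs4, jump_stopAt_approx hs1 hs2 hs4, crossIncrement]

/-- Along `x^n` the cross integral is the quadratic sum of `x` without its vanishing summand at `0`.
The joint limits of these sums on the two sides of `t'_n` are thus the clauses to be checked. -/
theorem piContinuous_crossIntegral (hπ : π.VanishingMesh) (hΩ : IsGeneric π Ω)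
    (hQ : Ω ⊆ finiteQV m π) (hφ : IsIntegrand π Ω φ) (hψ : IsIntegrand π Ω ψ) :
    PiContinuous π Ω (crossIntegral π φ ψ) := by
  have key : ∀ x ∈ Ω, ∀ (t : ℝ≥0) (l : Filter (ℕ × ℝ≥0)), l ≤ atTop ×ˢ 𝓝 t → ∀ L : ℝ,
      Tendsto (fun p : ℕ × ℝ≥0 => partialSum π (crossIncrement π φ ψ x) p.1 p.2) l (𝓝 L) →
      Tendsto (fun p : ℕ × ℝ≥0 => crossIntegral π φ ψ p.2 (stopAt (approx π p.1 x) p.2)) l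
        (𝓝 L) := by
    intro x hx t l hl L h
    have h0 := tendsto_crossIncrement_prev hπ hΩ hφ hψ hx 0
    simp only [PartitionSeq.prev_zero, crossJump_zero] at h0
    have hfst : Tendsto Prod.fst l atTop := tendsto_fst.mono_left hl
    have h1 := h.sub (h0.comp hfst)
    rw [sub_zero] at h1
    refine h1.congr' ?_
    have hnear : ∀ᶠ s in 𝓝 t, s ≤ t + 1 := ge_mem_nhds (by simp)
    filter_upwards [hfst.eventually (hΩ.eventually_approx hx t),
      (tendsto_snd.mono_left hl).eventually hnear] with p hp1 hp2
    exact (crossIntegral_approx hπ hΩ hQ hφ hψ hp1 hp2).symm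
  refine piContinuous_of_tendsto hΩ (fun x hx t => ?_) (fun x hx t => ?_)
    (fun x hx t ht => key x hx t _ inf_le_left _ ?_) fun x hx t => key x hx t _ inf_le_left _ ?_
  · simp only [crossIntegral_stopAt hπ hΩ hQ hφ hψ hx, crossIntegral_stopLeft hπ hΩ hQ hφ hψ hx]
    rcases eq_or_ne t 0 with rfl | ht
    · simp
    · exact tendsto_crossIntegral_left hπ hΩ hQ hφ hψ hx (pos_iff_ne_zero.2 ht)
  · simp only [crossIntegral_stopAt hπ hΩ hQ hφ hψ hx]
    exact tendsto_crossIntegral_right hπ hΩ hQ hφ hψ hx t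
  · rw [crossIntegral_stopLeft hπ hΩ hQ hφ hψ hx]
    exact tendsto_crossSum_left hπ hΩ hQ hφ hψ hx ht
  · rw [crossIntegral_stopAt hπ hΩ hQ hφ hψ hx]
    exact tendsto_crossSum_right hπ hΩ hQ hφ hψ hx t

end CrossLimits

/-! ### The bracket of two integrands -/

section Bracket

variable {m : ℕ} {π : PartitionSeq} {Ω : Set (Traj m)} {F : Functional m ℝ}
  {φ ψ : Functional m (EuclideanSpace ℝ (Fin m))} {x : Traj m}

/-- For `t > 0` a bump alters only the jump, so the jump relation makes `F` affine in `e` near `0`.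
At time `0` that relation is empty, and the gradient has to be supplied by `h0`. -/
theorem IsPrimitive.hasGradientAt (hΩ : IsGeneric π Ω) (hF : IsPrimitive π Ω F φ)
    (h0 : ∀ x ∈ Ω, HasGradientAt (fun e => F 0 (bump x 0 e)) (φ 0 (stopAt x 0)) 0)
    {z : ℝ≥0 × Traj m} (hz : z ∈ domain Ω) :
    HasGradientAt (fun e => F z.1 (bump z.2 z.1 e)) (φ z.1 z.2) 0 := by
  obtain ⟨t, x⟩ := z
  have hcausal := hF.causal _ hz
  obtain ⟨hx, hxt⟩ := hΩ.mem_domain_iff.1 hz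
  simp only [leftVersion] at hcausal ⊢
  rcases eq_or_ne t 0 with rfl | ht
  · have h := h0 x hx
    rwa [hxt] at h
  replace ht := pos_iff_ne_zero.2 ht
  obtain ⟨U, hU, -, -, hUΩ⟩ := hΩ.bump_mem x hx t
  have hlin : HasGradientAt (fun e => (F t (stopLeft x t) +
      inner ℝ (φ t (stopLeft x t)) (jump x t)) + inner ℝ (φ t (stopLeft x t)) e)
      (φ t (stopLeft x t)) 0 := by
    rw [hasGradientAt_iff_hasFDerivAt]
    exact ((InnerProductSpace.toDual ℝ _ (φ t (stopLeft x t))).hasFDerivAt).const_add _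
  rw [hcausal]
  refine hlin.congr_of_eventuallyEq ?_
  filter_upwards [hU] with e he
  have h := hF.jump_eq _ (hUΩ e he) t
  rw [stopAt_bump, stopLeft_bump (hΩ.cadlag x hx) ht, jump_bump (hΩ.cadlag x hx) ht,
    inner_add_right, ← add_assoc] at h
  exact h

theorem IsPrimitive.vertDeriv_eq (hΩ : IsGeneric π Ω) (hF : IsPrimitive π Ω F φ)
    (h0 : ∀ x ∈ Ω, HasGradientAt (fun e => F 0 (bump x 0 e)) (φ 0 (stopAt x 0)) 0)
    {z : ℝ≥0 × Traj m} (hz : z ∈ domain Ω) : vertDeriv F z.1 z.2 = φ z.1 z.2 :=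
  (hF.hasGradientAt hΩ h0 hz).gradient

theorem HorizConst.tendsto_quotient (hΩ : IsGeneric π Ω) (hF : HorizConst Ω F)
    {z : ℝ≥0 × Traj m} (hz : z ∈ domain Ω) :
    Tendsto (fun h : ℝ≥0 => (F (z.1 + h) z.2 - F z.1 z.2) / (h : ℝ)) (𝓝[>] 0) (𝓝 0) := by
  obtain ⟨hx, hxt⟩ := hΩ.mem_domain_iff.1 hz
  refine tendsto_const_nhds.congr fun h => ?_
  have h1 := hF z.2 hx z.1 (z.1 + h) le_self_add
  rw [hxt] at h1
  rw [h1, sub_self, zero_div]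

theorem HorizConst.horizDeriv_eq (hΩ : IsGeneric π Ω) (hF : HorizConst Ω F)
    {z : ℝ≥0 × Traj m} (hz : z ∈ domain Ω) : horizDeriv F z.1 z.2 = 0 := by
  have hne : (𝓝[>] (0 : ℝ≥0)).NeBot := inferInstance
  exact (hF.tendsto_quotient hΩ hz).limUnder_eq

/-- Converse to `exists_isPrimitive_of_mem_Lb`, up to the gradient at time `0`. -/
theorem IsPrimitive.classMb (hΩ : IsGeneric π Ω) (hF : IsPrimitive π Ω F φ)
    (h0 : ∀ x ∈ Ω, HasGradientAt (fun e => F 0 (bump x 0 e)) (φ 0 (stopAt x 0)) 0) :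
    ClassMb π Ω F := by
  have hvert := fun z hz => hF.vertDeriv_eq hΩ h0 (z := z) hz
  have hhor := fun z hz => hF.horizConst.horizDeriv_eq hΩ (z := z) hz
  refine ⟨⟨⟨hF.continuous, fun z hz => ⟨0, hF.horizConst.tendsto_quotient hΩ hz⟩,
    fun z hz => (hF.hasGradientAt hΩ h0 hz).differentiableAt,
    (rightCont_const (0 : ℝ)).congr hΩ fun z hz => (hhor z hz).symm, fun x hx T => ?_,
    hF.leftCont.congr hΩ fun z hz => (hvert z hz).symm, fun z hz => ?_⟩, hhor⟩, fun x hx T => ?_⟩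
  · obtain ⟨n₀, h⟩ := eventually_atTop.1 (hΩ.approx_mem_domain hx T)
    refine ⟨n₀, 0, fun n hn t ht => ?_⟩
    rw [hhor _ (h n hn t ht).1, norm_zero]
  · obtain ⟨hx, -⟩ := hΩ.mem_domain_iff.1 hz
    rw [leftVersion, hvert z hz, hvert _ (hΩ.stopLeft_mem_domain hx z.1)]
    exact hF.causal z hz
  · obtain ⟨K, hK⟩ := hF.bounded x hx T
    obtain ⟨n₀, h⟩ := eventually_atTop.1 ((hΩ.approx_mem_domain hx T).and hK)
    refine ⟨n₀, K, fun n hn t ht => ?_⟩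
    obtain ⟨h1, h2⟩ := h n hn
    have h3 := hF.causal _ (h1 t ht).1
    simp only [leftVersion, stopLeft_stopAt_of_le le_rfl] at h3
    rw [hvert _ (h1 t ht).1, h3]
    exact h2 t ht

/-- The product of the integrals minus the cross integral. -/
noncomputable def bracketPrimitive (π : PartitionSeq)
    (φ ψ : Functional m (EuclideanSpace ℝ (Fin m))) : Functional m ℝ :=
  fun t x => pathIntegral π φ t x * pathIntegral π ψ t x - crossIntegral π φ ψ t x

theorem bracket_stopLeft (t : ℝ≥0) : bracket π φ ψ t (stopLeft x t) =
    pathIntegral π φ t (stopLeft x t) • ψ t (stopLeft x t) +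
      pathIntegral π ψ t (stopLeft x t) • φ t (stopLeft x t) := by
  simp only [bracket, leftVersion, stopLeft_stopLeft]

/-- The jump relation is the product rule `(A + a)(B + b) - AB = Ab + Ba + ab` with `a = φ · Δx` and
`b = ψ · Δx`; the term `ab` is cancelled by the jump of the cross integral. -/
theorem isPrimitive_bracketPrimitive (hπ : π.VanishingMesh) (hΩ : IsGeneric π Ω)
    (hQ : Ω ⊆ finiteQV m π) {A B : Functional m ℝ} (hA : IsPrimitive π Ω A φ)
    (hB : IsPrimitive π Ω B ψ) : IsPrimitive π Ω (bracketPrimitive π φ ψ) (bracket π φ ψ) := by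
  replace hA := hA.isPrimitive_pathIntegral hπ hΩ
  replace hB := hB.isPrimitive_pathIntegral hπ hΩ
  have hφ := hA.isIntegrand
  have hψ := hB.isIntegrand
  refine ⟨(hA.continuous.mul hB.continuous).sub (piContinuous_crossIntegral hπ hΩ hQ hφ hψ),
    fun x hx t s hts => ?_, fun x hx t => ?_, ?_, fun z _ => ?_, fun x hx T => ?_⟩
  · simp only [bracketPrimitive]
    rw [hA.horizConst x hx t s hts, hB.horizConst x hx t s hts,
      horizConst_crossIntegral hπ hΩ hQ hφ hψ x hx t s hts]
  · simp only [bracketPrimitive]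
    rw [hA.jump_eq x hx t, hB.jump_eq x hx t, crossIntegral_jump_eq hπ hΩ hQ hφ hψ hx t,
      bracket_stopLeft, inner_add_left, real_inner_smul_left, real_inner_smul_left, crossJump]
    ring
  · have h1 := (hA.continuous.leftCont hΩ).comp₂ (g := fun (a : ℝ)
      (v : EuclideanSpace ℝ (Fin m)) => a • v) (by fun_prop) hB.leftCont
    have h2 := (hB.continuous.leftCont hΩ).comp₂ (g := fun (a : ℝ)
      (v : EuclideanSpace ℝ (Fin m)) => a • v) (by fun_prop) hA.leftCont
    exact (h1.comp₂ (g := fun v w : EuclideanSpace ℝ (Fin m) => v + w) (by fun_prop)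
      h2).leftVersion
  · simp only [bracket, leftVersion, stopLeft_stopLeft]
  · obtain ⟨K₁, h₁⟩ := hA.continuous.bounded hπ hΩ hx T
    obtain ⟨K₂, h₂⟩ := hB.continuous.bounded hπ hΩ hx T
    obtain ⟨K₃, h₃⟩ := hA.bounded x hx T
    obtain ⟨K₄, h₄⟩ := hB.bounded x hx T
    refine ⟨K₁ * K₄ + K₂ * K₃, ?_⟩
    filter_upwards [h₁, h₂, h₃, h₄] with n h₁ h₂ h₃ h₄ t ht
    rw [bracket_stopLeft]
    refine (norm_add_le _ _).trans (add_le_add ?_ ?_) <;> rw [norm_smul]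
    · exact mul_le_mul (h₁ t ht) (h₄ t ht) (norm_nonneg _) ((abs_nonneg _).trans (h₁ t ht))
    · exact mul_le_mul (h₂ t ht) (h₃ t ht) (norm_nonneg _) ((abs_nonneg _).trans (h₂ t ht))

theorem bracketPrimitive_zero (hπ : π.VanishingMesh) (hΩ : IsGeneric π Ω) {A : Functional m ℝ}
    (hA : IsPrimitive π Ω A φ) (hx : x ∈ Ω) : bracketPrimitive π φ ψ 0 (stopAt x 0) = 0 := by
  rw [bracketPrimitive, hA.pathIntegral_zero hπ hΩ hx, crossIntegral_zero, zero_mul, sub_zero]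

theorem bracket_mem_Lb (hπ : π.VanishingMesh) (hΩ : IsGeneric π Ω)
    (hQ : Ω ⊆ finiteQV m π) {A B : Functional m ℝ} (hA : IsPrimitive π Ω A φ)
    (hB : IsPrimitive π Ω B ψ) : bracket π φ ψ ∈ Lb π Ω := by
  have hH := isPrimitive_bracketPrimitive hπ hΩ hQ hA hB
  have h0 : ∀ x ∈ Ω, HasGradientAt (fun e => bracketPrimitive π φ ψ 0 (bump x 0 e))
      (bracket π φ ψ 0 (stopAt x 0)) 0 := by
    intro x hx
    -- At time `0` both integrals vanish on all bumped paths, so the primitive is locally zero in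
    -- `e` and its gradient matches the bracket, which is zero too.
    have h1 : bracket π φ ψ 0 (stopAt x 0) = 0 := by
      rw [← stopLeft_zero, bracket_stopLeft, stopLeft_zero, hA.pathIntegral_zero hπ hΩ hx,
        hB.pathIntegral_zero hπ hΩ hx, zero_smul, zero_smul, add_zero]
    rw [h1]
    obtain ⟨U, hU, -, -, hUΩ⟩ := hΩ.bump_mem x hx 0
    refine (hasGradientAt_const 0 (0 : ℝ)).congr_of_eventuallyEq ?_
    filter_upwards [hU] with e he
    rw [← stopAt_bump, bracketPrimitive_zero hπ hΩ hA (hUΩ e he)]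
  exact ⟨_, hH.classMb hΩ h0, fun z hz => (hH.vertDeriv_eq hΩ h0 hz).symm⟩

end Bracket

end CausalCalculus

open CausalCalculus
theorem mainTheorem8 {m : ℕ} (π : PartitionSeq) (hπ : π.VanishingMesh)
    (Ω : Set (Traj m)) (hΩ : IsGeneric π Ω) (hQ : Ω ⊆ finiteQV m π)
    (φ ψ : Functional m (EuclideanSpace ℝ (Fin m))) (hφ : φ ∈ Lb π Ω) (hψ : ψ ∈ Lb π Ω) :
    PathIntegrable π Ω φ ∧ PathIntegrable π Ω ψ ∧
    bracket π φ ψ ∈ Lb π Ω ∧ PathIntegrable π Ω (bracket π φ ψ) ∧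
    ∀ x ∈ Ω, ∀ t : ℝ≥0,
      (∀ i j : Fin m, StieltjesIntegrable
        (fun s => φ s (stopLeft x s) i * ψ s (stopLeft x s) j) (fun s => quadVar π x s i j) t) ∧
      pathIntegral π φ t (stopAt x t) * pathIntegral π ψ t (stopAt x t) =
        (∑ i : Fin m, ∑ j : Fin m, stieltjesIntegral
          (fun s => φ s (stopLeft x s) i * ψ s (stopLeft x s) j) (fun s => quadVar π x s i j) t) +
        pathIntegral π (bracket π φ ψ) t (stopAt x t) := by
  obtain ⟨A, hA⟩ := exists_isPrimitive_of_mem_Lb hΩ hφ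
  obtain ⟨B, hB⟩ := exists_isPrimitive_of_mem_Lb hΩ hψ
  have hH := isPrimitive_bracketPrimitive hπ hΩ hQ hA hB
  refine ⟨hA.pathIntegrable hπ hΩ, hB.pathIntegrable hπ hΩ, bracket_mem_Lb hπ hΩ hQ hA hB,
    hH.pathIntegrable hπ hΩ, fun x hx t => ⟨fun i j =>
      (tendsto_entry hπ hΩ hQ hA.isIntegrand hB.isIntegrand hx t i j).1, ?_⟩⟩
  rw [hH.pathIntegral_eq hπ hΩ hx t, bracketPrimitive_zero hπ hΩ hA hx, sub_zero, bracketPrimitive,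
    crossIntegral_stopAt hπ hΩ hQ hA.isIntegrand hB.isIntegrand hx, crossIntegral]
  ring
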